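/- Consider the linear system $x_{t+1}=Ax_t+B_uu_t+B_ww_t$, $t\in\mathbb Z$, with real matrices $A\in\mathbb R^{d_x\times d_x}$, $B_u\in\mathbb R^{d_x\times d_u}$, $B_w\in\mathbb R^{d_x\times d_w}$, where $(A,B_u)$ and $(A,B_w)$ are stabilizable. For $p\in[1,\infty]$ let $L_p$ be the space of (real) block Laurent operators $\mathcal M$, with blocks $\widehat M_k$, whose transfer matrix $M(e^{j\omega})=\sum_{k\in\mathbb Z}\widehat M_ke^{-j\omega k}$ has entries in $L_p$ of the unit circle, and let $H_p\subset L_p$ be the causal ones ($\widehat M_k=0$ for $k<0$); all block sizes are allowed. Put $\operatorname{tr}(\mathcal M)=\frac1{2\pi}\int_0^{2\pi}\operatorname{Tr}M(e^{j\omega})\,d\omega$, $\|\mathcal M\|_2^2=\operatorname{tr}(\mathcal M^*\mathcal M)$ and $\|\mathcal M\|_\infty=\operatorname{ess\,sup}_\omega\overline\sigma(M(e^{j\omega}))$, where $\overline\sigma$ is the largest singular value; $\mathcal M\succeq0$ means that $M(e^{j\omega})$ is Hermitian positive semidefinite for almost every $\omega$. For a causal controller $\mathcal K\in H_\infty^{d_u\times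 d_w}$, $u=\mathcal Kw$, let $\mathcal T_{\mathcal K}=\begin{bmatrix}\mathcal F\mathcal K+\mathcal G\\ \mathcal K\end{bmatrix}:w\mapsto(x,u)$ be the causal closed-loop operator; here $\mathcal F,\mathcal G$ are strictly causal with transfer matrices $(zI-A)^{-1}B_u$, $(zI-A)^{-1}B_w$, i.e. with blocks $A^{k-1}B_u$, $A^{k-1}B_w$ for $k\ge1$. If $\mathcal T_{\mathcal K}\notin H_2$, then $\|\mathcal T_{\mathcal K}\|_2$, $\|\mathcal T_{\mathcal K}\|_\infty$ and the weighted costs $\operatorname{tr}(\mathcal T_{\mathcal K}^*\mathcal T_{\mathcal K}(\mathcal I+\Lambda))$ below are $+\infty$. Let $\gamma_\infty=\inf_{\mathcal K\in H_\infty}\|\mathcal T_{\mathcal K}\|_\infty$, and let $\gamma_2=\|\mathcal T_{\mathcal K_2}\|_\infty$, where $\mathcal K_2$ minimizes $\|\mathcal T_{\mathcal K}\|_2$ over $\mathcal K\in H_\infty$. **Theorem (strong duality).** Let $\gamma\in(\gamma_\infty,\gamma_2)$. For $\Lambda\in L_1^{d_w\times d_w}$, $\Lambda\succeq0$, and $\mathcal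 K\in H_\infty^{d_u\times d_w}$ let $$\mathcal L(\mathcal K,\Lambda)=\operatorname{tr}\bigl(\mathcal T_{\mathcal K}^*\mathcal T_{\mathcal K}(\mathcal I+\Lambda)\bigr)-\gamma^2\operatorname{tr}(\Lambda).$$ Then for every such $\Lambda$ the minimum of $\mathcal L(\cdot,\Lambda)$ over $H_\infty^{d_u\times d_w}$ is attained, and the mixed $H_2/H_\infty$ problem is equivalent to the max-min problem: $$\min_{\substack{\mathcal K\in H_\infty\\ \|\mathcal T_{\mathcal K}\|_\infty\le\gamma}}\|\mathcal T_{\mathcal K}\|_2^2=\max_{\substack{\Lambda\in L_1\\ \Lambda\succeq0}}\ \min_{\mathcal K\in H_\infty}\mathcal L(\mathcal K,\Lambda),$$ where the common value is finite and the outer minimum on the left and the maximum on the right are attained. Moreover, for every maximizing $\Lambda$, a controller $\mathcal K$ solves the mixed $H_2/H_\infty$ problem if and only if $\mathcal K\in H_\infty$ minimizes $\mathcal L(\cdot,\Lambda)$ over $H_\infty$. -/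

import Mathlib

open MeasureTheory
open scoped ENNReal Matrix ComplexOrder

noncomputable section

namespace MixedControl

/-! ### Block Laurent operators, represented by their transfer matrices on the unit circle

The point `θ` of `ℝ / ℤ` stands for `e^{jω}` with `ω = 2πθ`; the normalized measure `dω / 2π` is the
Haar probability measure. A transfer matrix is `M(z) = ∑ₖ M̂ₖ z⁻ᵏ`, where `M̂ₖ` are the blocks of the
operator (its Markov parameters). -/

/-- The normalized Lebesgue measure `dω / 2π` on the circle. -/
abbrev circ : Measure UnitAddCircle := AddCircle.haarAddCircle

/-- Transfer matrices restricted to the unit circle, `θ ↦ M(e^{2πjθ})`. -/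
abbrev TransferMatrix (m n : Type) : Type := UnitAddCircle → Matrix m n ℂ

/-- The `k`-th block `M̂ₖ` of the Laurent operator with transfer matrix `M`, that is, the coefficient
of `z⁻ᵏ`. -/
def markov {m n : Type} (M : TransferMatrix m n) (k : ℤ) : Matrix m n ℂ :=
  Matrix.of fun i j => fourierCoeff (fun θ => M θ i j) (-k)

/-- `M ∈ L_p`: the transfer matrix has finite `L_p` norm on the unit circle, and the blocks of the
operator are real (the signals are real vector valued). -/
structure MemL {m n : Type} (p : ℝ≥0∞) (M : TransferMatrix m n) : Prop where
  memLp : ∀ i j, MemLp (fun θ => M θ i j) p circ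
  real : ∀ k i j, (markov M k i j).im = 0

/-- `M ∈ H_p`: an element of `L_p` that is causal. -/
structure MemH {m n : Type} (p : ℝ≥0∞) (M : TransferMatrix m n) : Prop extends MemL p M where
  causal : ∀ k : ℤ, k < 0 → markov M k = 0

section
open scoped Matrix.Norms.L2Operator

/-- The `H_∞` norm `ess sup_ω σ̄(M(e^{jω}))`, where `σ̄` is the largest singular value. -/
def hinf {m n : Type} [Fintype m] [Fintype n] [DecidableEq n] (M : TransferMatrix m n) : ℝ≥0∞ :=
  essSup (fun θ => ENNReal.ofReal ‖M θ‖) circ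

end

/-- `tr(M* M W) = ∫ Tr(M(e^{jω})* M(e^{jω}) W(e^{jω})) dω/2π` for a positive semidefinite weight `W`;
possibly infinite. -/
def wtrace {m n : Type} [Fintype m] [Fintype n] (M : TransferMatrix m n) (W : TransferMatrix n n) : ℝ≥0∞ :=
  ∫⁻ θ, ENNReal.ofReal ((M θ)ᴴ * M θ * W θ).trace.re ∂circ

/-- `‖M‖₂² = tr(M* M)`. -/
def h2sq {m n : Type} [Fintype m] [Fintype n] (M : TransferMatrix m n) : ℝ≥0∞ :=
  ∫⁻ θ, ENNReal.ofReal ((M θ)ᴴ * M θ).trace.re ∂circ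

/-- The normalized trace `tr(Λ) = ∫ Tr(Λ(e^{jω})) dω/2π`, for a self-adjoint `Λ ∈ L_1`. -/
def ntrace {n : Type} [Fintype n] (L : TransferMatrix n n) : ℝ :=
  ∫ θ, (L θ).trace.re ∂circ

/-! ### The control system -/

/-- The system `x_{t+1} = A x_t + B_u u_t + B_w w_t`. -/
structure System (dx du dw : ℕ) where
  A : Matrix (Fin dx) (Fin dx) ℝ
  Bu : Matrix (Fin dx) (Fin du) ℝ
  Bw : Matrix (Fin dx) (Fin dw) ℝ

/-- Stabilizability of `(A, B)`: some feedback makes `A + B L` a Schur matrix. -/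
def Stabilizable {n m : ℕ} (A : Matrix (Fin n) (Fin n) ℝ) (B : Matrix (Fin n) (Fin m) ℝ) : Prop :=
  ∃ L : Matrix (Fin m) (Fin n) ℝ,
    ∀ z ∈ spectrum ℂ ((A + B * L).map Complex.ofReal), ‖z‖ < 1

/-- Markov parameters of the strictly causal operator with transfer matrix `(zI - A)⁻¹ B`. -/
def markovSS {n m : ℕ} (A : Matrix (Fin n) (Fin n) ℝ) (B : Matrix (Fin n) (Fin m) ℝ) :
    ℕ → Matrix (Fin n) (Fin m) ℝ
  | 0 => 0
  | k + 1 => A ^ k * B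

section
variable {dx du dw : ℕ}

/-- Markov parameters of the causal closed-loop operator `T_K = [F K + G; K] : w ↦ (x, u)`. -/
def closedLoopMarkov (S : System dx du dw) (K : TransferMatrix (Fin du) (Fin dw)) (k : ℕ) :
    Matrix (Fin dx ⊕ Fin du) (Fin dw) ℂ :=
  Matrix.fromRows
    (∑ p ∈ Finset.HasAntidiagonal.antidiagonal k,
        (markovSS S.A S.Bu p.1).map Complex.ofReal * markov K (p.2 : ℤ)
      + (markovSS S.A S.Bw k).map Complex.ofReal)
    (markov K (k : ℤ))

/-- `T ∈ H_2` is the transfer matrix of the closed-loop operator `T_K`. It is determined by `K` up to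
a null set. It always exists when `A` is a Schur matrix; for other `A` its existence says that
`‖T_K‖₂` is finite. -/
def IsClosedLoop (S : System dx du dw) (K : TransferMatrix (Fin du) (Fin dw))
    (T : TransferMatrix (Fin dx ⊕ Fin du) (Fin dw)) : Prop :=
  MemH 2 T ∧ ∀ k : ℕ, markov T (k : ℤ) = closedLoopMarkov S K k

/-- The value `Φ(T_K)` of a functional (that does not see null sets) at the closed-loop transfer
matrix, and `∞` if the closed-loop operator is not in `H_2`. -/
def atClosedLoop (S : System dx du dw) (K : TransferMatrix (Fin du) (Fin dw))
    (Φ : TransferMatrix (Fin dx ⊕ Fin du) (Fin dw) → ℝ≥0∞) : ℝ≥0∞ :=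
  ⨅ (T : TransferMatrix (Fin dx ⊕ Fin du) (Fin dw)) (_ : IsClosedLoop S K T), Φ T

/-- `‖T_K‖_∞`. -/
def clHinf (S : System dx du dw) (K : TransferMatrix (Fin du) (Fin dw)) : ℝ≥0∞ :=
  atClosedLoop S K hinf

/-- `‖T_K‖₂²`. -/
def clH2sq (S : System dx du dw) (K : TransferMatrix (Fin du) (Fin dw)) : ℝ≥0∞ :=
  atClosedLoop S K h2sq

/-- The causal bounded controllers, `K ∈ H_∞`. -/
def controllers (du dw : ℕ) : Set (TransferMatrix (Fin du) (Fin dw)) :=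
  {K | MemH ∞ K}

/-- `γ_∞ = min ‖T_K‖_∞` over `K ∈ H_∞`. -/
def gammaInf (S : System dx du dw) : ℝ≥0∞ :=
  ⨅ K ∈ controllers du dw, clHinf S K

/-- `γ_2 = ‖T_{K_2}‖_∞`, where `K_2` is the minimizer (unique up to null sets) of `‖T_K‖₂` over
`K ∈ H_∞`. -/
def gammaTwo (S : System dx du dw) : ℝ≥0∞ :=
  ⨅ K₂ ∈ {K ∈ controllers du dw | IsMinOn (clH2sq S) (controllers du dw) K}, clHinf S K₂

/-- The controllers `K ∈ H_∞` with `‖T_K‖_∞ ≤ γ`. -/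
def feasible (S : System dx du dw) (γ : ℝ) : Set (TransferMatrix (Fin du) (Fin dw)) :=
  {K ∈ controllers du dw | clHinf S K ≤ ENNReal.ofReal γ}

/-- The dual variables: `Λ ∈ L_1`, self-adjoint and positive semidefinite. -/
def multipliers (dw : ℕ) : Set (TransferMatrix (Fin dw) (Fin dw)) :=
  {L | MemL 1 L ∧ ∀ᵐ θ ∂circ, (L θ).PosSemidef}

/-- The Lagrangian `tr(T_K* T_K (I + Λ)) - γ² tr(Λ)`, with values in `(-∞, ∞]`. -/
def lagrangian (S : System dx du dw) (γ : ℝ) (K : TransferMatrix (Fin du) (Fin dw))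
    (L : TransferMatrix (Fin dw) (Fin dw)) : EReal :=
  ((atClosedLoop S K fun T => wtrace T (fun θ => 1 + L θ) : ℝ≥0∞) : EReal)
    - ((γ ^ 2 * ntrace L : ℝ) : EReal)

/-- The dual function: the infimum of the Lagrangian over `K ∈ H_∞`. -/
def dualFunction (S : System dx du dw) (γ : ℝ) (L : TransferMatrix (Fin dw) (Fin dw)) : EReal :=
  ⨅ K ∈ controllers du dw, lagrangian S γ K L

end

end MixedControl

end

/-!
The closed loops of controllers in `H_∞` are exactly those solutions `T = [X; U]` in `H_2` of the
state equation `z X = A X + B_u U + B_w` whose input block `U` is essentially bounded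
(`isClosedLoop_iff`). The solutions in `H_2` form an affine set `loops S`, closed in `L_2`. With a
stabilizing solution of the Riccati equation of the linear quadratic regulator, its elements are
`T = inner * V + drift` with `V` in `H_2` arbitrary and `innerᴴ * inner` a constant positive definite
matrix. So the theorem splits into a duality on the convex set `loops S` and the regularity of the
closed loops that are optimal there.

*The inner minimum.* For a dual variable `Λ`, the cost `tr (T* T (I + Λ))` dominates the squared
`H_2` norm, so the parallelogram identity and Fatou's lemma give a minimizer on `loops S`, with
quadratic growth around it (`exists_wtrace_minimizer`). This minimizer `T` is bounded although `Λ` is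
only integrable (`Regulator.memH_top_of_minimizer`): put `E = innerᴴ * T`. The optimality conditions
express the Laurent coefficients of `tr (E (I + Λ) Eᴴ)` through powers of the stable closed-loop
matrix. They decay geometrically, so this trace is bounded, and because `I + Λ ≥ I`, so are `E` and
`T`. Hence the minimum is attained by a controller in `H_∞`.

*No duality gap.* The dual function is concave, with a gain that is quadratic in the distance of the
minimizers. Therefore the minimizers along a maximizing sequence of dual variables form a Cauchy
sequence in `L_2`, and the limit satisfies the saddle inequality against every dual variable
(`Regulator.exists_saddle`). Dual variables `x xᴴ` supported on small sets of frequencies turn this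
inequality into `‖T‖_∞ ≤ γ` (`opNorm_le_of_wtrace_le`), and `Λ = 0` bounds the `H_2` norm of the
limit by the dual value.

*Attainment of the dual maximum.* As `γ > γ_∞`, some closed loop `T₀` is strictly feasible, and this
bounds the traces of the dual variables with nearly maximal value. Maximizing a strictly concave
functional among those yields an almost everywhere convergent maximizing sequence
(`exists_tendsto_multipliers`), as in Komlós' theorem. Its mass may still escape on sets of
frequencies of vanishing measure, since `L_1` is not a dual space. Such mass does not help the dual
player: a Szegő extremal function `g` (`exists_szego`) is causal, close to `1` in `L_2` and small on
the exceptional sets, so that `T₀ + g (T - T₀)` is a closed loop that nearly costs as much as the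
minimizer `T` of the limit and meets the bound `γ` where the mass escapes. Hence the limit is
optimal (`Regulator.le_dualValue_of_tendsto`).

*Equality of the solution sets.* By quadratic growth the minimizer of the Lagrangian at a maximizing
`Λ` is unique up to null sets (`IsDualMinimizer.ae_eq`). Every solution of the mixed problem
minimizes that Lagrangian, because there is no gap; so the two sets of solutions coincide.
-/

noncomputable section

namespace MixedControl

open Filter Topology ComplexConjugate

/-! ### Laurent coefficients of functions on the circle -/

/-- The coefficient of `z⁻ᵏ` in the Laurent series `∑ₖ f̂ₖ z⁻ᵏ` of a scalar function on the circle. -/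
def zcoeff (f : UnitAddCircle → ℂ) (k : ℤ) : ℂ := fourierCoeff f (-k)

/-- A scalar function on the circle whose Laurent coefficients vanish at all negative times. -/
def Causal (f : UnitAddCircle → ℂ) : Prop := ∀ k : ℤ, k < 0 → zcoeff f k = 0

/-- The symmetry `f(z̄) = conj f(z)` that expresses, in the frequency domain, that the Laurent
coefficients of `f` are real. -/
def ConjSymm (f : UnitAddCircle → ℂ) : Prop := ∀ᵐ θ ∂circ, f (-θ) = conj (f θ)

theorem zcoeff_eq (f : UnitAddCircle → ℂ) (k : ℤ) :
    zcoeff f k = ∫ θ, fourier k θ * f θ ∂circ := by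
  simp [zcoeff, fourierCoeff]

theorem norm_fourier_apply (k : ℤ) (θ : UnitAddCircle) : ‖fourier k θ‖ = 1 := by
  rw [fourier_apply, Circle.norm_coe]

theorem zcoeff_congr_ae {f g : UnitAddCircle → ℂ} (h : f =ᵐ[circ] g) (k : ℤ) :
    zcoeff f k = zcoeff g k := by
  rw [zcoeff, zcoeff, fourierCoeff_congr_ae h]

theorem integrable_fourier_mul {f : UnitAddCircle → ℂ} (hf : Integrable f circ) (k : ℤ) :
    Integrable (fun θ => fourier k θ * f θ) circ := by
  simpa using hf.fourier_smul k

theorem zcoeff_add {f g : UnitAddCircle → ℂ} (hf : Integrable f circ) (hg : Integrable g circ)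
    (k : ℤ) : zcoeff (fun θ => f θ + g θ) k = zcoeff f k + zcoeff g k := by
  simp only [zcoeff_eq, mul_add]
  exact integral_add (integrable_fourier_mul hf k) (integrable_fourier_mul hg k)

theorem zcoeff_sub {f g : UnitAddCircle → ℂ} (hf : Integrable f circ) (hg : Integrable g circ)
    (k : ℤ) : zcoeff (fun θ => f θ - g θ) k = zcoeff f k - zcoeff g k := by
  simp only [zcoeff_eq, mul_sub]
  exact integral_sub (integrable_fourier_mul hf k) (integrable_fourier_mul hg k)

theorem zcoeff_sum {ι : Type*} (s : Finset ι) {f : ι → UnitAddCircle → ℂ}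
    (hf : ∀ i ∈ s, Integrable (f i) circ) (k : ℤ) :
    zcoeff (fun θ => ∑ i ∈ s, f i θ) k = ∑ i ∈ s, zcoeff (f i) k := by
  simp only [zcoeff_eq, Finset.mul_sum]
  exact integral_finsetSum s fun i hi => integrable_fourier_mul (hf i hi) k

theorem zcoeff_const_mul (c : ℂ) (f : UnitAddCircle → ℂ) (k : ℤ) :
    zcoeff (fun θ => c * f θ) k = c * zcoeff f k := by
  simp only [zcoeff_eq, mul_left_comm _ c]
  exact integral_const_mul c _

theorem zcoeff_fourier_mul (f : UnitAddCircle → ℂ) (n k : ℤ) :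
    zcoeff (fun θ => fourier n θ * f θ) k = zcoeff f (k + n) := by
  simp only [zcoeff_eq, fourier_add, mul_assoc]

theorem zcoeff_const (c : ℂ) (k : ℤ) : zcoeff (fun _ => c) k = if k = 0 then c else 0 := by
  have h : zcoeff (fun _ => c) k = c * zcoeff (fun θ => fourier 0 θ) k := by
    rw [← zcoeff_const_mul]; simp
  rw [h, zcoeff, fourierCoeff_fourier]
  by_cases hk : k = 0
  · simp [hk]
  · simp [hk]

theorem zcoeff_conj (f : UnitAddCircle → ℂ) (k : ℤ) :
    zcoeff (fun θ => conj (f θ)) k = conj (zcoeff f (-k)) := by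
  simp only [zcoeff_eq]
  rw [← integral_conj]
  simp [map_mul]

theorem zcoeff_conj_neg (f : UnitAddCircle → ℂ) (k : ℤ) :
    zcoeff (fun θ => conj (f (-θ))) k = conj (zcoeff f k) := by
  rw [zcoeff_conj, zcoeff_eq, zcoeff_eq, ← integral_neg_eq_self]
  simp

/-- An integrable function is determined by its Laurent coefficients. -/
theorem ae_eq_zero_of_zcoeff {f : UnitAddCircle → ℂ} (hf : Integrable f circ)
    (h : ∀ k, zcoeff f k = 0) : f =ᵐ[circ] 0 := by
  have hint : ∀ φ : C(UnitAddCircle, ℂ), Integrable (fun θ => φ θ * f θ) circ := fun φ =>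
    hf.bdd_mul φ.continuous.aestronglyMeasurable (ae_of_all _ fun x => φ.norm_coe_le_norm x)
  let ℓ : C(UnitAddCircle, ℂ) →L[ℂ] ℂ := LinearMap.mkContinuous
    { toFun := fun φ => ∫ θ, φ θ * f θ ∂circ
      map_add' := fun φ ψ => by
        simp only [ContinuousMap.add_apply, add_mul]
        exact integral_add (hint φ) (hint ψ)
      map_smul' := fun c φ => by
        simp only [ContinuousMap.smul_apply, smul_eq_mul, mul_assoc, RingHom.id_apply]
        exact integral_const_mul c _ } (∫ θ, ‖f θ‖ ∂circ) (by
      intro φ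
      simp only [LinearMap.coe_mk, AddHom.coe_mk]
      rw [mul_comm, ← integral_const_mul]
      refine norm_integral_le_of_norm_le (hf.norm.const_mul _) (ae_of_all _ fun x => ?_)
      rw [norm_mul]
      gcongr
      exact φ.norm_coe_le_norm x)
  have hℓ : ∀ φ, ℓ φ = 0 := by
    intro φ
    have hle : (⊤ : Submodule ℂ C(UnitAddCircle, ℂ)) ≤ ℓ.ker := by
      rw [← span_fourier_closure_eq_top]
      refine Submodule.topologicalClosure_minimal _ ?_ ℓ.isClosed_ker
      rw [Submodule.span_le]
      rintro _ ⟨k, rfl⟩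
      have := h k
      rw [zcoeff_eq] at this
      exact this
    exact hle (Submodule.mem_top (x := φ))
  refine ae_eq_zero_of_forall_setIntegral_isClosed_eq_zero hf fun s hs => ?_
  have hδ : ∀ n : ℕ, (0 : ℝ) < 1 / (n + 1) := fun n => by positivity
  have hδ0 : Tendsto (fun n : ℕ => (1 : ℝ) / (n + 1)) atTop (𝓝 0) :=
    tendsto_one_div_add_atTop_nhds_zero_nat
  have key := thickenedIndicator_tendsto_indicator_closure hδ hδ0 s
  rw [hs.closure_eq, tendsto_pi_nhds] at key
  rw [← integral_indicator hs.measurableSet]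
  have hlim : Tendsto (fun n : ℕ => ∫ θ, ((thickenedIndicator (hδ n) s θ : ℝ) : ℂ) * f θ ∂circ)
      atTop (𝓝 (∫ θ, s.indicator f θ ∂circ)) := by
    refine tendsto_integral_of_dominated_convergence (fun θ => ‖f θ‖) (fun n => ?_) hf.norm
      (fun n => ae_of_all _ fun x => ?_) (ae_of_all _ fun x => ?_)
    · refine AEStronglyMeasurable.mul (Continuous.aestronglyMeasurable ?_) hf.1
      fun_prop
    · rw [norm_mul]
      refine mul_le_of_le_one_left (norm_nonneg _) ?_
      have := thickenedIndicator_le_one (hδ n) s x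
      simpa using this
    · have h1 := (key x)
      have h2 : Tendsto (fun n : ℕ => ((thickenedIndicator (hδ n) s x : ℝ) : ℂ) * f x) atTop
          (𝓝 (((s.indicator (fun _ => (1 : NNReal)) x : NNReal) : ℝ) * f x)) := by
        refine Tendsto.mul_const _ ?_
        exact (Complex.continuous_ofReal.tendsto _).comp
          ((NNReal.continuous_coe.tendsto _).comp h1)
      convert h2 using 2
      by_cases hx : x ∈ s <;> simp [hx]
  have hzero : ∀ n : ℕ, ∫ θ, ((thickenedIndicator (hδ n) s θ : ℝ) : ℂ) * f θ ∂circ = 0 := fun n =>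
    hℓ ⟨fun θ => ((thickenedIndicator (hδ n) s θ : ℝ) : ℂ), by fun_prop⟩
  simp only [hzero] at hlim
  exact (tendsto_nhds_unique hlim tendsto_const_nhds)

theorem ae_eq_of_zcoeff {f g : UnitAddCircle → ℂ} (hf : Integrable f circ)
    (hg : Integrable g circ) (h : ∀ k, zcoeff f k = zcoeff g k) : f =ᵐ[circ] g := by
  have := ae_eq_zero_of_zcoeff (hf.sub hg) (fun k => by
    have := zcoeff_sub hf hg k
    rw [h k, sub_self] at this
    exact this)
  filter_upwards [this] with θ hθ
  exact sub_eq_zero.1 hθ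

theorem conjSymm_iff {f : UnitAddCircle → ℂ} (hf : Integrable f circ) :
    ConjSymm f ↔ ∀ k, (zcoeff f k).im = 0 := by
  have hg : Integrable (fun θ => conj (f (-θ))) circ := by
    have : Integrable (fun θ => f (-θ)) circ := hf.comp_neg
    exact (Complex.conjLIE.toLinearIsometry.toContinuousLinearMap).integrable_comp this
  constructor
  · intro h k
    have h1 : f =ᵐ[circ] fun θ => conj (f (-θ)) := by
      filter_upwards [h] with θ hθ
      simp [hθ]
    rw [← Complex.conj_eq_iff_im, ← zcoeff_conj_neg, zcoeff_congr_ae h1.symm]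
  · intro h
    have h1 : f =ᵐ[circ] fun θ => conj (f (-θ)) :=
      ae_eq_of_zcoeff hf hg fun k => by
        rw [zcoeff_conj_neg]; exact (Complex.conj_eq_iff_im.2 (h k)).symm
    filter_upwards [h1] with θ hθ
    rw [hθ]; simp

/-- The convolution formula for the Laurent coefficients of a product shows that causal
square integrable functions have a causal product. -/
theorem Causal.mul {f g : UnitAddCircle → ℂ} (hf : MemLp f 2 circ) (hg : MemLp g 2 circ)
    (hcf : Causal f) (hcg : Causal g) : Causal (fun θ => f θ * g θ) := by
  intro k hk
  have hu : MemLp (fun θ => conj (f θ)) 2 circ := hf.star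
  have hv : MemLp (fun θ => fourier k θ * g θ) 2 circ := by
    refine hg.of_le (AEStronglyMeasurable.mul (by fun_prop) hg.1) (ae_of_all _ fun x => ?_)
    rw [norm_mul, norm_fourier_apply, one_mul]
  have hs := fourierBasis.hasSum_inner_mul_inner (hu.toLp _) (hv.toLp _)
  have h0 : ∀ i : ℤ, inner ℂ (hu.toLp _) (fourierBasis i) * inner ℂ (fourierBasis i) (hv.toLp _)
      = 0 := by
    intro i
    have e1 : inner ℂ (hu.toLp _) (fourierBasis i) = zcoeff f i := by
      rw [← inner_conj_symm, ← HilbertBasis.repr_apply_apply, fourierBasis_repr,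
        fourierCoeff_congr_ae hu.coeFn_toLp]
      have := zcoeff_conj f (-i)
      rw [zcoeff, neg_neg] at this
      rw [this, Complex.conj_conj]
    have e2 : inner ℂ (fourierBasis i) (hv.toLp _) = zcoeff g (k - i) := by
      rw [← HilbertBasis.repr_apply_apply, fourierBasis_repr,
        fourierCoeff_congr_ae hv.coeFn_toLp]
      have := zcoeff_fourier_mul g k (-i)
      rw [zcoeff, neg_neg] at this
      rw [this]
      ring_nf
    rw [e1, e2]
    rcases lt_or_ge i 0 with hi | hi
    · rw [hcf i hi, zero_mul]
    · rw [hcg (k - i) (by omega), mul_zero]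
  simp only [h0] at hs
  have h1 := hs.unique hasSum_zero
  rw [L2.inner_def] at h1
  rw [zcoeff_eq, ← h1]
  refine integral_congr_ae ?_
  filter_upwards [hu.coeFn_toLp, hv.coeFn_toLp] with θ h2 h3
  rw [h2, h3]
  simp
  ring

/-- A function with summable Laurent coefficients is essentially bounded, since it agrees with the
uniform limit of its Laurent series. -/
theorem bounded_of_summable_zcoeff {f : UnitAddCircle → ℂ} (hf : Integrable f circ)
    (h : Summable fun k => ‖zcoeff f k‖) : ∃ C : ℝ, ∀ᵐ θ ∂circ, ‖f θ‖ ≤ C := by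
  have hs : Summable fun k : ℤ => zcoeff f k • (fourier (-k) : C(UnitAddCircle, ℂ)) := by
    refine Summable.of_norm ?_
    simpa [norm_smul, fourier_norm] using h
  have hint : ∀ φ : C(UnitAddCircle, ℂ), Integrable φ circ := fun φ =>
    φ.continuous.integrable_of_hasCompactSupport (HasCompactSupport.of_compactSpace φ)
  set g := ∑' k : ℤ, zcoeff f k • (fourier (-k) : C(UnitAddCircle, ℂ)) with hg
  refine ⟨‖g‖, ?_⟩
  have hfg : f =ᵐ[circ] g := by
    refine ae_eq_of_zcoeff hf (hint g) fun k => ?_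
    let ℓ : C(UnitAddCircle, ℂ) →L[ℂ] ℂ := LinearMap.mkContinuous
      { toFun := fun φ => zcoeff φ k
        map_add' := fun φ ψ => zcoeff_add (hint φ) (hint ψ) k
        map_smul' := fun c φ => zcoeff_const_mul c φ k } 1 (by
        intro φ
        simp only [LinearMap.coe_mk, AddHom.coe_mk, zcoeff_eq, one_mul]
        have := norm_integral_le_of_norm_le_const (μ := circ)
          (f := fun θ => fourier k θ * φ θ) (C := ‖φ‖)
          (ae_of_all _ fun x => by
            rw [norm_mul, norm_fourier_apply, one_mul]; exact φ.norm_coe_le_norm x)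
        simpa using this)
    have h1 : ℓ g = ∑' j : ℤ, ℓ (zcoeff f j • (fourier (-j) : C(UnitAddCircle, ℂ))) :=
      ℓ.map_tsum hs
    have h2 : ∀ j : ℤ, ℓ (zcoeff f j • (fourier (-j) : C(UnitAddCircle, ℂ)))
        = if j = k then zcoeff f k else 0 := by
      intro j
      rw [map_smul]
      change zcoeff f j • zcoeff (fun θ => fourier (-j) θ) k = _
      rw [zcoeff, zcoeff, fourierCoeff_fourier]
      by_cases hj : j = k
      · simp [hj, zcoeff]
      · have : -k ≠ -j := fun h => hj (neg_injective h).symm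
        simp [hj, this]
    have h3 : ℓ g = zcoeff f k := by
      rw [h1]; simp only [h2, tsum_ite_eq]
    exact h3.symm
  filter_upwards [hfg] with θ hθ
  rw [hθ]
  exact g.norm_coe_le_norm θ

/-- Laurent coefficients are continuous for convergence in `L₂`. -/
theorem tendsto_zcoeff {f : ℕ → UnitAddCircle → ℂ} {g : UnitAddCircle → ℂ}
    (hf : ∀ n, MemLp (f n) 2 circ) (hg : MemLp g 2 circ)
    (h : Tendsto (fun n => eLpNorm (fun θ => f n θ - g θ) 2 circ) atTop (𝓝 0)) (k : ℤ) :
    Tendsto (fun n => zcoeff (f n) k) atTop (𝓝 (zcoeff g k)) := by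
  simp only [zcoeff_eq]
  have hi := fun n => integrable_fourier_mul ((hf n).integrable one_le_two) k
  have hj := integrable_fourier_mul (hg.integrable one_le_two) k
  refine tendsto_integral_of_L1 _ hj.1 (Eventually.of_forall hi) ?_
  refine tendsto_of_tendsto_of_tendsto_of_le_of_le tendsto_const_nhds h (fun _ => zero_le) ?_
  intro n
  dsimp only
  calc ∫⁻ x, ‖fourier k x * f n x - fourier k x * g x‖ₑ ∂circ
      = eLpNorm (fun θ => f n θ - g θ) 1 circ := by
        rw [eLpNorm_one_eq_lintegral_enorm]
        refine lintegral_congr fun x => ?_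
        rw [← mul_sub, enorm_mul]
        have : ‖(fourier k x : ℂ)‖ₑ = 1 := by
          rw [← ofReal_norm, norm_fourier_apply, ENNReal.ofReal_one]
        rw [this, one_mul]
    _ ≤ eLpNorm (fun θ => f n θ - g θ) 2 circ :=
        eLpNorm_le_eLpNorm_of_exponent_le one_le_two ((hf n).1.sub hg.1)

/-! ### The Riccati equation of the linear quadratic regulator -/

section
attribute [local instance] Matrix.linftyOpNormedRing Matrix.linftyOpNormedAlgebra
  Matrix.linftyOpNormedAddCommGroup

theorem norm_apply_le_linftyOpNorm {n : ℕ} (M : Matrix (Fin n) (Fin n) ℂ) (i j : Fin n) :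
    ‖M i j‖ ≤ ‖M‖ := by
  have h1 : ‖M i j‖₊ ≤ ‖M‖₊ := by
    rw [Matrix.linfty_opNNNorm_def]
    exact (Finset.single_le_sum (f := fun j => ‖M i j‖₊) (fun _ _ => zero_le)
      (Finset.mem_univ j)).trans
      (Finset.le_sup (f := fun i => ∑ j, ‖M i j‖₊) (Finset.mem_univ i))
  exact_mod_cast h1

/-- The powers of a Schur matrix decay geometrically, by Gelfand's formula. -/
theorem exists_pow_entry_le {n : ℕ} (A : Matrix (Fin n) (Fin n) ℝ)
    (hA : ∀ z ∈ spectrum ℂ (A.map Complex.ofReal), ‖z‖ < 1) :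
    ∃ C r : ℝ, 0 ≤ C ∧ 0 ≤ r ∧ r < 1 ∧ ∀ k i j, |(A ^ k) i j| ≤ C * r ^ k := by
  rcases n with _ | n
  · exact ⟨0, 0, le_rfl, le_rfl, one_pos, fun k i => i.elim0⟩
  set a : Matrix (Fin (n + 1)) (Fin (n + 1)) ℂ := A.map Complex.ofReal with ha
  have h1 : spectralRadius ℂ a < (1 : NNReal) :=
    spectrum.spectralRadius_lt_of_forall_lt a fun z hz => by exact_mod_cast hA z hz
  obtain ⟨q, hq1, hq2⟩ := exists_between h1
  have hq2' : q < 1 := by simpa using hq2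
  lift q to NNReal using ne_top_of_lt hq2
  have hq3 : (q : ℝ) < 1 := by exact_mod_cast hq2'
  have h2 := (spectrum.pow_nnnorm_pow_one_div_tendsto_nhds_spectralRadius a).eventually_lt_const hq1
  obtain ⟨N, hN⟩ := eventually_atTop.1 (h2.and (eventually_ge_atTop 1))
  have h3 : ∀ k ≥ N, ‖a ^ k‖ ≤ (q : ℝ) ^ k := by
    intro k hk
    obtain ⟨h4, h5⟩ := hN k hk
    have hk0 : (0 : ℝ) < k := by exact_mod_cast h5
    have h6 : (‖a ^ k‖₊ : ℝ≥0∞) ≤ (q : ℝ≥0∞) ^ (k : ℝ) := by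
      have := ENNReal.rpow_le_rpow h4.le hk0.le
      rwa [← ENNReal.rpow_mul, one_div_mul_cancel hk0.ne', ENNReal.rpow_one] at this
    rw [ENNReal.rpow_natCast] at h6
    exact_mod_cast h6
  set r : ℝ := max q (1 / 2) with hr
  have hr0 : 0 < r := lt_of_lt_of_le (by norm_num) (le_max_right _ _)
  have hr1 : r < 1 := by
    rw [hr, max_lt_iff]
    exact ⟨hq3, by norm_num⟩
  have hs : 0 ≤ ∑ k ∈ Finset.range N, ‖a ^ k‖ / r ^ k :=
    Finset.sum_nonneg fun k _ => div_nonneg (norm_nonneg _) (pow_nonneg hr0.le _)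
  have hqr : (q : ℝ) ≤ r := le_max_left _ _
  clear_value r
  refine ⟨1 + ∑ k ∈ Finset.range N, ‖a ^ k‖ / r ^ k, r, by linarith, hr0.le, hr1,
    fun k i j => ?_⟩
  have h7 : |(A ^ k) i j| ≤ ‖a ^ k‖ := by
    have h8 : a ^ k = (A ^ k).map Complex.ofReal := by
      rw [ha]
      exact (map_pow (Complex.ofRealHom.mapMatrix) A k).symm
    calc |(A ^ k) i j| = ‖(a ^ k) i j‖ := by rw [h8]; simp
      _ ≤ ‖a ^ k‖ := norm_apply_le_linftyOpNorm _ i j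
  refine h7.trans ?_
  rcases le_or_gt N k with hk | hk
  · calc ‖a ^ k‖ ≤ (q : ℝ) ^ k := h3 k hk
      _ ≤ r ^ k := pow_le_pow_left₀ q.2 hqr k
      _ ≤ _ := le_mul_of_one_le_left (by positivity) (by linarith)
  · have h8 : ‖a ^ k‖ / r ^ k ≤ ∑ k ∈ Finset.range N, ‖a ^ k‖ / r ^ k :=
      Finset.single_le_sum (f := fun k => ‖a ^ k‖ / r ^ k) (fun _ _ => by positivity)
        (Finset.mem_range.2 hk)
    rw [div_le_iff₀ (by positivity)] at h8
    have : 0 < r ^ k := by positivity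
    nlinarith

end

section Riccati
variable {n m : ℕ} (A : Matrix (Fin n) (Fin n) ℝ) (B : Matrix (Fin n) (Fin m) ℝ)

/-- The cost matrix of one step of the feedback `u = L x`, followed by the terminal cost `P`. -/
def stepCost (L : Matrix (Fin m) (Fin n) ℝ) (P : Matrix (Fin n) (Fin n) ℝ) :
    Matrix (Fin n) (Fin n) ℝ :=
  1 + Lᵀ * L + (A + B * L)ᵀ * P * (A + B * L)

/-- The feedback gain that minimizes `stepCost A B L P` over `L`. -/
def greedyGain (P : Matrix (Fin n) (Fin n) ℝ) : Matrix (Fin m) (Fin n) ℝ :=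
  -((1 + Bᵀ * P * B)⁻¹ * (Bᵀ * P * A))

/-- Value iteration for the linear quadratic regulator, started from zero terminal cost. -/
def valueIter : ℕ → Matrix (Fin n) (Fin n) ℝ
  | 0 => 0
  | k + 1 => stepCost A B (greedyGain A B (valueIter k)) (valueIter k)

variable {A B}

theorem isUnit_det_one_add {P : Matrix (Fin n) (Fin n) ℝ} (hP : P.PosSemidef) :
    IsUnit (1 + Bᵀ * P * B).det := by
  have h : (1 + Bᵀ * P * B).PosDef := by
    refine Matrix.PosDef.one.add_posSemidef ?_
    have := hP.conjTranspose_mul_mul_same B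
    rwa [Matrix.conjTranspose_eq_transpose_of_trivial] at this
  exact (Matrix.isUnit_iff_isUnit_det _).1 h.isUnit

theorem greedyGain_stationary {P : Matrix (Fin n) (Fin n) ℝ} (hP : P.PosSemidef) :
    greedyGain A B P + Bᵀ * P * (A + B * greedyGain A B P) = 0 := by
  have h : (1 + Bᵀ * P * B) * greedyGain A B P = -(Bᵀ * P * A) := by
    rw [greedyGain, Matrix.mul_neg, Matrix.mul_nonsing_inv_cancel_left _ _ (isUnit_det_one_add hP)]
  have h2 : greedyGain A B P + Bᵀ * P * (A + B * greedyGain A B P)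
      = (1 + Bᵀ * P * B) * greedyGain A B P + Bᵀ * P * A := by
    simp only [Matrix.mul_add, Matrix.add_mul, Matrix.one_mul, Matrix.mul_assoc]
    abel
  rw [h2, h, neg_add_cancel]

theorem posSemidef_transpose_mul_self {k l : ℕ} (L : Matrix (Fin k) (Fin l) ℝ) :
    (Lᵀ * L).PosSemidef := by
  have := Matrix.posSemidef_conjTranspose_mul_self L
  rwa [Matrix.conjTranspose_eq_transpose_of_trivial] at this

theorem posSemidef_transpose_mul_mul {k l : ℕ} {P : Matrix (Fin k) (Fin k) ℝ} (hP : P.PosSemidef)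
    (L : Matrix (Fin k) (Fin l) ℝ) : (Lᵀ * P * L).PosSemidef := by
  have := hP.conjTranspose_mul_mul_same L
  rwa [Matrix.conjTranspose_eq_transpose_of_trivial] at this

theorem stepCost_posSemidef {P : Matrix (Fin n) (Fin n) ℝ} (hP : P.PosSemidef)
    (L : Matrix (Fin m) (Fin n) ℝ) : (stepCost A B L P).PosSemidef :=
  (Matrix.PosSemidef.one.add (posSemidef_transpose_mul_self L)).add
    (posSemidef_transpose_mul_mul hP _)

theorem stepCost_mono {P P' : Matrix (Fin n) (Fin n) ℝ} (h : (P' - P).PosSemidef)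
    (L : Matrix (Fin m) (Fin n) ℝ) : (stepCost A B L P' - stepCost A B L P).PosSemidef := by
  have h1 : stepCost A B L P' - stepCost A B L P = (A + B * L)ᵀ * (P' - P) * (A + B * L) := by
    simp only [stepCost, Matrix.mul_sub, Matrix.sub_mul]; abel
  rw [h1]
  exact posSemidef_transpose_mul_mul h _

/-- Completion of squares: no feedback has a smaller one-step cost than the greedy one. -/
theorem stepCost_greedyGain_le {P : Matrix (Fin n) (Fin n) ℝ} (hP : P.PosSemidef)
    (L : Matrix (Fin m) (Fin n) ℝ) :
    (stepCost A B L P - stepCost A B (greedyGain A B P) P).PosSemidef := by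
  set L₀ := greedyGain A B P with hL₀
  obtain ⟨D, rfl⟩ : ∃ D, L = L₀ + D := ⟨L - L₀, by abel⟩
  have hs := greedyGain_stationary (A := A) (B := B) hP
  rw [← hL₀] at hs
  have hPt : Pᵀ = P := by
    have := hP.1
    rwa [Matrix.IsHermitian, Matrix.conjTranspose_eq_transpose_of_trivial] at this
  have hs' : L₀ᵀ + (A + B * L₀)ᵀ * P * B = 0 := by
    have := congrArg Matrix.transpose hs
    simpa [Matrix.transpose_mul, hPt, Matrix.mul_assoc] using this
  have h1 : stepCost A B (L₀ + D) P - stepCost A B L₀ P = Dᵀ * D + (B * D)ᵀ * P * (B * D) := by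
    have h2 : stepCost A B (L₀ + D) P - stepCost A B L₀ P =
        Dᵀ * (L₀ + Bᵀ * P * (A + B * L₀)) + (L₀ᵀ + (A + B * L₀)ᵀ * P * B) * D
          + (Dᵀ * D + (B * D)ᵀ * P * (B * D)) := by
      simp only [stepCost, Matrix.transpose_add, Matrix.transpose_mul, Matrix.mul_add,
        Matrix.add_mul, Matrix.mul_assoc]
      abel
    rw [h2, hs, hs']; simp
  rw [h1]
  exact (posSemidef_transpose_mul_self D).add (posSemidef_transpose_mul_mul hP _)

theorem valueIter_posSemidef (k : ℕ) : (valueIter A B k).PosSemidef := by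
  induction k with
  | zero => exact Matrix.PosSemidef.zero
  | succ k ih => exact stepCost_posSemidef ih _

theorem valueIter_mono (k : ℕ) : (valueIter A B (k + 1) - valueIter A B k).PosSemidef := by
  induction k with
  | zero => simpa [valueIter] using stepCost_posSemidef Matrix.PosSemidef.zero _
  | succ k ih =>
    have h1 := stepCost_greedyGain_le (A := A) (B := B) (valueIter_posSemidef (A := A) (B := B) k)
      (greedyGain A B (valueIter A B (k + 1)))
    have h2 := stepCost_mono (A := A) (B := B) ih (greedyGain A B (valueIter A B (k + 1)))
    have h3 := h2.add h1
    rwa [sub_add_sub_cancel] at h3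

/-- The cost of a fixed feedback over `k` steps. -/
theorem iterate_stepCost_eq (L : Matrix (Fin m) (Fin n) ℝ) (k : ℕ) :
    (stepCost A B L)^[k] 0 =
      ∑ j ∈ Finset.range k, ((A + B * L) ^ j)ᵀ * (1 + Lᵀ * L) * (A + B * L) ^ j := by
  induction k with
  | zero => simp
  | succ k ih =>
    rw [Function.iterate_succ_apply', ih, stepCost, Finset.sum_range_succ', Finset.mul_sum,
      Finset.sum_mul, add_comm]
    congr 1
    · refine Finset.sum_congr rfl fun j _ => ?_
      rw [pow_succ, Matrix.transpose_mul]
      simp only [Matrix.mul_assoc]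
    · simp

theorem valueIter_le (L : Matrix (Fin m) (Fin n) ℝ) (k : ℕ) :
    ((stepCost A B L)^[k] 0 - valueIter A B k).PosSemidef := by
  induction k with
  | zero => simpa [valueIter] using Matrix.PosSemidef.zero
  | succ k ih =>
    rw [Function.iterate_succ_apply']
    have h1 := stepCost_greedyGain_le (A := A) (B := B) (valueIter_posSemidef (A := A) (B := B) k) L
    have h2 := stepCost_mono (A := A) (B := B) ih L
    have h3 := h2.add h1
    rwa [sub_add_sub_cancel] at h3

theorem quadForm_mono {P P' : Matrix (Fin n) (Fin n) ℝ} (h : (P' - P).PosSemidef)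
    (x : Fin n → ℝ) : x ⬝ᵥ P *ᵥ x ≤ x ⬝ᵥ P' *ᵥ x := by
  have := h.dotProduct_mulVec_nonneg x
  rw [Matrix.sub_mulVec, dotProduct_sub, star_trivial] at this
  linarith

theorem exists_iterate_stepCost_bound (L : Matrix (Fin m) (Fin n) ℝ)
    (hL : ∀ z ∈ spectrum ℂ ((A + B * L).map Complex.ofReal), ‖z‖ < 1) (x : Fin n → ℝ) :
    ∃ c : ℝ, ∀ k, x ⬝ᵥ ((stepCost A B L)^[k] 0) *ᵥ x ≤ c := by
  obtain ⟨C, r, hC, hr0, hr1, hCr⟩ := exists_pow_entry_le _ hL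
  -- each step contributes `qᵀ (1 + Lᵀ L) q` with `q = (A + B L) ^ j x` of size `O(r ^ j)`
  set S := A + B * L with hS
  set Q := 1 + Lᵀ * L with hQ
  set X := ∑ i, |x i| with hX
  have hX0 : 0 ≤ X := by positivity
  have hvec : ∀ j i, |((S ^ j) *ᵥ x) i| ≤ C * r ^ j * X := by
    intro j i
    rw [Matrix.mulVec, dotProduct, hX, Finset.mul_sum]
    refine (Finset.abs_sum_le_sum_abs _ _).trans (Finset.sum_le_sum fun l _ => ?_)
    rw [abs_mul]
    exact mul_le_mul_of_nonneg_right (hCr j i l) (abs_nonneg _)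
  set K := ∑ i, ∑ l, |Q i l| with hK
  have hK0 : 0 ≤ K := by positivity
  have hterm : ∀ j, x ⬝ᵥ ((S ^ j)ᵀ * Q * S ^ j) *ᵥ x ≤ (C * X) ^ 2 * K * r ^ j := by
    intro j
    have e : x ⬝ᵥ ((S ^ j)ᵀ * Q * S ^ j) *ᵥ x = (S ^ j *ᵥ x) ⬝ᵥ Q *ᵥ (S ^ j *ᵥ x) := by
      rw [← Matrix.mulVec_mulVec, ← Matrix.mulVec_mulVec, Matrix.dotProduct_mulVec,
        Matrix.vecMul_transpose]
    rw [e]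
    set y := S ^ j *ᵥ x with hy
    have hb : ∀ i l, y i * (Q i l * y l) ≤ (C * r ^ j * X) * (C * r ^ j * X) * |Q i l| := by
      intro i l
      calc y i * (Q i l * y l) ≤ |y i * (Q i l * y l)| := le_abs_self _
        _ = |y i| * |y l| * |Q i l| := by rw [abs_mul, abs_mul]; ring
        _ ≤ _ := by
          gcongr
          · exact hvec j i
          · exact hvec j l
    have : y ⬝ᵥ Q *ᵥ y ≤ (C * r ^ j * X) * (C * r ^ j * X) * K := by
      simp only [dotProduct, Matrix.mulVec, hK, Finset.mul_sum]
      exact Finset.sum_le_sum fun i _ => Finset.sum_le_sum fun l _ => hb i l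
    refine this.trans ?_
    have h1 : r ^ j * r ^ j ≤ r ^ j := mul_le_of_le_one_left (by positivity)
      (pow_le_one₀ hr0 hr1.le)
    have h2 : 0 ≤ (C * X) ^ 2 * K := by positivity
    calc (C * r ^ j * X) * (C * r ^ j * X) * K = (C * X) ^ 2 * K * (r ^ j * r ^ j) := by ring
      _ ≤ _ := mul_le_mul_of_nonneg_left h1 h2
  refine ⟨(C * X) ^ 2 * K * (1 - r)⁻¹, fun k => ?_⟩
  rw [iterate_stepCost_eq, Matrix.sum_mulVec, dotProduct_sum]
  refine (Finset.sum_le_sum fun j _ => hterm j).trans ?_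
  rw [← Finset.mul_sum]
  refine mul_le_mul_of_nonneg_left ?_ (by positivity)
  rw [← tsum_geometric_of_lt_one hr0 hr1]
  exact (summable_geometric_of_lt_one hr0 hr1).sum_le_tsum _ fun _ _ => by positivity

theorem quadForm_single_add {P : Matrix (Fin n) (Fin n) ℝ} (hP : Pᵀ = P) (i j : Fin n) :
    P i j = ((Pi.single i 1 + Pi.single j 1) ⬝ᵥ P *ᵥ (Pi.single i 1 + Pi.single j 1)
      - (Pi.single i 1) ⬝ᵥ P *ᵥ (Pi.single i 1) - (Pi.single j 1) ⬝ᵥ P *ᵥ (Pi.single j 1)) / 2 := by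
  have h : P j i = P i j := congrFun (congrFun hP i) j
  simp only [Matrix.mulVec_add, dotProduct_add, add_dotProduct, single_dotProduct,
    Matrix.mulVec_single_one, Matrix.col_apply, one_mul, h]
  ring

/-- The stabilizing solution of the Riccati equation of the linear quadratic regulator. It is the
limit of the increasing bounded sequence `valueIter`. -/
theorem exists_riccati (h : Stabilizable A B) :
    ∃ (L : Matrix (Fin m) (Fin n) ℝ) (P : Matrix (Fin n) (Fin n) ℝ), P.PosSemidef ∧
      P = stepCost A B L P ∧ L + Bᵀ * P * (A + B * L) = 0 := by
  obtain ⟨L₁, hL₁⟩ := h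
  have hsym : ∀ k, (valueIter A B k)ᵀ = valueIter A B k := fun k => by
    have := (valueIter_posSemidef (A := A) (B := B) k).1
    rwa [Matrix.IsHermitian, Matrix.conjTranspose_eq_transpose_of_trivial] at this
  have hquad : ∀ x : Fin n → ℝ, ∃ l, Tendsto (fun k => x ⬝ᵥ valueIter A B k *ᵥ x) atTop (𝓝 l) := by
    intro x
    obtain ⟨c, hc⟩ := exists_iterate_stepCost_bound L₁ hL₁ x
    refine ⟨_, tendsto_atTop_ciSup (monotone_nat_of_le_succ fun k =>
      quadForm_mono (valueIter_mono k) x) ⟨c, ?_⟩⟩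
    rintro _ ⟨k, rfl⟩
    exact (quadForm_mono (valueIter_le L₁ k) x).trans (hc k)
  choose l hl using hquad
  set P : Matrix (Fin n) (Fin n) ℝ := Matrix.of fun i j =>
    (l (Pi.single i 1 + Pi.single j 1) - l (Pi.single i 1) - l (Pi.single j 1)) / 2 with hPdef
  have hlim : Tendsto (valueIter A B) atTop (𝓝 P) := by
    refine tendsto_pi_nhds.2 fun i => tendsto_pi_nhds.2 fun j => ?_
    simp_rw [fun k => quadForm_single_add (hsym k) i j]
    exact (((hl _).sub (hl _)).sub (hl _)).div_const 2
  have hP : P.PosSemidef := by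
    refine Matrix.PosSemidef.of_dotProduct_mulVec_nonneg ?_ fun x => ?_
    · rw [Matrix.IsHermitian, Matrix.conjTranspose_eq_transpose_of_trivial]
      ext i j
      simp only [hPdef, Matrix.transpose_apply, Matrix.of_apply, add_comm]
      ring
    · have hc : Continuous fun M : Matrix (Fin n) (Fin n) ℝ => star x ⬝ᵥ M *ᵥ x := by fun_prop
      exact ge_of_tendsto' ((hc.tendsto P).comp hlim) fun k =>
        (valueIter_posSemidef k).dotProduct_mulVec_nonneg x
  have hgain : ContinuousAt (fun M => greedyGain A B M) P := by
    have hinv : ContinuousAt (fun M : Matrix (Fin n) (Fin n) ℝ => (1 + Bᵀ * M * B)⁻¹) P := by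
      have h1 : ContinuousAt (Inv.inv : Matrix (Fin m) (Fin m) ℝ → _) (1 + Bᵀ * P * B) := by
        refine continuousAt_matrix_inv _ ?_
        have := (isUnit_det_one_add (B := B) hP).ne_zero
        simp only [Ring.inverse_eq_inv']
        exact continuousAt_inv₀ this
      have h2 : Continuous fun M : Matrix (Fin n) (Fin n) ℝ => 1 + Bᵀ * M * B := by fun_prop
      exact ContinuousAt.comp (f := fun M : Matrix (Fin n) (Fin n) ℝ => 1 + Bᵀ * M * B) h1
        h2.continuousAt
    have h3 : Continuous fun M : Matrix (Fin n) (Fin n) ℝ => Bᵀ * M * A := by fun_prop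
    have h4 : Continuous fun p : Matrix (Fin m) (Fin m) ℝ × Matrix (Fin m) (Fin n) ℝ =>
      -(p.1 * p.2) := by fun_prop
    exact h4.continuousAt.comp (hinv.prodMk h3.continuousAt)
  refine ⟨greedyGain A B P, P, hP, ?_, greedyGain_stationary hP⟩
  have hstep : Tendsto (fun k => valueIter A B (k + 1)) atTop
      (𝓝 (stepCost A B (greedyGain A B P) P)) := by
    have h5 : Continuous fun p : Matrix (Fin m) (Fin n) ℝ × Matrix (Fin n) (Fin n) ℝ =>
        stepCost A B p.1 p.2 := by unfold stepCost; fun_prop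
    have h6 : Tendsto (fun k => (greedyGain A B (valueIter A B k), valueIter A B k)) atTop
        (𝓝 (greedyGain A B P, P)) := Tendsto.prodMk_nhds (hgain.tendsto.comp hlim) hlim
    have h7 := (h5.tendsto (greedyGain A B P, P)).comp h6
    simp only [valueIter]
    exact h7
  exact tendsto_nhds_unique ((tendsto_add_atTop_iff_nat 1).2 hlim) hstep

/-- The feedback of a Riccati solution is stabilizing: `P` is a Lyapunov function, and the powers of
the closed-loop matrix decay geometrically. -/
theorem exists_pow_entry_le_of_riccati {L : Matrix (Fin m) (Fin n) ℝ}
    {P : Matrix (Fin n) (Fin n) ℝ} (hP : P.PosSemidef) (hPL : P = stepCost A B L P) :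
    ∃ C r : ℝ, 0 ≤ C ∧ 0 ≤ r ∧ r < 1 ∧ ∀ k i j, |((A + B * L) ^ k) i j| ≤ C * r ^ k := by
  set S := A + B * L with hS
  set c : ℝ := 1 + ∑ i, ∑ j, |P i j| with hc
  have hc1 : 1 ≤ c := by
    have : 0 ≤ ∑ i, ∑ j, |P i j| := by positivity
    linarith
  have hsq : ∀ y : Fin n → ℝ, 0 ≤ y ⬝ᵥ y := fun y =>
    Finset.sum_nonneg fun i _ => mul_self_nonneg _
  have hsqi : ∀ (y : Fin n → ℝ) i, y i * y i ≤ y ⬝ᵥ y := fun y i =>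
    Finset.single_le_sum (f := fun i => y i * y i) (fun i _ => mul_self_nonneg _)
      (Finset.mem_univ i)
  have hup : ∀ y, y ⬝ᵥ P *ᵥ y ≤ c * (y ⬝ᵥ y) := by
    intro y
    have h1 : y ⬝ᵥ P *ᵥ y ≤ (∑ i, ∑ j, |P i j|) * (y ⬝ᵥ y) := by
      simp only [Finset.sum_mul]
      simp only [dotProduct, Matrix.mulVec, Finset.mul_sum]
      refine Finset.sum_le_sum fun i _ => Finset.sum_le_sum fun j _ => ?_
      rw [← Finset.mul_sum]
      have h2 := hsqi y i
      have h3 := hsqi y j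
      simp only [dotProduct] at h2 h3
      have h4 : |y i * y j| ≤ ∑ k, y k * y k := by
        rw [abs_le]; constructor <;> nlinarith [sq_nonneg (y i + y j), sq_nonneg (y i - y j)]
      calc y i * (P i j * y j) ≤ |y i * (P i j * y j)| := le_abs_self _
        _ = |P i j| * |y i * y j| := by rw [abs_mul, abs_mul, abs_mul]; ring
        _ ≤ _ := by gcongr
    nlinarith [hsq y]
  have hdec : ∀ y, (S *ᵥ y) ⬝ᵥ P *ᵥ (S *ᵥ y) + y ⬝ᵥ y ≤ y ⬝ᵥ P *ᵥ y := by
    intro y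
    have e : y ⬝ᵥ P *ᵥ y = y ⬝ᵥ y + (L *ᵥ y) ⬝ᵥ (L *ᵥ y) + (S *ᵥ y) ⬝ᵥ P *ᵥ (S *ᵥ y) := by
      conv_lhs => rw [hPL, stepCost]
      rw [← hS, Matrix.add_mulVec, Matrix.add_mulVec, dotProduct_add, dotProduct_add,
        Matrix.one_mulVec, ← Matrix.mulVec_mulVec, ← Matrix.mulVec_mulVec, ← Matrix.mulVec_mulVec,
        Matrix.dotProduct_mulVec y Lᵀ, Matrix.vecMul_transpose, Matrix.dotProduct_mulVec y Sᵀ,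
        Matrix.vecMul_transpose]
    have h2 : 0 ≤ (L *ᵥ y) ⬝ᵥ (L *ᵥ y) := Finset.sum_nonneg fun i _ => mul_self_nonneg _
    linarith
  have hlow : ∀ y, y ⬝ᵥ y ≤ y ⬝ᵥ P *ᵥ y := fun y => by
    have h1 := hP.dotProduct_mulVec_nonneg (S *ᵥ y)
    rw [star_trivial] at h1
    linarith [hdec y]
  set r := 1 - c⁻¹ with hr
  have hci : 0 < c⁻¹ := by positivity
  have hci1 : c⁻¹ ≤ 1 := inv_le_one_of_one_le₀ hc1
  have hr0 : 0 ≤ r := by linarith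
  have hstep : ∀ y, (S *ᵥ y) ⬝ᵥ P *ᵥ (S *ᵥ y) ≤ r * (y ⬝ᵥ P *ᵥ y) := by
    intro y
    have h1 : c⁻¹ * (y ⬝ᵥ P *ᵥ y) ≤ y ⬝ᵥ y := by
      rw [inv_mul_le_iff₀ (by positivity)]; exact hup y
    rw [hr, sub_mul, one_mul]
    linarith [hdec y]
  have hpow : ∀ k y, ((S ^ k) *ᵥ y) ⬝ᵥ P *ᵥ ((S ^ k) *ᵥ y) ≤ r ^ k * (y ⬝ᵥ P *ᵥ y) := by
    intro k y
    induction k with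
    | zero => simp
    | succ k ih =>
      rw [pow_succ' S, ← Matrix.mulVec_mulVec]
      refine (hstep _).trans ?_
      rw [pow_succ' r, mul_assoc]
      exact mul_le_mul_of_nonneg_left ih hr0
  refine ⟨Real.sqrt c, Real.sqrt r, Real.sqrt_nonneg _, Real.sqrt_nonneg _, ?_, fun k i j => ?_⟩
  · rw [Real.sqrt_lt' one_pos]; linarith
  · set e : Fin n → ℝ := Pi.single j 1 with he
    have h1 : (S ^ k *ᵥ e) i = (S ^ k) i j := by simp [he]
    have hee : e ⬝ᵥ e = 1 := by simp [he]
    have h2 : (S ^ k) i j * (S ^ k) i j ≤ r ^ k * c := by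
      rw [← h1]
      refine (hsqi _ i).trans ((hlow _).trans ((hpow k e).trans ?_))
      refine mul_le_mul_of_nonneg_left ?_ (by positivity)
      have := hup e
      rwa [hee, mul_one] at this
    refine abs_le_of_sq_le_sq' ?_ (by positivity) |> abs_le.2
    rw [mul_pow, ← pow_mul, mul_comm k 2, pow_mul, Real.sq_sqrt (by positivity), Real.sq_sqrt hr0]
    nlinarith

end Riccati

/-! ### Hardy spaces with real coefficients -/

/-- A scalar function in the Hardy space `H_p` with real Laurent coefficients. -/
structure HardyFn (p : ℝ≥0∞) (f : UnitAddCircle → ℂ) : Prop where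
  memLp : MemLp f p circ
  symm : ConjSymm f
  causal : Causal f

section Hardy
variable {p : ℝ≥0∞} {f g : UnitAddCircle → ℂ}

theorem ConjSymm.mul (hf : ConjSymm f) (hg : ConjSymm g) : ConjSymm fun θ => f θ * g θ := by
  filter_upwards [hf, hg] with θ h1 h2
  rw [h1, h2, map_mul]

theorem ConjSymm.add (hf : ConjSymm f) (hg : ConjSymm g) : ConjSymm fun θ => f θ + g θ := by
  filter_upwards [hf, hg] with θ h1 h2
  rw [h1, h2, map_add]

theorem ConjSymm.sub (hf : ConjSymm f) (hg : ConjSymm g) : ConjSymm fun θ => f θ - g θ := by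
  filter_upwards [hf, hg] with θ h1 h2
  rw [h1, h2, map_sub]

theorem ConjSymm.sum {ι : Type*} {s : Finset ι} {f : ι → UnitAddCircle → ℂ}
    (hf : ∀ i ∈ s, ConjSymm (f i)) : ConjSymm fun θ => ∑ i ∈ s, f i θ := by
  have := (Filter.eventually_all_finset s).2 hf
  filter_upwards [this] with θ h
  rw [map_sum]
  exact Finset.sum_congr rfl h

theorem ConjSymm.ofReal (c : ℝ) : ConjSymm fun _ => (c : ℂ) :=
  ae_of_all _ fun _ => (Complex.conj_ofReal c).symm

theorem fourier_neg_apply (k : ℤ) (θ : UnitAddCircle) :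
    (fourier k (-θ) : ℂ) = conj (fourier k θ) := by
  rw [← fourier_neg]; simp [fourier_apply]

theorem ConjSymm.fourier (k : ℤ) : ConjSymm fun θ => fourier k θ :=
  ae_of_all _ fun θ => fourier_neg_apply k θ

theorem ConjSymm.conj (hf : ConjSymm f) : ConjSymm fun θ => conj (f θ) := by
  filter_upwards [hf] with θ h
  rw [h]

theorem HardyFn.add (hp : 1 ≤ p) (hf : HardyFn p f) (hg : HardyFn p g) :
    HardyFn p fun θ => f θ + g θ :=
  ⟨hf.memLp.add hg.memLp, hf.symm.add hg.symm, fun k hk => by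
    rw [zcoeff_add (hf.memLp.integrable hp) (hg.memLp.integrable hp), hf.causal k hk,
      hg.causal k hk, add_zero]⟩

theorem HardyFn.sub (hp : 1 ≤ p) (hf : HardyFn p f) (hg : HardyFn p g) :
    HardyFn p fun θ => f θ - g θ :=
  ⟨hf.memLp.sub hg.memLp, hf.symm.sub hg.symm, fun k hk => by
    rw [zcoeff_sub (hf.memLp.integrable hp) (hg.memLp.integrable hp), hf.causal k hk,
      hg.causal k hk, sub_zero]⟩

theorem HardyFn.sum (hp : 1 ≤ p) {ι : Type*} {s : Finset ι} {f : ι → UnitAddCircle → ℂ}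
    (hf : ∀ i ∈ s, HardyFn p (f i)) : HardyFn p fun θ => ∑ i ∈ s, f i θ :=
  ⟨memLp_finsetSum s fun i hi => (hf i hi).memLp, ConjSymm.sum fun i hi => (hf i hi).symm,
    fun k hk => by
      rw [zcoeff_sum s fun i hi => (hf i hi).memLp.integrable hp]
      exact Finset.sum_eq_zero fun i hi => (hf i hi).causal k hk⟩

theorem HardyFn.mul (hp : 2 ≤ p) (hf : HardyFn ∞ f) (hg : HardyFn p g) :
    HardyFn p fun θ => f θ * g θ :=
  ⟨hg.memLp.mul hf.memLp, hf.symm.mul hg.symm,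
    Causal.mul (hf.memLp.mono_exponent le_top) (hg.memLp.mono_exponent hp) hf.causal hg.causal⟩

theorem HardyFn.ofReal (c : ℝ) : HardyFn p fun _ => (c : ℂ) :=
  ⟨memLp_const _, ConjSymm.ofReal c, fun k hk => by rw [zcoeff_const, if_neg hk.ne]⟩

theorem HardyFn.fourier_neg (k : ℕ) : HardyFn p fun θ => fourier (-(k : ℤ)) θ := by
  refine ⟨MemLp.of_bound (by fun_prop) 1 (ae_of_all _ fun θ => (norm_fourier_apply _ θ).le),
    ConjSymm.fourier _, fun j hj => ?_⟩
  have h := zcoeff_fourier_mul (fun _ => 1) (-(k : ℤ)) j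
  simp only [mul_one] at h
  rw [h, zcoeff_const, if_neg (by omega)]

theorem HardyFn.mono {q : ℝ≥0∞} (hqp : q ≤ p) (hf : HardyFn p f) : HardyFn q f :=
  ⟨hf.memLp.mono_exponent hqp, hf.symm, hf.causal⟩

theorem memL_iff {m n : Type} (hp : 1 ≤ p) {M : TransferMatrix m n} :
    MemL p M ↔ ∀ i j, MemLp (fun θ => M θ i j) p circ ∧ ConjSymm fun θ => M θ i j := by
  constructor
  · intro h i j
    exact ⟨h.memLp i j, (conjSymm_iff ((h.memLp i j).integrable hp)).2 fun k => h.real k i j⟩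
  · intro h
    exact ⟨fun i j => (h i j).1, fun k i j =>
      (conjSymm_iff ((h i j).1.integrable hp)).1 (h i j).2 k⟩

theorem memH_iff {m n : Type} (hp : 1 ≤ p) {M : TransferMatrix m n} :
    MemH p M ↔ ∀ i j, HardyFn p fun θ => M θ i j := by
  constructor
  · intro h i j
    obtain ⟨h1, h2⟩ := (memL_iff hp).1 h.toMemL i j
    exact ⟨h1, h2, fun k hk => congrFun (congrFun (h.causal k hk) i) j⟩
  · intro h
    refine ⟨(memL_iff hp).2 fun i j => ⟨(h i j).memLp, (h i j).symm⟩, fun k hk => ?_⟩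
    ext i j
    exact (h i j).causal k hk

end Hardy

section HardyMatrix
variable {m n l : Type} {p : ℝ≥0∞}

theorem MemH.add (hp : 1 ≤ p) {M N : TransferMatrix m n} (hM : MemH p M) (hN : MemH p N) :
    MemH p fun θ => M θ + N θ :=
  (memH_iff hp).2 fun i j => ((memH_iff hp).1 hM i j).add hp ((memH_iff hp).1 hN i j)

theorem MemH.sub (hp : 1 ≤ p) {M N : TransferMatrix m n} (hM : MemH p M) (hN : MemH p N) :
    MemH p fun θ => M θ - N θ :=
  (memH_iff hp).2 fun i j => ((memH_iff hp).1 hM i j).sub hp ((memH_iff hp).1 hN i j)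

theorem MemH.mul [Fintype l] (hp : 2 ≤ p) {M : TransferMatrix m l} {N : TransferMatrix l n}
    (hM : MemH ∞ M) (hN : MemH p N) : MemH p fun θ => M θ * N θ := by
  have hp1 : 1 ≤ p := one_le_two.trans hp
  exact (memH_iff hp1).2 fun i j => HardyFn.sum hp1 fun k _ =>
    ((memH_iff le_top).1 hM i k).mul hp ((memH_iff hp1).1 hN k j)

theorem MemH.smul (hp : 2 ≤ p) {g : UnitAddCircle → ℂ} {N : TransferMatrix m n}
    (hg : HardyFn ∞ g) (hN : MemH p N) : MemH p fun θ => g θ • N θ := by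
  have hp1 : 1 ≤ p := one_le_two.trans hp
  exact (memH_iff hp1).2 fun i j => hg.mul hp ((memH_iff hp1).1 hN i j)

theorem MemH.ofReal (hp : 1 ≤ p) (M : Matrix m n ℝ) : MemH p fun _ => M.map Complex.ofReal :=
  (memH_iff hp).2 fun i j => HardyFn.ofReal (M i j)

theorem MemH.mono {q : ℝ≥0∞} (hq : 1 ≤ q) (hqp : q ≤ p) {M : TransferMatrix m n}
    (hM : MemH p M) : MemH q M :=
  (memH_iff hq).2 fun i j => ((memH_iff (hq.trans hqp)).1 hM i j).mono hqp

theorem MemH.fromRows (hp : 1 ≤ p) {M : TransferMatrix m n} {N : TransferMatrix l n}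
    (hM : MemH p M) (hN : MemH p N) : MemH p fun θ => Matrix.fromRows (M θ) (N θ) :=
  (memH_iff hp).2 fun i j => by
    rcases i with i | i
    · exact (memH_iff hp).1 hM i j
    · exact (memH_iff hp).1 hN i j

theorem MemH.toRows₁ {M : TransferMatrix (m ⊕ l) n} (hp : 1 ≤ p) (hM : MemH p M) :
    MemH p fun θ => (M θ).toRows₁ :=
  (memH_iff hp).2 fun i j => (memH_iff hp).1 hM (Sum.inl i) j

theorem MemH.toRows₂ {M : TransferMatrix (m ⊕ l) n} (hp : 1 ≤ p) (hM : MemH p M) :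
    MemH p fun θ => (M θ).toRows₂ :=
  (memH_iff hp).2 fun i j => (memH_iff hp).1 hM (Sum.inr i) j

end HardyMatrix

/-! ### The regulator and its transfer matrices -/

/-- A stabilizing solution `P` of the Riccati equation of the linear quadratic regulator of the
system, with its feedback gain `L`. -/
structure Regulator {dx du dw : ℕ} (S : System dx du dw) where
  /-- The feedback gain. -/
  L : Matrix (Fin du) (Fin dx) ℝ
  /-- The value matrix. -/
  P : Matrix (Fin dx) (Fin dx) ℝ
  posSemidef : P.PosSemidef
  /-- The Riccati equation, as a Lyapunov equation for the closed loop with gain `L`. -/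
  riccati : P = stepCost S.A S.Bu L P
  /-- The gain `L` minimizes the one-step cost. -/
  stationary : L + S.Buᵀ * P * (S.A + S.Bu * L) = 0

theorem exists_regulator {dx du dw : ℕ} (S : System dx du dw) (h : Stabilizable S.A S.Bu) :
    Nonempty (Regulator S) := by
  obtain ⟨L, P, h1, h2, h3⟩ := exists_riccati h
  exact ⟨⟨L, P, h1, h2, h3⟩⟩

/-- The complexification of a real matrix. -/
abbrev cpx {m n : Type} (M : Matrix m n ℝ) : Matrix m n ℂ := M.map Complex.ofReal

section cpx
variable {m n l : Type}

theorem cpx_mul [Fintype n] (M : Matrix m n ℝ) (N : Matrix n l ℝ) :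
    cpx (M * N) = cpx M * cpx N := Matrix.map_mul (f := Complex.ofRealHom)

theorem cpx_add (M N : Matrix m n ℝ) : cpx (M + N) = cpx M + cpx N :=
  Matrix.map_add _ Complex.ofReal_add M N

theorem cpx_one [DecidableEq n] : cpx (1 : Matrix n n ℝ) = 1 :=
  Matrix.map_one _ Complex.ofReal_zero Complex.ofReal_one

theorem cpx_zero : cpx (0 : Matrix m n ℝ) = 0 :=
  Matrix.map_zero _ Complex.ofReal_zero

theorem cpx_pow [Fintype n] [DecidableEq n] (M : Matrix n n ℝ) (k : ℕ) :
    cpx (M ^ k) = cpx M ^ k := map_pow (Complex.ofRealHom.mapMatrix) M k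

theorem cpx_conjTranspose (M : Matrix m n ℝ) : (cpx M)ᴴ = cpx Mᵀ := by
  ext i j; simp [cpx]

end cpx

namespace Regulator
variable {dx du dw : ℕ} {S : System dx du dw} (ρ : Regulator S)

/-- The closed-loop matrix of the regulator. -/
def Acl : Matrix (Fin dx) (Fin dx) ℂ := cpx (S.A + S.Bu * ρ.L)

/-- The resolvent `(zI - A - B_u L)⁻¹` on the unit circle. -/
def res : TransferMatrix (Fin dx) (Fin dx) := fun θ => ((fourier 1 θ : ℂ) • 1 - ρ.Acl)⁻¹

theorem exists_norm_Acl_pow_le :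
    ∃ C r : ℝ, 0 ≤ C ∧ 0 ≤ r ∧ r < 1 ∧ ∀ k i j, ‖(ρ.Acl ^ k) i j‖ ≤ C * r ^ k := by
  obtain ⟨C, r, hC, hr0, hr1, h⟩ := exists_pow_entry_le_of_riccati ρ.posSemidef ρ.riccati
  refine ⟨C, r, hC, hr0, hr1, fun k i j => ?_⟩
  rw [Acl, ← cpx_pow]
  simpa [cpx] using h k i j

theorem isUnit_det (θ : UnitAddCircle) : IsUnit ((fourier 1 θ : ℂ) • 1 - ρ.Acl).det := by
  rw [isUnit_iff_ne_zero]
  intro hdet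
  obtain ⟨v, hv0, hv⟩ := Matrix.exists_mulVec_eq_zero_iff.2 hdet
  set z : ℂ := fourier 1 θ with hz
  have hav : ρ.Acl *ᵥ v = z • v := by
    rw [Matrix.sub_mulVec, Matrix.smul_mulVec, Matrix.one_mulVec, sub_eq_zero] at hv
    exact hv.symm
  have hpow : ∀ k, (ρ.Acl ^ k) *ᵥ v = z ^ k • v := by
    intro k
    induction k with
    | zero => simp
    | succ k ih => rw [pow_succ, ← Matrix.mulVec_mulVec, hav, Matrix.mulVec_smul, ih, smul_smul,
        pow_succ']
  obtain ⟨C, r, hC, hr0, hr1, h⟩ := ρ.exists_norm_Acl_pow_le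
  apply hv0
  ext i
  have hle : ∀ k, ‖v i‖ ≤ C * r ^ k * ∑ j, ‖v j‖ := by
    intro k
    have h1 : ‖(z ^ k • v) i‖ = ‖v i‖ := by
      rw [Pi.smul_apply, norm_smul, norm_pow, norm_fourier_apply, one_pow, one_mul]
    rw [← h1, ← hpow, Matrix.mulVec, dotProduct, Finset.mul_sum]
    refine (norm_sum_le _ _).trans (Finset.sum_le_sum fun j _ => ?_)
    rw [norm_mul]
    exact mul_le_mul_of_nonneg_right (h k i j) (norm_nonneg _)
  have hlim : Tendsto (fun k => C * r ^ k * ∑ j, ‖v j‖) atTop (𝓝 (C * 0 * ∑ j, ‖v j‖)) :=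
    ((tendsto_pow_atTop_nhds_zero_of_lt_one hr0 hr1).const_mul C).mul_const _
  have := ge_of_tendsto' hlim hle
  simpa using this

theorem sub_mul_res (θ : UnitAddCircle) : ((fourier 1 θ : ℂ) • 1 - ρ.Acl) * ρ.res θ = 1 :=
  Matrix.mul_nonsing_inv _ (ρ.isUnit_det θ)

theorem res_mul_sub (θ : UnitAddCircle) : ρ.res θ * ((fourier 1 θ : ℂ) • 1 - ρ.Acl) = 1 :=
  Matrix.nonsing_inv_mul _ (ρ.isUnit_det θ)

theorem smul_res (θ : UnitAddCircle) : (fourier 1 θ : ℂ) • ρ.res θ = 1 + ρ.Acl * ρ.res θ := by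
  have h := ρ.sub_mul_res θ
  rw [Matrix.sub_mul, Matrix.smul_mul, Matrix.one_mul, sub_eq_iff_eq_add] at h
  exact h

theorem continuous_res : Continuous ρ.res := by
  have h : Continuous fun θ : UnitAddCircle => (fourier 1 θ : ℂ) • (1 : Matrix (Fin dx) (Fin dx) ℂ)
      - ρ.Acl := by fun_prop
  rw [continuous_iff_continuousAt]
  intro θ
  refine ContinuousAt.comp (g := Inv.inv) (continuousAt_matrix_inv _ ?_) h.continuousAt
  simp only [Ring.inverse_eq_inv']
  exact continuousAt_inv₀ (ρ.isUnit_det θ).ne_zero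

theorem continuous_res_apply (i j : Fin dx) : Continuous fun θ => ρ.res θ i j :=
  ρ.continuous_res.matrix_elem i j

theorem memLp_res (p : ℝ≥0∞) (i j : Fin dx) : MemLp (fun θ => ρ.res θ i j) p circ := by
  obtain ⟨C, hC⟩ := isCompact_univ.exists_bound_of_continuousOn
    (ρ.continuous_res_apply i j).continuousOn
  exact MemLp.of_bound (ρ.continuous_res_apply i j).aestronglyMeasurable C
    (ae_of_all _ fun θ => hC θ trivial)

theorem res_neg (θ : UnitAddCircle) : ρ.res (-θ) = (ρ.res θ).map conj := by
  have h : ((fourier 1 (-θ) : ℂ) • 1 - ρ.Acl) * (ρ.res θ).map conj = 1 := by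
    have h1 := congrArg (fun M => M.map conj) (ρ.sub_mul_res θ)
    simp only [Matrix.map_mul] at h1
    rw [Matrix.map_one _ (map_zero _) (map_one _)] at h1
    refine Eq.trans ?_ h1
    congr 1
    rw [fourier_neg_apply]
    ext i j
    by_cases hij : i = j <;> simp [Acl, Matrix.smul_apply, hij]
  rw [res, Matrix.inv_eq_right_inv h]

theorem conjSymm_res (i j : Fin dx) : ConjSymm fun θ => ρ.res θ i j :=
  ae_of_all _ fun θ => congrFun (congrFun (ρ.res_neg θ) i) j

theorem zcoeff_res_succ (k : ℤ) (i j : Fin dx) : zcoeff (fun θ => ρ.res θ i j) (k + 1) =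
    (if k = 0 then (1 : Matrix (Fin dx) (Fin dx) ℂ) i j else 0)
      + ∑ l, ρ.Acl i l * zcoeff (fun θ => ρ.res θ l j) k := by
  rw [← zcoeff_fourier_mul]
  have h : (fun θ => (fourier 1 θ : ℂ) * ρ.res θ i j) = fun θ =>
      (1 : Matrix (Fin dx) (Fin dx) ℂ) i j + ∑ l, ρ.Acl i l * ρ.res θ l j := by
    funext θ
    exact congrFun (congrFun (ρ.smul_res θ) i) j
  have hi : ∀ l, Integrable (fun θ => ρ.Acl i l * ρ.res θ l j) circ := fun l =>
    ((ρ.memLp_res 1 l j).integrable le_rfl).const_mul _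
  rw [h, zcoeff_add (integrable_const _) (integrable_finsetSum _ fun l _ => hi l), zcoeff_const,
    zcoeff_sum _ fun l _ => hi l]
  simp only [zcoeff_const_mul]

/-- The resolvent of a Schur matrix is causal: its coefficients at negative times are fixed by
arbitrarily high powers of the matrix, up to a shift. -/
theorem causal_res (i j : Fin dx) : Causal fun θ => ρ.res θ i j := by
  intro k hk
  set c : ℤ → Matrix (Fin dx) (Fin dx) ℂ :=
    fun k => Matrix.of fun i j => zcoeff (fun θ => ρ.res θ i j) k with hc
  have hstep : ∀ k : ℤ, k < 0 → c (k + 1) = ρ.Acl * c k := by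
    intro k hk
    ext i j
    simp only [hc, Matrix.of_apply, ρ.zcoeff_res_succ, hk.ne, if_false, zero_add,
      Matrix.mul_apply]
  have hpow : ∀ (q : ℕ) (k : ℤ), k < 0 → c k = ρ.Acl ^ q * c (k - q) := by
    intro q
    induction q with
    | zero => intro k _; simp
    | succ q ih =>
      intro k hk
      rw [ih k hk, pow_succ, Matrix.mul_assoc, ← hstep _ (by push_cast; omega)]
      congr 2
      push_cast
      ring
  obtain ⟨C, r, hC, hr0, hr1, h⟩ := ρ.exists_norm_Acl_pow_le
  set K := ∑ l, ∫ θ, ‖ρ.res θ l j‖ ∂circ with hK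
  have hb : ∀ (k : ℤ) l, ‖c k l j‖ ≤ ∫ θ, ‖ρ.res θ l j‖ ∂circ := by
    intro k l
    simp only [hc, Matrix.of_apply, zcoeff_eq]
    refine (norm_integral_le_integral_norm _).trans (le_of_eq ?_)
    simp only [norm_mul, norm_fourier_apply, one_mul]
  have hle : ∀ q : ℕ, ‖c k i j‖ ≤ C * r ^ q * K := by
    intro q
    rw [hpow q k hk, Matrix.mul_apply, hK, Finset.mul_sum]
    refine (norm_sum_le _ _).trans (Finset.sum_le_sum fun l _ => ?_)
    rw [norm_mul]
    exact mul_le_mul (h q i l) (hb _ l) (norm_nonneg _) (by positivity)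
  have hlim : Tendsto (fun q => C * r ^ q * K) atTop (𝓝 (C * 0 * K)) :=
    ((tendsto_pow_atTop_nhds_zero_of_lt_one hr0 hr1).const_mul C).mul_const _
  have := ge_of_tendsto' hlim hle
  simpa [hc] using this

theorem memH_res : MemH ∞ ρ.res :=
  (memH_iff le_top).2 fun i j => ⟨ρ.memLp_res _ i j, ρ.conjSymm_res i j, ρ.causal_res i j⟩

theorem cpx_P_conjTranspose : (cpx ρ.P)ᴴ = cpx ρ.P := by
  have := ρ.posSemidef.1
  rw [Matrix.IsHermitian, Matrix.conjTranspose_eq_transpose_of_trivial] at this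
  rw [cpx_conjTranspose, this]

theorem cpx_riccati : cpx ρ.P = 1 + (cpx ρ.L)ᴴ * cpx ρ.L + ρ.Aclᴴ * cpx ρ.P * ρ.Acl := by
  conv_lhs => rw [ρ.riccati]
  rw [stepCost, Acl, cpx_conjTranspose, cpx_conjTranspose]
  simp only [cpx_add, cpx_mul, cpx_one]

theorem cpx_stationary : cpx ρ.L + (cpx S.Bu)ᴴ * cpx ρ.P * ρ.Acl = 0 := by
  have := congrArg cpx ρ.stationary
  rwa [cpx_add, cpx_mul, cpx_mul, cpx_zero, ← cpx_conjTranspose] at this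

/-- The spectral identity of the regulator. -/
theorem res_conjTranspose_mul (θ : UnitAddCircle) :
    (ρ.res θ)ᴴ * (1 + (cpx ρ.L)ᴴ * cpx ρ.L) * ρ.res θ =
      cpx ρ.P + cpx ρ.P * ρ.Acl * ρ.res θ + (ρ.res θ)ᴴ * ρ.Aclᴴ * cpx ρ.P := by
  set z : ℂ := fourier 1 θ with hz
  set Φ := ρ.res θ with hΦ
  have h1 : z • Φ = 1 + ρ.Acl * Φ := ρ.smul_res θ
  have h1' : star z • Φᴴ = 1 + Φᴴ * ρ.Aclᴴ := by
    have := congrArg Matrix.conjTranspose h1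
    simpa [Matrix.conjTranspose_smul] using this
  have hzz : star z * z = 1 := by
    rw [Complex.star_def, Complex.conj_mul', norm_fourier_apply]; simp
  have h2 : 1 + (cpx ρ.L)ᴴ * cpx ρ.L = cpx ρ.P - ρ.Aclᴴ * cpx ρ.P * ρ.Acl := by
    rw [eq_sub_iff_add_eq, ← ρ.cpx_riccati]
  have h3 : Φᴴ * cpx ρ.P * Φ = (1 + Φᴴ * ρ.Aclᴴ) * cpx ρ.P * (1 + ρ.Acl * Φ) := by
    rw [← h1, ← h1', Matrix.smul_mul, Matrix.smul_mul, Matrix.mul_smul, smul_smul, hzz, one_smul]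
  rw [h2, Matrix.mul_sub, Matrix.sub_mul, h3]
  simp only [Matrix.mul_add, Matrix.add_mul, Matrix.mul_one, Matrix.one_mul, Matrix.mul_assoc]
  abel

/-- The transfer matrix from the deviation `v = u - L x` to `(x, u)`. -/
def inner : TransferMatrix (Fin dx ⊕ Fin du) (Fin du) := fun θ =>
  Matrix.fromRows (ρ.res θ * cpx S.Bu) (1 + cpx ρ.L * (ρ.res θ * cpx S.Bu))

/-- The transfer matrix from the disturbance `w` to `(x, u)` when `u = L x`. -/
def drift : TransferMatrix (Fin dx ⊕ Fin du) (Fin dw) := fun θ =>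
  Matrix.fromRows (ρ.res θ * cpx S.Bw) (cpx ρ.L * (ρ.res θ * cpx S.Bw))

/-- The constant `I + B_uᵀ P B_u`, which is the Gram matrix of `inner`. -/
def gram : Matrix (Fin du) (Fin du) ℝ := 1 + S.Buᵀ * ρ.P * S.Bu

/-- The causal rational matrix `drift* inner`. -/
def cross : TransferMatrix (Fin dw) (Fin du) := fun θ =>
  cpx (S.Bwᵀ * ρ.P * S.Bu) + cpx (S.Bwᵀ * ρ.P) * ρ.Acl * ρ.res θ * cpx S.Bu

theorem memH_inner : MemH ∞ ρ.inner := by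
  have h := ρ.memH_res.mul le_top (MemH.ofReal le_top S.Bu)
  refine h.fromRows le_top ?_
  have h1 := MemH.ofReal (p := ∞) le_top (1 : Matrix (Fin du) (Fin du) ℝ)
  have h2 := (MemH.ofReal (p := ∞) le_top ρ.L).mul le_top h
  have h3 := h1.add le_top h2
  simpa only [← cpx_one] using h3

theorem memH_drift : MemH ∞ ρ.drift := by
  have h := ρ.memH_res.mul le_top (MemH.ofReal le_top S.Bw)
  exact h.fromRows le_top ((MemH.ofReal (p := ∞) le_top ρ.L).mul le_top h)

theorem fromRows_conjTranspose_mul {m₁ m₂ n l : Type} [Fintype m₁] [Fintype m₂]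
    (A : Matrix m₁ n ℂ) (B : Matrix m₂ n ℂ) (C : Matrix m₁ l ℂ) (D : Matrix m₂ l ℂ) :
    (Matrix.fromRows A B)ᴴ * Matrix.fromRows C D = Aᴴ * C + Bᴴ * D := by
  rw [Matrix.conjTranspose_fromRows_eq_fromCols_conjTranspose, Matrix.fromCols_mul_fromRows]

/-- The Riccati equation makes `inner* inner` constant: `inner` is an inner factor up to a constant
normalization. -/
theorem inner_conjTranspose_mul_inner (θ : UnitAddCircle) :
    (ρ.inner θ)ᴴ * ρ.inner θ = cpx ρ.gram := by
  rw [inner, fromRows_conjTranspose_mul]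
  have h := ρ.res_conjTranspose_mul θ
  have hs := ρ.cpx_stationary
  have hs' : (cpx ρ.L)ᴴ + ρ.Aclᴴ * cpx ρ.P * cpx S.Bu = 0 := by
    have := congrArg Matrix.conjTranspose hs
    simpa [Matrix.conjTranspose_mul, ρ.cpx_P_conjTranspose, Matrix.mul_assoc] using this
  set Φ := ρ.res θ with hΦ
  set B := cpx S.Bu with hB
  set L := cpx ρ.L with hL
  have e : (Φ * B)ᴴ * (Φ * B) + (1 + L * (Φ * B))ᴴ * (1 + L * (Φ * B)) =
      Bᴴ * (Φᴴ * (1 + Lᴴ * L) * Φ) * B + L * (Φ * B) + Bᴴ * Φᴴ * Lᴴ + 1 := by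
    simp only [Matrix.conjTranspose_mul, Matrix.conjTranspose_add, Matrix.conjTranspose_one,
      Matrix.mul_add, Matrix.add_mul, Matrix.mul_one, Matrix.one_mul, Matrix.mul_assoc]
    abel
  have e2 : Bᴴ * (Φᴴ * (1 + Lᴴ * L) * Φ) * B + L * (Φ * B) + Bᴴ * Φᴴ * Lᴴ + 1 =
      1 + Bᴴ * cpx ρ.P * B + (L + Bᴴ * cpx ρ.P * ρ.Acl) * (Φ * B)
        + Bᴴ * Φᴴ * (Lᴴ + ρ.Aclᴴ * cpx ρ.P * B) := by
    rw [h]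
    simp only [Matrix.mul_add, Matrix.add_mul, Matrix.mul_assoc]
    abel
  rw [e, e2, hs, hs', gram, cpx_add, cpx_mul, cpx_mul, cpx_one, ← cpx_conjTranspose]
  simp [hB]

theorem inner_conjTranspose_mul_drift (θ : UnitAddCircle) :
    (ρ.inner θ)ᴴ * ρ.drift θ = (ρ.cross θ)ᴴ := by
  rw [inner, drift, fromRows_conjTranspose_mul]
  have h := ρ.res_conjTranspose_mul θ
  have hs := ρ.cpx_stationary
  have hc : (ρ.cross θ)ᴴ = (cpx S.Bu)ᴴ * cpx ρ.P * cpx S.Bw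
      + (cpx S.Bu)ᴴ * ((ρ.res θ)ᴴ * ρ.Aclᴴ * cpx ρ.P) * cpx S.Bw := by
    simp only [cross, cpx_mul, Matrix.conjTranspose_add, Matrix.conjTranspose_mul,
      ρ.cpx_P_conjTranspose, ← cpx_conjTranspose, Matrix.conjTranspose_conjTranspose,
      Matrix.mul_assoc]
  rw [hc]
  set Φ := ρ.res θ with hΦ
  set B := cpx S.Bu with hB
  set D := cpx S.Bw with hD
  set L := cpx ρ.L with hL
  have e : (Φ * B)ᴴ * (Φ * D) + (1 + L * (Φ * B))ᴴ * (L * (Φ * D)) =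
      Bᴴ * (Φᴴ * (1 + Lᴴ * L) * Φ) * D + L * (Φ * D) := by
    simp only [Matrix.conjTranspose_mul, Matrix.conjTranspose_add, Matrix.conjTranspose_one,
      Matrix.mul_add, Matrix.add_mul, Matrix.mul_one, Matrix.one_mul, Matrix.mul_assoc]
    abel
  have e2 : Bᴴ * (Φᴴ * (1 + Lᴴ * L) * Φ) * D + L * (Φ * D) =
      Bᴴ * cpx ρ.P * D + Bᴴ * (Φᴴ * ρ.Aclᴴ * cpx ρ.P) * D
        + (L + Bᴴ * cpx ρ.P * ρ.Acl) * (Φ * D) := by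
    rw [h]
    simp only [Matrix.mul_add, Matrix.add_mul, Matrix.mul_assoc]
    abel
  rw [e, e2, hs, Matrix.zero_mul, add_zero]

end Regulator

/-! ### Closed loops in the frequency domain -/

section loops
variable {dx du dw : ℕ}

/-- The `H_2` transfer matrices `T : w ↦ (x, u)` of causal closed loops, described by the state
equation `z X = A X + B_u U + B_w` on the unit circle. The controller may be any element of `H_2`. -/
def loops (S : System dx du dw) : Set (TransferMatrix (Fin dx ⊕ Fin du) (Fin dw)) :=
  {T | MemH 2 T ∧ ∀ᵐ θ ∂circ, (fourier 1 θ : ℂ) • (T θ).toRows₁ =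
    cpx S.A * (T θ).toRows₁ + cpx S.Bu * (T θ).toRows₂ + cpx S.Bw}

variable {S : System dx du dw}

theorem markov_congr_ae {m n : Type} {M N : TransferMatrix m n} (h : M =ᵐ[circ] N) (k : ℤ) :
    markov M k = markov N k := by
  ext i j
  exact zcoeff_congr_ae (by filter_upwards [h] with θ hθ; rw [hθ]) k

theorem MemH.ae_eq_of_markov {m n : Type} [Finite m] [Finite n] {p : ℝ≥0∞} (hp : 1 ≤ p)
    {M N : TransferMatrix m n} (hM : MemH p M) (hN : MemH p N)
    (h : ∀ k : ℕ, markov M k = markov N k) : M =ᵐ[circ] N := by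
  have h1 : ∀ i j, (fun θ => M θ i j) =ᵐ[circ] fun θ => N θ i j := fun i j =>
    ae_eq_of_zcoeff ((hM.memLp i j).integrable hp) ((hN.memLp i j).integrable hp) fun k => by
      rcases lt_or_ge k 0 with hk | hk
      · rw [((memH_iff hp).1 hM i j).causal k hk, ((memH_iff hp).1 hN i j).causal k hk]
      · lift k to ℕ using hk
        exact congrFun (congrFun (h k) i) j
  filter_upwards [ae_all_iff.2 fun i => ae_all_iff.2 (h1 i)] with θ hθ
  ext i j
  exact hθ i j

theorem IsClosedLoop.ae_eq {K : TransferMatrix (Fin du) (Fin dw)}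
    {T T' : TransferMatrix (Fin dx ⊕ Fin du) (Fin dw)} (h : IsClosedLoop S K T)
    (h' : IsClosedLoop S K T') : T =ᵐ[circ] T' :=
  h.1.ae_eq_of_markov one_le_two h'.1 fun k => by rw [h.2, h'.2]

/-- The closed loop is unique up to null sets, so the infimum in `atClosedLoop` is over one value. -/
theorem atClosedLoop_eq {K : TransferMatrix (Fin du) (Fin dw)}
    {T : TransferMatrix (Fin dx ⊕ Fin du) (Fin dw)} (h : IsClosedLoop S K T)
    {F : TransferMatrix (Fin dx ⊕ Fin du) (Fin dw) → ℝ≥0∞}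
    (hF : ∀ T', T =ᵐ[circ] T' → F T = F T') : atClosedLoop S K F = F T :=
  le_antisymm (iInf₂_le T h) (le_iInf₂ fun T' h' => (hF T' (h.ae_eq h')).le)

theorem exists_isClosedLoop_of_lt_top {K : TransferMatrix (Fin du) (Fin dw)}
    {F : TransferMatrix (Fin dx ⊕ Fin du) (Fin dw) → ℝ≥0∞} (h : atClosedLoop S K F < ∞) :
    ∃ T, IsClosedLoop S K T := by
  by_contra! hne
  refine h.ne ?_
  simp [atClosedLoop, hne]

theorem closedLoopMarkov_toRows₁_zero (K : TransferMatrix (Fin du) (Fin dw)) :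
    (closedLoopMarkov S K 0).toRows₁ = 0 := by
  simp [closedLoopMarkov, markovSS]

theorem cpx_markovSS_succ {m : ℕ} (A : Matrix (Fin dx) (Fin dx) ℝ) (B : Matrix (Fin dx) (Fin m) ℝ)
    (k : ℕ) : (markovSS A B (k + 1)).map Complex.ofReal = cpx A ^ k * cpx B := by
  rw [markovSS, ← cpx_pow]
  exact cpx_mul _ _

/-- The state equation in the time domain. -/
theorem closedLoopMarkov_toRows₁_succ (K : TransferMatrix (Fin du) (Fin dw)) (k : ℕ) :
    (closedLoopMarkov S K (k + 1)).toRows₁ = cpx S.A * (closedLoopMarkov S K k).toRows₁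
      + cpx S.Bu * markov K k + if k = 0 then cpx S.Bw else 0 := by
  have hX : ∀ k, (closedLoopMarkov S K (k + 1)).toRows₁ =
      ∑ p ∈ Finset.HasAntidiagonal.antidiagonal k, cpx S.A ^ p.1 * cpx S.Bu * markov K (p.2 : ℤ)
        + cpx S.A ^ k * cpx S.Bw := by
    intro k
    rw [closedLoopMarkov, Matrix.toRows₁_fromRows, Finset.Nat.sum_antidiagonal_succ]
    have h0 : markovSS S.A S.Bu 0 = 0 := rfl
    simp only [cpx_markovSS_succ, h0]
    simp
  rcases k with _ | k
  · rw [hX, closedLoopMarkov_toRows₁_zero]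
    simp
  · rw [hX, hX, Finset.Nat.sum_antidiagonal_succ, Matrix.mul_add, Matrix.mul_sum, pow_succ']
    simp only [pow_zero, Matrix.one_mul, pow_succ', Matrix.mul_assoc, Nat.succ_ne_zero, if_false,
      add_zero]
    abel

/-- The defect of the state equation. -/
def stateDefect (S : System dx du dw) (T : TransferMatrix (Fin dx ⊕ Fin du) (Fin dw)) :
    TransferMatrix (Fin dx) (Fin dw) := fun θ => (fourier 1 θ : ℂ) • (T θ).toRows₁ -
      (cpx S.A * (T θ).toRows₁ + cpx S.Bu * (T θ).toRows₂ + cpx S.Bw)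

theorem stateDefect_apply (T : TransferMatrix (Fin dx ⊕ Fin du) (Fin dw)) (i : Fin dx)
    (j : Fin dw) : (fun θ => stateDefect S T θ i j) = fun θ =>
      (fourier 1 θ : ℂ) * T θ (Sum.inl i) j - ((∑ l, cpx S.A i l * T θ (Sum.inl l) j
        + ∑ l, cpx S.Bu i l * T θ (Sum.inr l) j) + cpx S.Bw i j) := rfl

/-- The Laurent coefficients of the defect are the defects of the state equation in the time
domain. -/
theorem integrable_stateDefect {T : TransferMatrix (Fin dx ⊕ Fin du) (Fin dw)} (hT : MemH 2 T)
    (i : Fin dx) (j : Fin dw) : Integrable (fun θ => stateDefect S T θ i j) circ ∧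
    ∀ k : ℤ, zcoeff (fun θ => stateDefect S T θ i j) k =
    ((markov T (k + 1)).toRows₁ - (cpx S.A * (markov T k).toRows₁ + cpx S.Bu * (markov T k).toRows₂
      + if k = 0 then cpx S.Bw else 0)) i j := by
  have hint : ∀ i j, Integrable (fun θ => T θ i j) circ := fun i j =>
    (hT.memLp i j).integrable one_le_two
  have h1 : ∀ l, Integrable (fun θ => cpx S.A i l * T θ (Sum.inl l) j) circ := fun l =>
    (hint _ _).const_mul _
  have h2 : ∀ l, Integrable (fun θ => cpx S.Bu i l * T θ (Sum.inr l) j) circ := fun l =>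
    (hint _ _).const_mul _
  have h3 : Integrable (fun θ => ∑ l, cpx S.A i l * T θ (Sum.inl l) j) circ :=
    integrable_finsetSum _ fun l _ => h1 l
  have h4 : Integrable (fun θ => ∑ l, cpx S.Bu i l * T θ (Sum.inr l) j) circ :=
    integrable_finsetSum _ fun l _ => h2 l
  have h5 : Integrable (fun θ => ∑ l, cpx S.A i l * T θ (Sum.inl l) j
      + ∑ l, cpx S.Bu i l * T θ (Sum.inr l) j) circ := h3.add h4
  have h6 : Integrable (fun θ => (∑ l, cpx S.A i l * T θ (Sum.inl l) j
      + ∑ l, cpx S.Bu i l * T θ (Sum.inr l) j) + cpx S.Bw i j) circ := h5.add (integrable_const _)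
  have h7 := integrable_fourier_mul (hint (Sum.inl i) j) 1
  rw [stateDefect_apply]
  refine ⟨h7.sub h6, fun k => ?_⟩
  rw [zcoeff_sub h7 h6, zcoeff_fourier_mul,
    zcoeff_add h5 (integrable_const _), zcoeff_add h3 h4, zcoeff_const,
    zcoeff_sum _ fun l _ => h1 l, zcoeff_sum _ fun l _ => h2 l]
  simp only [zcoeff_const_mul, Matrix.sub_apply, Matrix.add_apply, Matrix.mul_apply]
  congr 2
  split_ifs <;> simp

/-- The closed loops of controllers in `H_∞` are the elements of `loops S` whose input block is the
controller. -/
theorem isClosedLoop_iff {K : TransferMatrix (Fin du) (Fin dw)} (hK : MemH ∞ K)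
    {T : TransferMatrix (Fin dx ⊕ Fin du) (Fin dw)} :
    IsClosedLoop S K T ↔ T ∈ loops S ∧ (fun θ => (T θ).toRows₂) =ᵐ[circ] K := by
  have hK2 : MemH 2 K := hK.mono one_le_two le_top
  constructor
  · rintro ⟨hT, hTk⟩
    have hU : ∀ k : ℤ, (markov T k).toRows₂ = markov K k := by
      intro k
      rcases lt_or_ge k 0 with hk | hk
      · rw [hT.causal k hk, hK.causal k hk]; rfl
      · lift k to ℕ using hk
        rw [hTk k, closedLoopMarkov, Matrix.toRows₂_fromRows]
    refine ⟨⟨hT, ?_⟩, (hT.toRows₂ one_le_two).ae_eq_of_markov one_le_two hK2 fun k => hU k⟩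
    have hzero : ∀ i j, (fun θ => stateDefect S T θ i j) =ᵐ[circ] 0 := by
      intro i j
      obtain ⟨hint, hcoeff⟩ := integrable_stateDefect (S := S) hT i j
      refine ae_eq_zero_of_zcoeff hint fun k => ?_
      · rw [hcoeff]
        suffices h : (markov T (k + 1)).toRows₁ = cpx S.A * (markov T k).toRows₁
            + cpx S.Bu * (markov T k).toRows₂ + if k = 0 then cpx S.Bw else 0 by
          rw [h, sub_self]; rfl
        rcases lt_trichotomy k (-1) with hk | hk | hk
        · rw [hT.causal (k + 1) (by omega), hT.causal k (by omega), if_neg (by omega)]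
          have z1 : (0 : Matrix (Fin dx ⊕ Fin du) (Fin dw) ℂ).toRows₁ = 0 := rfl
          have z2 : (0 : Matrix (Fin dx ⊕ Fin du) (Fin dw) ℂ).toRows₂ = 0 := rfl
          simp [z1, z2]
        · subst hk
          have z1 : (0 : Matrix (Fin dx ⊕ Fin du) (Fin dw) ℂ).toRows₁ = 0 := rfl
          have z2 : (0 : Matrix (Fin dx ⊕ Fin du) (Fin dw) ℂ).toRows₂ = 0 := rfl
          have h0 := hTk 0
          rw [Nat.cast_zero] at h0
          rw [neg_add_cancel, h0, closedLoopMarkov_toRows₁_zero, hT.causal (-1) (by norm_num)]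
          simp [z1, z2]
        · lift k to ℕ using by omega
          have h1 := hTk (k + 1)
          rw [Nat.cast_succ] at h1
          rw [h1, closedLoopMarkov_toRows₁_succ, hTk k, closedLoopMarkov, Matrix.toRows₂_fromRows]
          simp
    filter_upwards [ae_all_iff.2 fun i => ae_all_iff.2 (hzero i)] with θ hθ
    rw [← sub_eq_zero]
    ext i j
    exact hθ i j
  · rintro ⟨⟨hT, heq⟩, hU⟩
    have hstep : ∀ k : ℤ, (markov T (k + 1)).toRows₁ = cpx S.A * (markov T k).toRows₁
        + cpx S.Bu * (markov T k).toRows₂ + if k = 0 then cpx S.Bw else 0 := by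
      intro k
      rw [← sub_eq_zero]
      ext i j
      rw [← (integrable_stateDefect hT i j).2, Matrix.zero_apply]
      have : (fun θ => stateDefect S T θ i j) =ᵐ[circ] fun _ => 0 := by
        filter_upwards [heq] with θ hθ
        rw [stateDefect, hθ, sub_self]; rfl
      rw [zcoeff_congr_ae this, zcoeff_const]
      simp
    have hUk : ∀ k : ℤ, (markov T k).toRows₂ = markov K k := fun k => markov_congr_ae hU k
    refine ⟨hT, fun k => ?_⟩
    have hX : (markov T k).toRows₁ = (closedLoopMarkov S K k).toRows₁ := by
      induction k with
      | zero =>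
        have := hstep (-1)
        rw [neg_add_cancel, hT.causal (-1) (by norm_num)] at this
        have z1 : (0 : Matrix (Fin dx ⊕ Fin du) (Fin dw) ℂ).toRows₁ = 0 := rfl
        have z2 : (0 : Matrix (Fin dx ⊕ Fin du) (Fin dw) ℂ).toRows₂ = 0 := rfl
        rw [closedLoopMarkov_toRows₁_zero, Nat.cast_zero, this, z1, z2]
        simp
      | succ k ih =>
        rw [Nat.cast_succ, hstep, ih, closedLoopMarkov_toRows₁_succ, hUk]
        simp
    rw [← Matrix.fromRows_toRows (markov T k), hX, hUk, closedLoopMarkov, Matrix.toRows₁_fromRows]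

theorem toRows₁_add {m₁ m₂ n : Type} (A B : Matrix (m₁ ⊕ m₂) n ℂ) :
    (A + B).toRows₁ = A.toRows₁ + B.toRows₁ := rfl

theorem toRows₂_add {m₁ m₂ n : Type} (A B : Matrix (m₁ ⊕ m₂) n ℂ) :
    (A + B).toRows₂ = A.toRows₂ + B.toRows₂ := rfl

/-- The deviation `V = U - L X` of the input from the regulator feedback. -/
def Regulator.deviation (ρ : Regulator S) (T : TransferMatrix (Fin dx ⊕ Fin du) (Fin dw)) :
    TransferMatrix (Fin du) (Fin dw) := fun θ => (T θ).toRows₂ - cpx ρ.L * (T θ).toRows₁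

theorem Regulator.memH_deviation (ρ : Regulator S)
    {T : TransferMatrix (Fin dx ⊕ Fin du) (Fin dw)} {p : ℝ≥0∞} (hp : 2 ≤ p) (hT : MemH p T) :
    MemH p (ρ.deviation T) := by
  have hp1 : 1 ≤ p := one_le_two.trans hp
  exact (hT.toRows₂ hp1).sub hp1 ((MemH.ofReal le_top ρ.L).mul hp (hT.toRows₁ hp1))

/-- Every closed loop is the regulated closed loop driven by its deviation. No stability of `A` is
needed here, since `A + B_u L` is a Schur matrix. -/
theorem Regulator.eq_inner_mul_deviation_add_drift (ρ : Regulator S)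
    {T : TransferMatrix (Fin dx ⊕ Fin du) (Fin dw)} (hT : T ∈ loops S) :
    ∀ᵐ θ ∂circ, T θ = ρ.inner θ * ρ.deviation T θ + ρ.drift θ := by
  filter_upwards [hT.2] with θ hθ
  set X := (T θ).toRows₁ with hX
  set U := (T θ).toRows₂ with hU
  have hV : U = ρ.deviation T θ + cpx ρ.L * X := by simp [deviation, hX, hU]
  set V := ρ.deviation T θ with hVdef
  have h1 : ((fourier 1 θ : ℂ) • 1 - ρ.Acl) * X = cpx S.Bu * V + cpx S.Bw := by
    rw [Matrix.sub_mul, Matrix.smul_mul, Matrix.one_mul, hθ, Acl, cpx_add, cpx_mul, hV]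
    simp only [Matrix.mul_add, Matrix.add_mul, Matrix.mul_assoc]
    abel
  have h2 : X = ρ.res θ * cpx S.Bu * V + ρ.res θ * cpx S.Bw := by
    have := congrArg (fun M => ρ.res θ * M) h1
    simp only [← Matrix.mul_assoc, ρ.res_mul_sub, Matrix.one_mul, Matrix.mul_add] at this
    exact this
  rw [← Matrix.fromRows_toRows (T θ), ← hX, ← hU, inner, drift, Matrix.fromRows_mul]
  have h3 : U = (1 + cpx ρ.L * (ρ.res θ * cpx S.Bu)) * V + cpx ρ.L * (ρ.res θ * cpx S.Bw) := by
    rw [hV, h2]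
    simp only [Matrix.mul_add, Matrix.add_mul, Matrix.one_mul, Matrix.mul_assoc]
    abel
  ext (i | i) j
  · simp only [Matrix.add_apply, Matrix.fromRows_apply_inl]
    rw [← Matrix.add_apply, ← h2]
  · simp only [Matrix.add_apply, Matrix.fromRows_apply_inr]
    rw [← Matrix.add_apply, ← h3]

theorem Regulator.drift_mem_loops (ρ : Regulator S) : ρ.drift ∈ loops S := by
  refine ⟨ρ.memH_drift.mono one_le_two le_top, ae_of_all _ fun θ => ?_⟩
  have h := ρ.smul_res θ
  simp only [drift, Matrix.toRows₁_fromRows, Matrix.toRows₂_fromRows]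
  rw [← Matrix.smul_mul, h, Acl, cpx_add, cpx_mul]
  simp only [Matrix.add_mul, Matrix.one_mul, Matrix.mul_assoc]
  abel

theorem Regulator.add_inner_mul_mem_loops (ρ : Regulator S)
    {T : TransferMatrix (Fin dx ⊕ Fin du) (Fin dw)} (hT : T ∈ loops S)
    {D : TransferMatrix (Fin du) (Fin dw)} (hD : MemH 2 D) :
    (fun θ => T θ + ρ.inner θ * D θ) ∈ loops S := by
  refine ⟨hT.1.add one_le_two (ρ.memH_inner.mul le_rfl hD), ?_⟩
  filter_upwards [hT.2] with θ hθ
  have h := ρ.smul_res θ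
  have h1 : (fourier 1 θ : ℂ) • (ρ.res θ * cpx S.Bu * D θ) = cpx S.A * (ρ.res θ * cpx S.Bu * D θ)
      + cpx S.Bu * ((1 + cpx ρ.L * (ρ.res θ * cpx S.Bu)) * D θ) := by
    rw [← Matrix.smul_mul, ← Matrix.smul_mul, h, Acl, cpx_add, cpx_mul]
    simp only [Matrix.mul_add, Matrix.add_mul, Matrix.one_mul, Matrix.mul_assoc]
    abel
  rw [toRows₁_add, toRows₂_add, inner, Matrix.fromRows_mul, Matrix.toRows₁_fromRows,
    Matrix.toRows₂_fromRows, smul_add, hθ, h1]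
  simp only [Matrix.mul_add]
  abel

/-- Closed loops may be combined with weights in `H_∞`. -/
theorem add_smul_sub_mem_loops {T₀ T : TransferMatrix (Fin dx ⊕ Fin du) (Fin dw)}
    (hT₀ : T₀ ∈ loops S) (hT : T ∈ loops S) {g : UnitAddCircle → ℂ} (hg : HardyFn ∞ g) :
    (fun θ => T₀ θ + g θ • (T θ - T₀ θ)) ∈ loops S := by
  refine ⟨hT₀.1.add one_le_two ((hT.1.sub one_le_two hT₀.1).smul le_rfl hg), ?_⟩
  filter_upwards [hT.2, hT₀.2] with θ h h₀
  have e1 : (T₀ θ + g θ • (T θ - T₀ θ)).toRows₁ =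
    (T₀ θ).toRows₁ + g θ • ((T θ).toRows₁ - (T₀ θ).toRows₁) := rfl
  have e2 : (T₀ θ + g θ • (T θ - T₀ θ)).toRows₂ =
    (T₀ θ).toRows₂ + g θ • ((T θ).toRows₂ - (T₀ θ).toRows₂) := rfl
  rw [e1, e2, smul_add, smul_comm, smul_sub, h, h₀]
  simp only [Matrix.mul_add, Matrix.mul_smul, Matrix.mul_sub, smul_sub, smul_add]
  abel

/-- A bounded closed loop comes from a controller in `H_∞`. -/
theorem isClosedLoop_of_memH {T : TransferMatrix (Fin dx ⊕ Fin du) (Fin dw)} (hT : T ∈ loops S)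
    (hb : MemH ∞ T) : (fun θ => (T θ).toRows₂) ∈ controllers du dw ∧
      IsClosedLoop S (fun θ => (T θ).toRows₂) T := by
  have hK := hb.toRows₂ le_top
  exact ⟨hK, (isClosedLoop_iff hK).2 ⟨hT, ae_eq_refl _⟩⟩

end loops

/-! ### Weighted quadratic forms of matrices -/

section forms
variable {m n l : Type} [Fintype m] [Fintype n] [Fintype l]

/-- The squared Frobenius norm. -/
def fro (M : Matrix m n ℂ) : ℝ := ∑ i, ∑ j, ‖M i j‖ ^ 2

/-- The sesquilinear form `Tr(X* Y W)` with weight `W`. -/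
def wform (X Y : Matrix m n ℂ) (W : Matrix n n ℂ) : ℂ := (Xᴴ * Y * W).trace

/-- The quadratic form `Re Tr(M* M W)` with weight `W`. -/
def wquad (M : Matrix m n ℂ) (W : Matrix n n ℂ) : ℝ := (Mᴴ * M * W).trace.re

theorem fro_nonneg (M : Matrix m n ℂ) : 0 ≤ fro M := by unfold fro; positivity

theorem norm_sq_le_fro (M : Matrix m n ℂ) (i : m) (j : n) : ‖M i j‖ ^ 2 ≤ fro M :=
  (Finset.single_le_sum (f := fun j => ‖M i j‖ ^ 2) (fun _ _ => by positivity)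
    (Finset.mem_univ j)).trans
    (Finset.single_le_sum (f := fun i => ∑ j, ‖M i j‖ ^ 2) (fun _ _ => by positivity)
      (Finset.mem_univ i))

theorem trace_conjTranspose_mul (X Y : Matrix m n ℂ) :
    (Xᴴ * Y).trace = ∑ i, ∑ j, conj (X i j) * Y i j := by
  rw [Matrix.trace, Finset.sum_comm]
  rfl

theorem trace_conjTranspose_mul_self_re (M : Matrix m n ℂ) : (Mᴴ * M).trace.re = fro M := by
  rw [trace_conjTranspose_mul, fro, Complex.re_sum]
  refine Finset.sum_congr rfl fun i _ => ?_
  rw [Complex.re_sum]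
  refine Finset.sum_congr rfl fun j _ => ?_
  rw [Complex.conj_mul', ← Complex.ofReal_pow, Complex.ofReal_re]

theorem wquad_one [DecidableEq n] (M : Matrix m n ℂ) : wquad M 1 = fro M := by
  rw [wquad, Matrix.mul_one, trace_conjTranspose_mul_self_re]

theorem wquad_add (M : Matrix m n ℂ) (W W' : Matrix n n ℂ) :
    wquad M (W + W') = wquad M W + wquad M W' := by
  simp [wquad, Matrix.mul_add, Matrix.trace_add]

theorem wquad_smul (M : Matrix m n ℂ) (c : ℝ) (W : Matrix n n ℂ) :
    wquad M (c • W) = c * wquad M W := by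
  simp [wquad, Matrix.trace_smul]

theorem wform_self_re (M : Matrix m n ℂ) (W : Matrix n n ℂ) : (wform M M W).re = wquad M W := rfl

theorem wform_mul_conjTranspose (X Y : Matrix m n ℂ) (B : Matrix n l ℂ) :
    wform X Y (B * Bᴴ) = ((X * B)ᴴ * (Y * B)).trace := by
  rw [wform, Matrix.conjTranspose_mul, ← Matrix.mul_assoc, Matrix.trace_mul_comm]
  simp only [Matrix.mul_assoc]

theorem wquad_mul_conjTranspose (M : Matrix m n ℂ) (B : Matrix n l ℂ) :
    wquad M (B * Bᴴ) = fro (M * B) := by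
  rw [← wform_self_re, wform_mul_conjTranspose, trace_conjTranspose_mul_self_re]

open scoped MatrixOrder Matrix.Norms.L2Operator in
theorem exists_eq_mul_conjTranspose {W : Matrix n n ℂ} (hW : W.PosSemidef) :
    ∃ B : Matrix n n ℂ, W = B * Bᴴ := by
  classical
  obtain ⟨B, hB⟩ := CStarAlgebra.nonneg_iff_eq_mul_star_self.1 hW.nonneg
  exact ⟨B, hB⟩

theorem wquad_nonneg {W : Matrix n n ℂ} (hW : W.PosSemidef) (M : Matrix m n ℂ) :
    0 ≤ wquad M W := by
  obtain ⟨B, rfl⟩ := exists_eq_mul_conjTranspose hW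
  rw [wquad_mul_conjTranspose]
  exact fro_nonneg _

theorem norm_wform_le {W : Matrix n n ℂ} (hW : W.PosSemidef) (X Y : Matrix m n ℂ) :
    ‖wform X Y W‖ ≤ wquad X W + wquad Y W := by
  obtain ⟨B, rfl⟩ := exists_eq_mul_conjTranspose hW
  rw [wquad_mul_conjTranspose, wquad_mul_conjTranspose, wform_mul_conjTranspose,
    trace_conjTranspose_mul, fro, fro, ← Finset.sum_add_distrib]
  refine (norm_sum_le _ _).trans (Finset.sum_le_sum fun i _ => ?_)
  rw [← Finset.sum_add_distrib]
  refine (norm_sum_le _ _).trans (Finset.sum_le_sum fun j _ => ?_)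
  rw [norm_mul, RCLike.norm_conj]
  nlinarith [sq_nonneg (‖(X * B) i j‖ - ‖(Y * B) i j‖), sq_nonneg (‖(X * B) i j‖),
    sq_nonneg (‖(Y * B) i j‖)]

/-- Submultiplicativity of the Frobenius norm. -/
theorem fro_mul_le (A : Matrix m n ℂ) (B : Matrix n l ℂ) : fro (A * B) ≤ fro A * fro B := by
  have h : ∀ i j, ‖(A * B) i j‖ ^ 2 ≤ (∑ k, ‖A i k‖ ^ 2) * ∑ k, ‖B k j‖ ^ 2 := by
    intro i j
    have h1 : ‖(A * B) i j‖ ≤ ∑ k, ‖A i k‖ * ‖B k j‖ := by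
      rw [Matrix.mul_apply]
      exact (norm_sum_le _ _).trans (Finset.sum_le_sum fun k _ => (norm_mul _ _).le)
    exact (pow_le_pow_left₀ (norm_nonneg _) h1 2).trans (Finset.sum_mul_sq_le_sq_mul_sq _ _ _)
  have h2 : fro A * fro B = ∑ i, ∑ j, (∑ k, ‖A i k‖ ^ 2) * ∑ k, ‖B k j‖ ^ 2 := by
    have e : fro B = ∑ j, ∑ k, ‖B k j‖ ^ 2 := by rw [fro, Finset.sum_comm]
    rw [e, fro, Finset.sum_mul_sum]
  rw [h2, fro]
  exact Finset.sum_le_sum fun i _ => Finset.sum_le_sum fun j _ => h i j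

theorem wquad_mul_le {W : Matrix n n ℂ} (hW : W.PosSemidef) (A : Matrix l m ℂ)
    (M : Matrix m n ℂ) : wquad (A * M) W ≤ fro A * wquad M W := by
  obtain ⟨B, rfl⟩ := exists_eq_mul_conjTranspose hW
  rw [wquad_mul_conjTranspose, wquad_mul_conjTranspose, Matrix.mul_assoc]
  exact fro_mul_le _ _

theorem wquad_le_fro_mul {W : Matrix n n ℂ} (hW : W.PosSemidef) (M : Matrix m n ℂ) :
    wquad M W ≤ fro M * W.trace.re := by
  obtain ⟨B, rfl⟩ := exists_eq_mul_conjTranspose hW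
  rw [wquad_mul_conjTranspose, Matrix.trace_mul_comm, trace_conjTranspose_mul_self_re]
  exact fro_mul_le _ _

theorem trace_re_nonneg {W : Matrix n n ℂ} (hW : W.PosSemidef) : 0 ≤ W.trace.re := by
  obtain ⟨B, rfl⟩ := exists_eq_mul_conjTranspose hW
  rw [Matrix.trace_mul_comm, trace_conjTranspose_mul_self_re]
  exact fro_nonneg _

theorem norm_apply_le_trace {W : Matrix n n ℂ} (hW : W.PosSemidef) (i j : n) :
    ‖W i j‖ ≤ W.trace.re := by
  obtain ⟨B, rfl⟩ := exists_eq_mul_conjTranspose hW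
  have h1 : ∀ i, ∑ k, ‖B i k‖ ^ 2 ≤ fro B := fun i =>
    Finset.single_le_sum (f := fun i => ∑ k, ‖B i k‖ ^ 2)
      (fun _ _ => by positivity) (Finset.mem_univ i)
  rw [Matrix.trace_mul_comm, trace_conjTranspose_mul_self_re, Matrix.mul_apply]
  have h2 : ‖∑ k, B i k * Bᴴ k j‖ ≤ ∑ k, (‖B i k‖ ^ 2 + ‖B j k‖ ^ 2) / 2 := by
    refine (norm_sum_le _ _).trans (Finset.sum_le_sum fun k _ => ?_)
    rw [norm_mul, Matrix.conjTranspose_apply, norm_star]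
    nlinarith [sq_nonneg (‖B i k‖ - ‖B j k‖)]
  refine h2.trans ?_
  rw [← Finset.sum_div, Finset.sum_add_distrib]
  linarith [h1 i, h1 j]

theorem wquad_parallelogram (X Y : Matrix m n ℂ) (W : Matrix n n ℂ) :
    wquad ((1 / 2 : ℝ) • (X + Y)) W + 1 / 4 * wquad (X - Y) W =
      1 / 2 * wquad X W + 1 / 2 * wquad Y W := by
  simp only [wquad, Matrix.conjTranspose_smul, Matrix.conjTranspose_add, Matrix.conjTranspose_sub,
    Matrix.smul_mul, Matrix.mul_smul, Matrix.add_mul, Matrix.mul_add, Matrix.sub_mul,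
    Matrix.mul_sub, Matrix.trace_smul, Matrix.trace_add, Matrix.trace_sub, star_trivial,
    Complex.add_re, Complex.sub_re, Complex.real_smul, Complex.re_ofReal_mul]
  ring

theorem wquad_add_smul {W : Matrix n n ℂ} (hW : W.IsHermitian) (X D : Matrix m n ℂ) (t : ℝ) :
    wquad (X + t • D) W = wquad X W + 2 * t * (wform D X W).re + t ^ 2 * wquad D W := by
  have h : (Xᴴ * D * W).trace.re = (Dᴴ * X * W).trace.re := by
    have : (Dᴴ * X * W).trace = star (Xᴴ * D * W).trace := by
      rw [← Matrix.trace_conjTranspose]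
      simp only [Matrix.conjTranspose_mul, Matrix.conjTranspose_conjTranspose, hW.eq]
      rw [Matrix.trace_mul_comm]
    rw [this]; simp
  simp only [wquad, wform, Matrix.conjTranspose_smul, Matrix.conjTranspose_add,
    Matrix.smul_mul, Matrix.mul_smul, Matrix.add_mul, Matrix.mul_add,
    Matrix.trace_smul, Matrix.trace_add, star_trivial,
    Complex.add_re, Complex.real_smul, Complex.re_ofReal_mul, h]
  ring

theorem wquad_real_smul (M : Matrix m n ℂ) (c : ℝ) (W : Matrix n n ℂ) :
    wquad (c • M) W = c ^ 2 * wquad M W := by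
  simp only [wquad, Matrix.conjTranspose_smul, Matrix.smul_mul, Matrix.mul_smul,
    Matrix.trace_smul, star_trivial, Complex.real_smul, Complex.re_ofReal_mul]
  ring

theorem wquad_smul_left (M : Matrix m n ℂ) (c : ℂ) (W : Matrix n n ℂ) :
    wquad (c • M) W = ‖c‖ ^ 2 * wquad M W := by
  have : ((c • M)ᴴ * (c • M) * W) = ((‖c‖ ^ 2 : ℝ) : ℂ) • (Mᴴ * M * W) := by
    rw [Matrix.conjTranspose_smul, Matrix.smul_mul, Matrix.mul_smul, smul_smul, Matrix.smul_mul,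
      Complex.star_def, Complex.conj_mul', Complex.ofReal_pow]
  rw [wquad, this, Matrix.trace_smul, smul_eq_mul, Complex.re_ofReal_mul, wquad]

theorem wquad_add_le {W : Matrix n n ℂ} (hW : W.PosSemidef) (X Y : Matrix m n ℂ) :
    wquad (X + Y) W ≤ 2 * wquad X W + 2 * wquad Y W := by
  have h1 := wquad_parallelogram X Y W
  rw [wquad_real_smul] at h1
  have h2 := wquad_nonneg hW (X - Y)
  linarith

theorem fro_add_le (X Y : Matrix m n ℂ) : fro (X + Y) ≤ 2 * fro X + 2 * fro Y := by
  classical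
  have := wquad_add_le Matrix.PosSemidef.one X Y
  simpa only [wquad_one] using this

theorem fro_le_wquad [DecidableEq n] {W : Matrix n n ℂ} (hW : (W - 1).PosSemidef)
    (M : Matrix m n ℂ) : fro M ≤ wquad M W := by
  have h := wquad_add M (W - 1) 1
  rw [sub_add_cancel, wquad_one] at h
  linarith [wquad_nonneg hW M]

section
open scoped Matrix.Norms.L2Operator

theorem fro_mul_le_opNorm [DecidableEq n] (T : Matrix m n ℂ) (B : Matrix n l ℂ) :
    fro (T * B) ≤ ‖T‖ ^ 2 * fro B := by
  have e : ∀ {k : Type} [Fintype k] (M : Matrix k l ℂ),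
      fro M = ∑ j, ‖WithLp.toLp 2 (fun i => M i j)‖ ^ 2 := by
    intro k _ M
    rw [fro, Finset.sum_comm]
    refine Finset.sum_congr rfl fun j _ => ?_
    rw [EuclideanSpace.norm_sq_eq]
  rw [e, e, Finset.mul_sum]
  refine Finset.sum_le_sum fun j _ => ?_
  have h := Matrix.l2_opNorm_mulVec T (WithLp.toLp 2 fun i => B i j)
  rw [← mul_pow]
  exact pow_le_pow_left₀ (norm_nonneg _) h 2

theorem wquad_le_opNorm [DecidableEq n] {W : Matrix n n ℂ} (hW : W.PosSemidef)
    (T : Matrix m n ℂ) : wquad T W ≤ ‖T‖ ^ 2 * W.trace.re := by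
  obtain ⟨B, rfl⟩ := exists_eq_mul_conjTranspose hW
  rw [wquad_mul_conjTranspose, Matrix.trace_mul_comm, trace_conjTranspose_mul_self_re]
  exact fro_mul_le_opNorm _ _

theorem opNorm_le_of_forall [DecidableEq n] {T : Matrix m n ℂ} {γ : ℝ} (hγ : 0 ≤ γ)
    (h : ∀ x : n → ℂ, ∑ i, ‖(T *ᵥ x) i‖ ^ 2 ≤ γ ^ 2 * ∑ j, ‖x j‖ ^ 2) : ‖T‖ ≤ γ := by
  rw [Matrix.l2_opNorm_def]
  refine ContinuousLinearMap.opNorm_le_bound _ hγ fun x => ?_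
  refine le_of_sq_le_sq ?_ (by positivity)
  rw [mul_pow, EuclideanSpace.norm_sq_eq, EuclideanSpace.norm_sq_eq]
  exact h (WithLp.ofLp x)

theorem opNorm_sq_le_fro [DecidableEq n] (T : Matrix m n ℂ) : ‖T‖ ^ 2 ≤ fro T := by
  have h : ‖T‖ ≤ Real.sqrt (fro T) := by
    refine opNorm_le_of_forall (Real.sqrt_nonneg _) fun x => ?_
    rw [Real.sq_sqrt (fro_nonneg _)]
    have := fro_mul_le T (Matrix.of fun i (_ : Unit) => x i)
    simpa [fro, Matrix.mul_apply, Matrix.mulVec, dotProduct] using this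
  calc ‖T‖ ^ 2 ≤ Real.sqrt (fro T) ^ 2 := pow_le_pow_left₀ (norm_nonneg _) h 2
    _ = fro T := Real.sq_sqrt (fro_nonneg _)

end

end forms

theorem posSemidef_of_sub_one {n : Type} [DecidableEq n] {W : Matrix n n ℂ}
    (hW : (W - 1).PosSemidef) :
    W.PosSemidef := by
  have := hW.add Matrix.PosSemidef.one
  rwa [sub_add_cancel] at this

/-! ### Matrix valued functions -/

section entries
variable {m n l : Type}

/-- Almost everywhere strong measurability, entry by entry. -/
def EntryAESM (M : TransferMatrix m n) : Prop :=
  ∀ i j, AEStronglyMeasurable (fun θ => M θ i j) circ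

/-- The symmetry of transfer matrices of operators with real blocks. -/
def EntrySymm (M : TransferMatrix m n) : Prop := ∀ i j, ConjSymm fun θ => M θ i j

theorem MemL.entryAESM {p : ℝ≥0∞} {M : TransferMatrix m n} (hM : MemL p M) : EntryAESM M :=
  fun i j => (hM.memLp i j).1

theorem MemL.entrySymm {p : ℝ≥0∞} (hp : 1 ≤ p) {M : TransferMatrix m n} (hM : MemL p M) :
    EntrySymm M := fun i j => ((memL_iff hp).1 hM i j).2

theorem EntryAESM.add {M N : TransferMatrix m n} (hM : EntryAESM M) (hN : EntryAESM N) :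
    EntryAESM fun θ => M θ + N θ := fun i j => (hM i j).add (hN i j)

theorem EntryAESM.sub {M N : TransferMatrix m n} (hM : EntryAESM M) (hN : EntryAESM N) :
    EntryAESM fun θ => M θ - N θ := fun i j => (hM i j).sub (hN i j)

theorem EntryAESM.const (M : Matrix m n ℂ) : EntryAESM fun _ => M :=
  fun _ _ => aestronglyMeasurable_const

theorem EntryAESM.mul [Fintype l] {M : TransferMatrix m l} {N : TransferMatrix l n}
    (hM : EntryAESM M) (hN : EntryAESM N) : EntryAESM fun θ => M θ * N θ := fun i j =>
  Finset.aestronglyMeasurable_fun_sum _ fun k _ => (hM i k).mul (hN k j)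

theorem EntryAESM.conjTranspose {M : TransferMatrix m n} (hM : EntryAESM M) :
    EntryAESM fun θ => (M θ)ᴴ := fun i j =>
  Complex.continuous_conj.comp_aestronglyMeasurable (hM j i)

theorem EntryAESM.trace [Fintype n] {M : TransferMatrix n n} (hM : EntryAESM M) :
    AEStronglyMeasurable (fun θ => (M θ).trace) circ :=
  Finset.aestronglyMeasurable_fun_sum _ fun i _ => hM i i

theorem EntryAESM.wform [Fintype m] [Fintype n] {X Y : TransferMatrix m n}
    {W : TransferMatrix n n} (hX : EntryAESM X) (hY : EntryAESM Y) (hW : EntryAESM W) :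
    AEStronglyMeasurable (fun θ => wform (X θ) (Y θ) (W θ)) circ :=
  ((hX.conjTranspose.mul hY).mul hW).trace

theorem EntryAESM.wquad [Fintype m] [Fintype n] {X : TransferMatrix m n}
    {W : TransferMatrix n n} (hX : EntryAESM X) (hW : EntryAESM W) :
    AEStronglyMeasurable (fun θ => wquad (X θ) (W θ)) circ :=
  Complex.continuous_re.comp_aestronglyMeasurable (hX.wform hX hW)

theorem EntryAESM.fro [Fintype m] [Fintype n] {X : TransferMatrix m n}
    (hX : EntryAESM X) : AEStronglyMeasurable (fun θ => fro (X θ)) circ := by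
  unfold MixedControl.fro
  exact Finset.aestronglyMeasurable_fun_sum _ fun i _ =>
    Finset.aestronglyMeasurable_fun_sum _ fun j _ => (hX i j).norm.pow 2

theorem EntrySymm.add {M N : TransferMatrix m n} (hM : EntrySymm M) (hN : EntrySymm N) :
    EntrySymm fun θ => M θ + N θ := fun i j => (hM i j).add (hN i j)

theorem EntrySymm.mul [Fintype l] {M : TransferMatrix m l} {N : TransferMatrix l n}
    (hM : EntrySymm M) (hN : EntrySymm N) : EntrySymm fun θ => M θ * N θ := fun i j =>
  ConjSymm.sum fun k _ => (hM i k).mul (hN k j)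

theorem EntrySymm.conjTranspose {M : TransferMatrix m n} (hM : EntrySymm M) :
    EntrySymm fun θ => (M θ)ᴴ := fun i j => (hM j i).conj

theorem EntrySymm.trace [Fintype n] {M : TransferMatrix n n} (hM : EntrySymm M) :
    ConjSymm fun θ => (M θ).trace := ConjSymm.sum fun i _ => hM i i

theorem EntrySymm.const_one [DecidableEq n] :
    EntrySymm (fun _ : UnitAddCircle => (1 : Matrix n n ℂ)) := fun i j => by
  have := ConjSymm.ofReal ((1 : Matrix n n ℝ) i j)
  convert this using 2
  by_cases h : i = j
  · subst h; simp
  · simp [h]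

theorem EntrySymm.wform [Fintype m] [Fintype n] {X Y : TransferMatrix m n}
    {W : TransferMatrix n n} (hX : EntrySymm X) (hY : EntrySymm Y) (hW : EntrySymm W) :
    ConjSymm fun θ => wform (X θ) (Y θ) (W θ) :=
  ((hX.conjTranspose.mul hY).mul hW).trace

end entries

/-! ### Convergence in `L₂` and weighted costs -/

section costs
variable {m n l : Type} [Fintype m] [Fintype n] [Fintype l]

theorem h2sq_eq_lintegral_fro (M : TransferMatrix m n) :
    h2sq M = ∫⁻ θ, ENNReal.ofReal (fro (M θ)) ∂circ := by
  simp only [h2sq, trace_conjTranspose_mul_self_re]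

theorem h2sq_eq_sum {M : TransferMatrix m n} (hM : EntryAESM M) :
    h2sq M = ∑ i, ∑ j, eLpNorm (fun θ => M θ i j) 2 circ ^ 2 := by
  have h : ∀ i j, eLpNorm (fun θ => M θ i j) 2 circ ^ 2 = ∫⁻ θ, ‖M θ i j‖ₑ ^ 2 ∂circ := by
    intro i j
    have := eLpNorm_nnreal_pow_eq_lintegral (μ := circ) (f := fun θ => M θ i j) (p := 2)
      two_ne_zero
    simpa using this
  simp only [h]
  rw [h2sq_eq_lintegral_fro]
  have hm : ∀ i j, AEMeasurable (fun θ => ‖M θ i j‖ₑ ^ 2) circ := fun i j =>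
    (hM i j).enorm.pow_const 2
  have h2 : ∀ i, AEMeasurable (fun θ => ∑ j, ‖M θ i j‖ₑ ^ 2) circ := fun i =>
    Finset.aemeasurable_fun_sum _ fun j _ => hm i j
  simp only [← lintegral_finsetSum' _ fun j _ => hm _ j,
    ← lintegral_finsetSum' _ fun i _ => h2 i]
  refine lintegral_congr fun θ => ?_
  rw [fro, ENNReal.ofReal_sum_of_nonneg fun _ _ => by positivity]
  refine Finset.sum_congr rfl fun i _ => ?_
  rw [ENNReal.ofReal_sum_of_nonneg fun _ _ => by positivity]
  refine Finset.sum_congr rfl fun j _ => ?_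
  rw [ENNReal.ofReal_pow (norm_nonneg _), ofReal_norm]

theorem wtrace_eq (M : TransferMatrix m n) (W : TransferMatrix n n) :
    wtrace M W = ∫⁻ θ, ENNReal.ofReal (wquad (M θ) (W θ)) ∂circ := rfl

theorem wtrace_congr_ae {M M' : TransferMatrix m n} (h : M =ᵐ[circ] M') (W : TransferMatrix n n) :
    wtrace M W = wtrace M' W := by
  refine lintegral_congr_ae ?_
  filter_upwards [h] with θ hθ
  rw [hθ]

theorem h2sq_congr_ae {M M' : TransferMatrix m n} (h : M =ᵐ[circ] M') : h2sq M = h2sq M' := by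
  refine lintegral_congr_ae ?_
  filter_upwards [h] with θ hθ
  rw [hθ]

theorem h2sq_sub_comm (M N : TransferMatrix m n) :
    h2sq (fun θ => M θ - N θ) = h2sq fun θ => N θ - M θ := by
  simp only [h2sq_eq_lintegral_fro, fro, Matrix.sub_apply, norm_sub_rev]

theorem h2sq_add_le {M N : TransferMatrix m n} (hM : EntryAESM M) :
    h2sq (fun θ => M θ + N θ) ≤ 2 * h2sq M + 2 * h2sq N := by
  simp only [h2sq_eq_lintegral_fro]
  rw [← lintegral_const_mul' _ _ (by simp), ← lintegral_const_mul' _ _ (by simp),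
    ← lintegral_add_left' ((hM.fro.aemeasurable.ennreal_ofReal).const_mul _)]
  refine lintegral_mono fun θ => ?_
  refine (ENNReal.ofReal_le_ofReal (fro_add_le _ _)).trans ?_
  rw [ENNReal.ofReal_add (by have := fro_nonneg (M θ); positivity)
    (by have := fro_nonneg (N θ); positivity), ENNReal.ofReal_mul zero_le_two,
    ENNReal.ofReal_mul zero_le_two]
  simp

theorem h2sq_le_wtrace [DecidableEq n] (M : TransferMatrix m n) {W : TransferMatrix n n}
    (hW : ∀ᵐ θ ∂circ, (W θ - 1).PosSemidef) : h2sq M ≤ wtrace M W := by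
  rw [h2sq_eq_lintegral_fro]
  refine lintegral_mono_ae ?_
  filter_upwards [hW] with θ hθ
  exact ENNReal.ofReal_le_ofReal (fro_le_wquad hθ _)

/-- The parallelogram identity for weighted costs. -/
theorem wtrace_parallelogram {X Y : TransferMatrix m n} {W : TransferMatrix n n}
    (hX : EntryAESM X) (hY : EntryAESM Y) (hWm : EntryAESM W)
    (hW : ∀ᵐ θ ∂circ, (W θ).PosSemidef) :
    wtrace (fun θ => (1 / 2 : ℝ) • (X θ + Y θ)) W + ENNReal.ofReal (1 / 4)
      * wtrace (fun θ => X θ - Y θ) W =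
    ENNReal.ofReal (1 / 2) * wtrace X W + ENNReal.ofReal (1 / 2) * wtrace Y W := by
  simp only [wtrace_eq]
  have m1 : AEMeasurable (fun θ => ENNReal.ofReal (wquad (X θ - Y θ) (W θ))) circ :=
    ((hX.sub hY).wquad hWm).aemeasurable.ennreal_ofReal
  have m2 : AEMeasurable (fun θ => ENNReal.ofReal (wquad (Y θ) (W θ))) circ :=
    (hY.wquad hWm).aemeasurable.ennreal_ofReal
  rw [← lintegral_const_mul'' _ m1, ← lintegral_const_mul' _ _ ENNReal.ofReal_ne_top,
    ← lintegral_const_mul' _ _ ENNReal.ofReal_ne_top, ← lintegral_add_right' _ (m1.const_mul _),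
    ← lintegral_add_right' _ (m2.const_mul _)]
  refine lintegral_congr_ae ?_
  filter_upwards [hW] with θ hθ
  have n1 := fun M : Matrix m n ℂ => wquad_nonneg hθ M
  rw [← ENNReal.ofReal_mul (by norm_num), ← ENNReal.ofReal_mul (by norm_num),
    ← ENNReal.ofReal_mul (by norm_num),
    ← ENNReal.ofReal_add (n1 _) (mul_nonneg (by norm_num) (n1 _)),
    ← ENNReal.ofReal_add (mul_nonneg (by norm_num) (n1 _)) (mul_nonneg (by norm_num) (n1 _)),
    wquad_parallelogram]

theorem fro_tendsto_zero_iff {M : ℕ → Matrix m n ℂ} :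
    Tendsto (fun k => fro (M k)) atTop (𝓝 0) ↔ ∀ i j, Tendsto (fun k => M k i j) atTop (𝓝 0) := by
  constructor
  · intro h i j
    rw [tendsto_zero_iff_norm_tendsto_zero]
    have h1 : Tendsto (fun k => ‖M k i j‖ ^ 2) atTop (𝓝 0) :=
      squeeze_zero (fun _ => by positivity) (fun k => norm_sq_le_fro _ i j) h
    have h2 := (Real.continuous_sqrt.tendsto 0).comp h1
    simpa [Function.comp_def, Real.sqrt_sq (norm_nonneg _)] using h2
  · intro h
    have : Tendsto (fun k => ∑ i, ∑ j, ‖M k i j‖ ^ 2) atTop (𝓝 (∑ _i : m, ∑ _j : n, 0)) :=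
      tendsto_finsetSum _ fun i _ => tendsto_finsetSum _ fun j _ => by
        simpa using ((h i j).norm.pow 2)
    simpa [fro] using this

/-- A sequence that converges in `L₂` has an almost everywhere convergent subsequence. -/
theorem exists_subseq_tendsto_ae {T : ℕ → TransferMatrix m n} {T' : TransferMatrix m n}
    (hT : ∀ k, EntryAESM (T k)) (hT' : EntryAESM T')
    (h : Tendsto (fun k => h2sq fun θ => T k θ - T' θ) atTop (𝓝 0)) :
    ∃ φ : ℕ → ℕ, StrictMono φ ∧ ∀ᵐ θ ∂circ, ∀ i j,
      Tendsto (fun k => T (φ k) θ i j) atTop (𝓝 (T' θ i j)) := by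
  have hm : ∀ k, AEStronglyMeasurable (fun θ => fro (T k θ - T' θ)) circ := fun k =>
    ((hT k).sub hT').fro
  have h1 : TendstoInMeasure circ (fun k θ => fro (T k θ - T' θ)) atTop fun _ => 0 := by
    refine tendstoInMeasure_of_tendsto_eLpNorm one_ne_zero hm aestronglyMeasurable_const ?_
    simp only [h2sq_eq_lintegral_fro] at h
    refine h.congr fun k => ?_
    rw [eLpNorm_one_eq_lintegral_enorm]
    refine lintegral_congr fun θ => ?_
    simp only [Pi.sub_apply, sub_zero]
    rw [← ofReal_norm, Real.norm_of_nonneg (fro_nonneg _)]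
  obtain ⟨φ, hφ, hlim⟩ := h1.exists_seq_tendsto_ae
  refine ⟨φ, hφ, ?_⟩
  filter_upwards [hlim] with θ hθ i j
  have := (fro_tendsto_zero_iff.1 hθ i j)
  simp only [Matrix.sub_apply] at this
  simpa using this.add_const (T' θ i j)

/-- Completeness of `L₂`, for matrix valued functions. -/
theorem exists_h2sq_limit {T : ℕ → TransferMatrix m n}
    (hT : ∀ k i j, MemLp (fun θ => T k θ i j) 2 circ)
    (h : ∀ ε > 0, ∃ N, ∀ k ≥ N, ∀ k' ≥ N, h2sq (fun θ => T k θ - T k' θ) ≤ ENNReal.ofReal ε) :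
    ∃ T' : TransferMatrix m n, (∀ i j, MemLp (fun θ => T' θ i j) 2 circ) ∧
      Tendsto (fun k => h2sq fun θ => T k θ - T' θ) atTop (𝓝 0) := by
  have hcau : ∀ i j, CauchySeq fun k => (hT k i j).toLp := by
    intro i j
    rw [Metric.cauchySeq_iff]
    intro ε hε
    obtain ⟨N, hN⟩ := h ((ε / 2) ^ 2) (by positivity)
    refine ⟨N, fun k hk k' hk' => ?_⟩
    have hm : EntryAESM fun θ => T k θ - T k' θ := fun i j => ((hT k i j).sub (hT k' i j)).1
    have h1 : eLpNorm (fun θ => T k θ i j - T k' θ i j) 2 circ ^ 2 ≤ ENNReal.ofReal (ε / 2) ^ 2 := by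
      rw [← ENNReal.ofReal_pow (by positivity)]
      refine le_trans ?_ (hN k hk k' hk')
      rw [h2sq_eq_sum hm]
      exact (Finset.single_le_sum (f := fun j => eLpNorm (fun θ => (T k θ - T k' θ) i j) 2 circ ^ 2)
        (fun _ _ => zero_le) (Finset.mem_univ j)).trans (Finset.single_le_sum
        (f := fun i => ∑ j, eLpNorm (fun θ => (T k θ - T k' θ) i j) 2 circ ^ 2)
        (fun _ _ => zero_le) (Finset.mem_univ i))
    have h2 : eLpNorm (fun θ => T k θ i j - T k' θ i j) 2 circ ≤ ENNReal.ofReal (ε / 2) :=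
      (ENNReal.pow_le_pow_left_iff two_ne_zero).1 h1
    rw [dist_eq_norm, ← MemLp.toLp_sub, Lp.norm_toLp]
    calc (eLpNorm ((fun θ => T k θ i j) - fun θ => T k' θ i j) 2 circ).toReal
        ≤ (ENNReal.ofReal (ε / 2)).toReal := ENNReal.toReal_mono ENNReal.ofReal_ne_top h2
      _ = ε / 2 := ENNReal.toReal_ofReal (by positivity)
      _ < ε := by linarith
  choose g hg using fun i j => cauchySeq_tendsto_of_complete (hcau i j)
  refine ⟨fun θ => Matrix.of fun i j => g i j θ, fun i j => Lp.memLp (g i j), ?_⟩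
  have hm : ∀ k, EntryAESM fun θ => T k θ - Matrix.of fun i j => g i j θ := fun k i j =>
    ((hT k i j).sub (Lp.memLp (g i j))).1
  simp only [h2sq_eq_sum (hm _)]
  have h0 : (0 : ℝ≥0∞) = ∑ _i : m, ∑ _j : n, (0 : ℝ≥0∞) ^ 2 := by simp
  rw [h0]
  refine tendsto_finsetSum _ fun i _ => tendsto_finsetSum _ fun j _ => ENNReal.Tendsto.pow ?_
  have h1 := Lp.tendsto_Lp_iff_tendsto_eLpNorm' _ (g i j) |>.1 (hg i j)
  refine h1.congr fun k => ?_
  refine eLpNorm_congr_ae ?_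
  filter_upwards [(hT k i j).coeFn_toLp] with θ hθ
  simp [hθ]

theorem tendsto_wquad {M : ℕ → Matrix m n ℂ} {M' : Matrix m n ℂ} {W : ℕ → Matrix n n ℂ}
    {W' : Matrix n n ℂ} (hM : ∀ i j, Tendsto (fun k => M k i j) atTop (𝓝 (M' i j)))
    (hW : ∀ i j, Tendsto (fun k => W k i j) atTop (𝓝 (W' i j))) :
    Tendsto (fun k => wquad (M k) (W k)) atTop (𝓝 (wquad M' W')) := by
  refine (Complex.continuous_re.tendsto _).comp ?_
  exact tendsto_finsetSum _ fun j _ => tendsto_finsetSum _ fun l _ =>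
    (tendsto_finsetSum _ fun i _ =>
      ((Complex.continuous_conj.tendsto _).comp (hM i j)).mul (hM i l)).mul (hW l j)

/-- Weighted costs are lower semicontinuous, by Fatou's lemma. -/
theorem wtrace_le_of_tendsto {T : ℕ → TransferMatrix m n} {T' : TransferMatrix m n}
    (hT : ∀ k, EntryAESM (T k)) (hT' : EntryAESM T') {W : TransferMatrix n n} (hW : EntryAESM W)
    (h : Tendsto (fun k => h2sq fun θ => T k θ - T' θ) atTop (𝓝 0)) {c : ℕ → ℝ≥0∞} {c' : ℝ≥0∞}
    (hc : Tendsto c atTop (𝓝 c')) (hTc : ∀ k, wtrace (T k) W ≤ c k) : wtrace T' W ≤ c' := by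
  obtain ⟨φ, hφ, hlim⟩ := exists_subseq_tendsto_ae hT hT' h
  calc
    wtrace T' W ≤ ∫⁻ θ, liminf (fun k => ENNReal.ofReal (wquad (T (φ k) θ) (W θ))) atTop ∂circ := by
        refine lintegral_mono_ae ?_
        filter_upwards [hlim] with θ hθ
        have h2 := tendsto_wquad hθ (fun i j => tendsto_const_nhds (x := W θ i j))
        exact ((ENNReal.continuous_ofReal.tendsto _).comp h2).liminf_eq.ge
    _ ≤ liminf (fun k => wtrace (T (φ k)) W) atTop :=
        lintegral_liminf_le' fun k => ((hT _).wquad hW).aemeasurable.ennreal_ofReal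
    _ ≤ liminf (fun k => c (φ k)) atTop := liminf_le_liminf (Eventually.of_forall fun k => hTc _)
    _ = c' := (hc.comp hφ.tendsto_atTop).liminf_eq

/-- Minimization of a weighted cost over a closed convex set of square integrable functions. The
minimizer satisfies a quadratic growth condition. -/
theorem exists_wtrace_minimizer [DecidableEq n] {C : Set (TransferMatrix m n)}
    {W : TransferMatrix n n} (hWm : EntryAESM W) (hW : ∀ᵐ θ ∂circ, (W θ - 1).PosSemidef)
    (hL2 : ∀ T ∈ C, ∀ i j, MemLp (fun θ => T θ i j) 2 circ)
    (hmid : ∀ T ∈ C, ∀ T' ∈ C, (fun θ => (1 / 2 : ℝ) • (T θ + T' θ)) ∈ C)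
    (hclosed : ∀ (T : ℕ → TransferMatrix m n) (T' : TransferMatrix m n), (∀ k, T k ∈ C) →
      (∀ i j, MemLp (fun θ => T' θ i j) 2 circ) →
      Tendsto (fun k => h2sq fun θ => T k θ - T' θ) atTop (𝓝 0) → T' ∈ C)
    (hne : ∃ T ∈ C, wtrace T W < ∞) :
    ∃ T ∈ C, wtrace T W < ∞ ∧
      ∀ T' ∈ C, wtrace T W + ENNReal.ofReal (1 / 2) * h2sq (fun θ => T' θ - T θ) ≤ wtrace T' W := by
  have hW' : ∀ᵐ θ ∂circ, (W θ).PosSemidef := hW.mono fun θ => posSemidef_of_sub_one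
  have hm : ∀ T ∈ C, EntryAESM T := fun T hT i j => (hL2 T hT i j).1
  set ι : ℝ≥0∞ := ⨅ T ∈ C, wtrace T W with hι
  have hιle : ∀ T ∈ C, ι ≤ wtrace T W := fun T hT => iInf₂_le T hT
  obtain ⟨T₀, hT₀, hT₀fin⟩ := hne
  have hιtop : ι ≠ ∞ := ((hιle T₀ hT₀).trans_lt hT₀fin).ne
  have hseq : ∀ k : ℕ, ∃ T ∈ C, wtrace T W ≤ ι + ENNReal.ofReal (1 / (k + 1)) := by
    intro k
    have hpos : (0 : ℝ) < 1 / (k + 1) := by positivity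
    have h1 : ι < ι + ENNReal.ofReal (1 / (k + 1)) :=
      ENNReal.lt_add_right hιtop (ENNReal.ofReal_pos.2 hpos).ne'
    obtain ⟨T, hT⟩ := iInf_lt_iff.1 h1
    obtain ⟨hTC, hT⟩ := iInf_lt_iff.1 hT
    exact ⟨T, hTC, hT.le⟩
  choose T hTC hTι using hseq
  have hhalf : ENNReal.ofReal (1 / 2) + ENNReal.ofReal (1 / 2) = 1 := by
    rw [← ENNReal.ofReal_add (by norm_num) (by norm_num)]; norm_num
  have hlim0 : Tendsto (fun k : ℕ => (1 : ℝ) / (k + 1)) atTop (𝓝 0) :=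
    tendsto_one_div_add_atTop_nhds_zero_nat
  obtain ⟨T', hT'L2, hT'⟩ := exists_h2sq_limit (fun k => hL2 _ (hTC k)) (by
    intro ε hε
    obtain ⟨N, hN⟩ := eventually_atTop.1 (hlim0.eventually_lt_const (by positivity : 0 < ε / 4))
    refine ⟨N, fun k hk k' hk' => ?_⟩
    have hp := wtrace_parallelogram (hm _ (hTC k)) (hm _ (hTC k')) hWm hW'
    have h1 := hιle _ (hmid _ (hTC k) _ (hTC k'))
    have h2 : ι + ENNReal.ofReal (1 / 4) * wtrace (fun θ => T k θ - T k' θ) W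
        ≤ ι + ENNReal.ofReal (ε / 4) := by
      calc ι + ENNReal.ofReal (1 / 4) * wtrace (fun θ => T k θ - T k' θ) W
          ≤ _ := add_le_add_left h1 _
        _ = _ := hp
        _ ≤ ENNReal.ofReal (1 / 2) * (ι + ENNReal.ofReal (ε / 4))
            + ENNReal.ofReal (1 / 2) * (ι + ENNReal.ofReal (ε / 4)) := by
          gcongr
          · exact (hTι k).trans (add_le_add_right (ENNReal.ofReal_le_ofReal (hN k hk).le) _)
          · exact (hTι k').trans (add_le_add_right (ENNReal.ofReal_le_ofReal (hN k' hk').le) _)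
        _ = ι + ENNReal.ofReal (ε / 4) := by rw [← add_mul, hhalf, one_mul]
    have h3 := (ENNReal.add_le_add_iff_left hιtop).1 h2
    have h4 : ENNReal.ofReal (1 / 4) * h2sq (fun θ => T k θ - T k' θ) ≤ ENNReal.ofReal (1 / 4)
        * ENNReal.ofReal ε := by
      rw [← ENNReal.ofReal_mul (by norm_num), one_div_mul_eq_div]
      exact (mul_le_mul_right (h2sq_le_wtrace _ hW) _).trans h3
    exact (ENNReal.mul_le_mul_iff_right (by simp) ENNReal.ofReal_ne_top).1 h4)
  have hT'C := hclosed T T' hTC hT'L2 hT'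
  have hT'ι : wtrace T' W ≤ ι := by
    refine wtrace_le_of_tendsto (fun k => hm _ (hTC k)) (hm _ hT'C) hWm hT' ?_ hTι
    have := (ENNReal.continuous_ofReal.tendsto 0).comp hlim0
    simpa using this.const_add ι
  refine ⟨T', hT'C, hT'ι.trans_lt hιtop.lt_top, fun T'' hT'' => ?_⟩
  have hp := wtrace_parallelogram (hm _ hT'') (hm _ hT'C) hWm hW'
  have h1 := hT'ι.trans (hιle _ (hmid _ hT'' _ hT'C))
  have hfin : wtrace T' W ≠ ∞ := (hT'ι.trans_lt hιtop.lt_top).ne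
  have hquart : ENNReal.ofReal (1 / 4) = ENNReal.ofReal (1 / 2) * ENNReal.ofReal (1 / 2) := by
    rw [← ENNReal.ofReal_mul (by norm_num)]; norm_num
  have h2 : ENNReal.ofReal (1 / 2) * wtrace T' W + ENNReal.ofReal (1 / 2) * (wtrace T' W +
      ENNReal.ofReal (1 / 2) * h2sq (fun θ => T'' θ - T' θ)) ≤
      ENNReal.ofReal (1 / 2) * wtrace T' W + ENNReal.ofReal (1 / 2) * wtrace T'' W := by
    calc _ = wtrace T' W + ENNReal.ofReal (1 / 4) * h2sq (fun θ => T'' θ - T' θ) := by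
          rw [mul_add, ← add_assoc, ← add_mul, hhalf, one_mul, hquart, mul_assoc]
      _ ≤ wtrace (fun θ => (1 / 2 : ℝ) • (T'' θ + T' θ)) W
          + ENNReal.ofReal (1 / 4) * wtrace (fun θ => T'' θ - T' θ) W :=
          add_le_add h1 (mul_le_mul_right (h2sq_le_wtrace _ hW) _)
      _ = _ := by rw [hp, add_comm]
  have h3 := (ENNReal.add_le_add_iff_left (ENNReal.mul_ne_top ENNReal.ofReal_ne_top hfin)).1 h2
  exact (ENNReal.mul_le_mul_iff_right (by simp) ENNReal.ofReal_ne_top).1 h3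

theorem integrable_wquad {M : TransferMatrix m n} {W : TransferMatrix n n} (hM : EntryAESM M)
    (hWm : EntryAESM W) (hW : ∀ᵐ θ ∂circ, (W θ).PosSemidef) (h : wtrace M W < ∞) :
    Integrable (fun θ => wquad (M θ) (W θ)) circ :=
  ⟨hM.wquad hWm, (hasFiniteIntegral_iff_ofReal (hW.mono fun _ hθ => wquad_nonneg hθ _)).2 h⟩

theorem wtrace_eq_ofReal {M : TransferMatrix m n} {W : TransferMatrix n n}
    (hW : ∀ᵐ θ ∂circ, (W θ).PosSemidef) (h : Integrable (fun θ => wquad (M θ) (W θ)) circ) :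
    wtrace M W = ENNReal.ofReal (∫ θ, wquad (M θ) (W θ) ∂circ) :=
  (ofReal_integral_eq_lintegral_ofReal h (hW.mono fun _ hθ => wquad_nonneg hθ _)).symm

theorem integrable_wform {X Y : TransferMatrix m n} {W : TransferMatrix n n} (hX : EntryAESM X)
    (hY : EntryAESM Y) (hWm : EntryAESM W) (hW : ∀ᵐ θ ∂circ, (W θ).PosSemidef)
    (hXW : wtrace X W < ∞) (hYW : wtrace Y W < ∞) :
    Integrable (fun θ => wform (X θ) (Y θ) (W θ)) circ := by
  refine ((integrable_wquad hX hWm hW hXW).add (integrable_wquad hY hWm hW hYW)).mono'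
    (hX.wform hY hWm) ?_
  filter_upwards [hW] with θ hθ
  exact norm_wform_le hθ _ _

/-- The first order optimality condition for a minimizer of a weighted cost, in a direction `D`. -/
theorem integral_wform_eq_zero {T D : TransferMatrix m n} {W : TransferMatrix n n}
    (hT : EntryAESM T) (hD : EntryAESM D) (hWm : EntryAESM W)
    (hW : ∀ᵐ θ ∂circ, (W θ).PosSemidef) (hTs : EntrySymm T) (hDs : EntrySymm D)
    (hWs : EntrySymm W) (hTW : wtrace T W < ∞) (hDW : wtrace D W < ∞)
    (hmin : ∀ t : ℝ, wtrace T W ≤ wtrace (fun θ => T θ + t • D θ) W) :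
    ∫ θ, wform (D θ) (T θ) (W θ) ∂circ = 0 := by
  have hi := integrable_wform hD hT hWm hW hDW hTW
  have hqT := integrable_wquad hT hWm hW hTW
  have hqD := integrable_wquad hD hWm hW hDW
  have him : (∫ θ, wform (D θ) (T θ) (W θ) ∂circ).im = 0 := by
    have := (conjSymm_iff hi).1 (hDs.wform hTs hWs) 0
    rw [zcoeff_eq] at this
    simpa using this
  set b := ∫ θ, wform (D θ) (T θ) (W θ) ∂circ with hb
  have hre : ∫ θ, (wform (D θ) (T θ) (W θ)).re ∂circ = b.re := integral_re hi
  set q := ∫ θ, wquad (D θ) (W θ) ∂circ with hq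
  have hq0 : 0 ≤ q := integral_nonneg_of_ae (hW.mono fun _ hθ => wquad_nonneg hθ _)
  have key : ∀ t : ℝ, 0 ≤ 2 * t * b.re + t ^ 2 * q := by
    intro t
    have e : (fun θ => wquad (T θ + t • D θ) (W θ)) =ᵐ[circ] fun θ => (wquad (T θ) (W θ)
        + 2 * t * (wform (D θ) (T θ) (W θ)).re) + t ^ 2 * wquad (D θ) (W θ) := by
      filter_upwards [hW] with θ hθ
      exact wquad_add_smul hθ.1 _ _ _
    have i1 : Integrable (fun θ => 2 * t * (wform (D θ) (T θ) (W θ)).re) circ :=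
      hi.re.const_mul _
    have i2 : Integrable (fun θ => t ^ 2 * wquad (D θ) (W θ)) circ := hqD.const_mul _
    have i3 : Integrable (fun θ => wquad (T θ) (W θ)
        + 2 * t * (wform (D θ) (T θ) (W θ)).re) circ := hqT.add i1
    have i4 : Integrable (fun θ => wquad (T θ + t • D θ) (W θ)) circ := (i3.add i2).congr e.symm
    have h1 := hmin t
    have hnn : 0 ≤ ∫ θ, wquad (T θ + t • D θ) (W θ) ∂circ :=
      integral_nonneg_of_ae (hW.mono fun _ hθ => wquad_nonneg hθ _)
    rw [wtrace_eq_ofReal hW hqT, wtrace_eq_ofReal (M := fun θ => T θ + t • D θ) hW i4,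
      ENNReal.ofReal_le_ofReal_iff hnn, integral_congr_ae e, integral_add i3 i2,
      integral_add hqT i1, integral_const_mul, integral_const_mul, hre] at h1
    linarith
  have hbre : b.re = 0 := by
    by_contra hne
    -- the quadratic polynomial is negative at `t = - b / (q + 1)`
    have h1 := key (-b.re / (q + 1))
    have hq1 : 0 < q + 1 := by linarith
    have h2 : 2 * (-b.re / (q + 1)) * b.re + (-b.re / (q + 1)) ^ 2 * q
        = -(b.re ^ 2 * (q + 2)) / (q + 1) ^ 2 := by
      field_simp
      ring
    rw [h2] at h1
    have h3 : 0 < b.re ^ 2 * (q + 2) := by positivity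
    have h4 : -(b.re ^ 2 * (q + 2)) / (q + 1) ^ 2 < 0 :=
      div_neg_of_neg_of_pos (by linarith) (by positivity)
    linarith
  exact Complex.ext hbre him

end costs

/-! ### Minimization of a weighted cost over closed loops -/

section bounded
variable {m n l : Type} [Fintype m] [Fintype n] [Fintype l]

theorem memLp_top_iff_bounded {f : UnitAddCircle → ℂ} (hf : AEStronglyMeasurable f circ) :
    MemLp f ∞ circ ↔ ∃ C : ℝ, ∀ᵐ θ ∂circ, ‖f θ‖ ≤ C := by
  constructor
  · intro h
    refine ⟨(eLpNormEssSup f circ).toReal, ?_⟩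
    have h1 : eLpNormEssSup f circ ≠ ∞ := by simpa using h.2.ne
    filter_upwards [enorm_ae_le_eLpNormEssSup f circ] with θ hθ
    have := ENNReal.toReal_mono h1 hθ
    simpa using this
  · rintro ⟨C, hC⟩
    exact MemLp.of_bound hf C hC

theorem MemH.exists_fro_le {M : TransferMatrix m n} (hM : MemH ∞ M) :
    ∃ C : ℝ, 0 ≤ C ∧ ∀ᵐ θ ∂circ, fro (M θ) ≤ C := by
  choose c hc using fun i j => (memLp_top_iff_bounded (hM.memLp i j).1).1 (hM.memLp i j)
  refine ⟨∑ i, ∑ j, c i j ^ 2, by positivity, ?_⟩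
  filter_upwards [ae_all_iff.2 fun i => ae_all_iff.2 (hc i)] with θ hθ
  exact Finset.sum_le_sum fun i _ => Finset.sum_le_sum fun j _ =>
    pow_le_pow_left₀ (norm_nonneg _) (hθ i j) 2

theorem MemH.top_of_fro_le {M : TransferMatrix m n} (hM : MemH 2 M) {C : ℝ}
    (hC : ∀ᵐ θ ∂circ, fro (M θ) ≤ C) : MemH ∞ M := by
  refine (memH_iff le_top).2 fun i j => ?_
  have h := (memH_iff one_le_two).1 hM i j
  refine ⟨(memLp_top_iff_bounded h.memLp.1).2 ⟨Real.sqrt C, ?_⟩, h.symm, h.causal⟩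
  filter_upwards [hC] with θ hθ
  exact Real.le_sqrt_of_sq_le ((norm_sq_le_fro _ i j).trans hθ)

theorem wtrace_mul_lt_top {A : TransferMatrix l m} {M : TransferMatrix m n}
    {W : TransferMatrix n n} (hW : ∀ᵐ θ ∂circ, (W θ).PosSemidef) {C : ℝ} (hC0 : 0 ≤ C)
    (hC : ∀ᵐ θ ∂circ, fro (A θ) ≤ C) (hM : wtrace M W < ∞) :
    wtrace (fun θ => A θ * M θ) W < ∞ := by
  refine lt_of_le_of_lt (b := ENNReal.ofReal C * wtrace M W) ?_
    (ENNReal.mul_lt_top ENNReal.ofReal_lt_top hM)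
  rw [wtrace_eq, wtrace_eq, ← lintegral_const_mul' _ _ ENNReal.ofReal_ne_top]
  refine lintegral_mono_ae ?_
  filter_upwards [hW, hC] with θ h1 h2
  rw [← ENNReal.ofReal_mul hC0]
  exact ENNReal.ofReal_le_ofReal ((wquad_mul_le h1 _ _).trans
    (mul_le_mul_of_nonneg_right h2 (wquad_nonneg h1 _)))

theorem wtrace_lt_top_of_fro_le {M : TransferMatrix m n} {W : TransferMatrix n n}
    (hW : ∀ᵐ θ ∂circ, (W θ).PosSemidef) (hWi : ∀ i j, Integrable (fun θ => W θ i j) circ) {C : ℝ}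
    (hC : ∀ᵐ θ ∂circ, fro (M θ) ≤ C) : wtrace M W < ∞ := by
  have htr : Integrable (fun θ => C * (W θ).trace.re) circ :=
    (Integrable.re (integrable_finsetSum _ fun i _ => hWi i i)).const_mul C
  refine lt_of_le_of_lt ?_ (lt_top_iff_ne_top.2 htr.lintegral_lt_top.ne)
  rw [wtrace_eq]
  refine lintegral_mono_ae ?_
  filter_upwards [hW, hC] with θ h1 h2
  exact ENNReal.ofReal_le_ofReal ((wquad_le_fro_mul h1 _).trans
    (mul_le_mul_of_nonneg_right h2 (trace_re_nonneg h1)))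

end bounded

section weights
variable {n : ℕ} {L : TransferMatrix (Fin n) (Fin n)}

theorem weight_sub_one_posSemidef (hL : L ∈ multipliers n) :
    ∀ᵐ θ ∂circ, ((1 + L θ) - 1).PosSemidef := by
  filter_upwards [hL.2] with θ hθ
  rwa [add_sub_cancel_left]

theorem weight_posSemidef (hL : L ∈ multipliers n) : ∀ᵐ θ ∂circ, (1 + L θ).PosSemidef :=
  (weight_sub_one_posSemidef hL).mono fun _ => posSemidef_of_sub_one

theorem weight_entryAESM (hL : L ∈ multipliers n) : EntryAESM fun θ => 1 + L θ :=
  (EntryAESM.const 1).add hL.1.entryAESM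

theorem weight_entrySymm (hL : L ∈ multipliers n) : EntrySymm fun θ => 1 + L θ :=
  EntrySymm.const_one.add (hL.1.entrySymm le_rfl)

theorem weight_integrable (hL : L ∈ multipliers n) (i j : Fin n) :
    Integrable (fun θ => (1 + L θ) i j) circ :=
  (integrable_const _).add ((hL.1.memLp i j).integrable le_rfl)

end weights

section loops
variable {dx du dw : ℕ} {S : System dx du dw}

theorem loops_midpoint {T T' : TransferMatrix (Fin dx ⊕ Fin du) (Fin dw)} (hT : T ∈ loops S)
    (hT' : T' ∈ loops S) : (fun θ => (1 / 2 : ℝ) • (T θ + T' θ)) ∈ loops S := by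
  have h := add_smul_sub_mem_loops hT hT' (g := fun _ => ((1 / 2 : ℝ) : ℂ)) (HardyFn.ofReal _)
  convert h using 2 with θ
  ext i j
  simp
  ring

theorem eLpNorm_entry_tendsto {m n : Type} [Fintype m] [Fintype n] {T : ℕ → TransferMatrix m n}
    {T' : TransferMatrix m n} (hT : ∀ k, EntryAESM (T k)) (hT' : EntryAESM T')
    (h : Tendsto (fun k => h2sq fun θ => T k θ - T' θ) atTop (𝓝 0)) (i : m) (j : n) :
    Tendsto (fun k => eLpNorm (fun θ => T k θ i j - T' θ i j) 2 circ) atTop (𝓝 0) := by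
  have h1 : Tendsto (fun k => eLpNorm (fun θ => T k θ i j - T' θ i j) 2 circ ^ 2) atTop (𝓝 0) := by
    refine tendsto_of_tendsto_of_tendsto_of_le_of_le tendsto_const_nhds h (fun _ => zero_le) ?_
    intro k
    dsimp only
    rw [h2sq_eq_sum ((hT k).sub hT')]
    exact (Finset.single_le_sum (f := fun j => eLpNorm (fun θ => (T k θ - T' θ) i j) 2 circ ^ 2)
      (fun _ _ => zero_le) (Finset.mem_univ j)).trans (Finset.single_le_sum
      (f := fun i => ∑ j, eLpNorm (fun θ => (T k θ - T' θ) i j) 2 circ ^ 2)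
      (fun _ _ => zero_le) (Finset.mem_univ i))
  have h2 := h1.ennrpow_const (1 / 2)
  rw [ENNReal.zero_rpow_of_pos (by norm_num)] at h2
  refine h2.congr fun k => ?_
  rw [← ENNReal.rpow_natCast, ← ENNReal.rpow_mul]
  norm_num

/-- The reflection symmetry is preserved by almost everywhere convergence. -/
theorem ConjSymm.of_tendsto {f : ℕ → UnitAddCircle → ℂ} {g : UnitAddCircle → ℂ}
    (hf : ∀ k, ConjSymm (f k)) (h : ∀ᵐ θ ∂circ, Tendsto (fun k => f k θ) atTop (𝓝 (g θ))) :
    ConjSymm g := by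
  have hq : Measure.QuasiMeasurePreserving (fun θ : UnitAddCircle => -θ) circ circ :=
    (Measure.measurePreserving_neg circ).quasiMeasurePreserving
  have hneg : ∀ᵐ θ ∂circ, Tendsto (fun k => f k (-θ)) atTop (𝓝 (g (-θ))) :=
    hq.ae (p := fun θ => Tendsto (fun k => f k θ) atTop (𝓝 (g θ))) h
  have hs : ∀ᵐ θ ∂circ, ∀ k, f k (-θ) = conj (f k θ) := ae_all_iff.2 hf
  unfold ConjSymm
  filter_upwards [h, hneg, hs] with θ h1 h2 h3
  refine tendsto_nhds_unique h2 ?_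
  simp only [h3]
  exact (Complex.continuous_conj.tendsto _).comp h1

theorem EntrySymm.of_tendsto {m n : Type} {T : ℕ → TransferMatrix m n} {T' : TransferMatrix m n}
    (hT : ∀ k, EntrySymm (T k))
    (h : ∀ᵐ θ ∂circ, ∀ i j, Tendsto (fun k => T k θ i j) atTop (𝓝 (T' θ i j))) :
    EntrySymm T' := fun i j =>
  ConjSymm.of_tendsto (f := fun k θ => T k θ i j) (fun k => hT k i j) (h.mono fun _ hθ => hθ i j)

theorem Causal.of_tendsto {f : ℕ → UnitAddCircle → ℂ} {g : UnitAddCircle → ℂ}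
    (hf : ∀ n, MemLp (f n) 2 circ) (hg : MemLp g 2 circ) (hc : ∀ n, Causal (f n))
    (h : Tendsto (fun n => eLpNorm (fun θ => f n θ - g θ) 2 circ) atTop (𝓝 0)) : Causal g := by
  intro k hk
  have h1 := tendsto_zcoeff hf hg h k
  have h2 : (fun n => zcoeff (f n) k) = fun _ => 0 := funext fun n => hc n k hk
  rw [h2] at h1
  exact tendsto_nhds_unique h1 tendsto_const_nhds

/-- Membership in `H_2` is preserved by convergence in `L₂`. -/
theorem MemH.of_tendsto {m n : Type} [Fintype m] [Fintype n] {T : ℕ → TransferMatrix m n}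
    {T' : TransferMatrix m n} (hT : ∀ k, MemH 2 (T k))
    (hT' : ∀ i j, MemLp (fun θ => T' θ i j) 2 circ)
    (h : Tendsto (fun k => h2sq fun θ => T k θ - T' θ) atTop (𝓝 0)) : MemH 2 T' := by
  have hm : ∀ k, EntryAESM (T k) := fun k => (hT k).entryAESM
  have hm' : EntryAESM T' := fun i j => (hT' i j).1
  obtain ⟨φ, hφ, hlim⟩ := exists_subseq_tendsto_ae hm hm' h
  have hsymm : EntrySymm T' :=
    EntrySymm.of_tendsto (fun k => (hT (φ k)).entrySymm one_le_two) hlim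
  have hcausal : ∀ i j, Causal fun θ => T' θ i j := fun i j =>
    Causal.of_tendsto (fun k => (hT k).memLp i j) (hT' i j)
      (fun k => ((memH_iff one_le_two).1 (hT k) i j).causal) (eLpNorm_entry_tendsto hm hm' h i j)
  exact (memH_iff one_le_two).2 fun i j => ⟨hT' i j, hsymm i j, hcausal i j⟩

theorem loops_closed {T : ℕ → TransferMatrix (Fin dx ⊕ Fin du) (Fin dw)}
    {T' : TransferMatrix (Fin dx ⊕ Fin du) (Fin dw)} (hT : ∀ k, T k ∈ loops S)
    (hT' : ∀ i j, MemLp (fun θ => T' θ i j) 2 circ)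
    (h : Tendsto (fun k => h2sq fun θ => T k θ - T' θ) atTop (𝓝 0)) : T' ∈ loops S := by
  have hm : ∀ k, EntryAESM (T k) := fun k => (hT k).1.entryAESM
  have hm' : EntryAESM T' := fun i j => (hT' i j).1
  obtain ⟨φ, hφ, hlim⟩ := exists_subseq_tendsto_ae hm hm' h
  refine ⟨MemH.of_tendsto (fun k => (hT k).1) hT' h, ?_⟩
  filter_upwards [hlim, ae_all_iff.2 fun k => (hT k).2] with θ h1 h2
  rw [← sub_eq_zero]
  ext i j
  have h3 : ∀ k, stateDefect S (T (φ k)) θ i j = 0 := fun k => by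
    rw [stateDefect, h2, sub_self]; rfl
  have h4 : Tendsto (fun k => stateDefect S (T (φ k)) θ i j) atTop
      (𝓝 (stateDefect S T' θ i j)) := by
    refine Tendsto.sub ((h1 _ _).const_mul _) (Tendsto.add (Tendsto.add ?_ ?_) tendsto_const_nhds)
    · exact tendsto_finsetSum (f := fun l k => cpx S.A i l * T (φ k) θ (Sum.inl l) j) Finset.univ
        fun l _ => (h1 (Sum.inl l) j).const_mul _
    · exact tendsto_finsetSum (f := fun l k => cpx S.Bu i l * T (φ k) θ (Sum.inr l) j) Finset.univ
        fun l _ => (h1 (Sum.inr l) j).const_mul _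
  simp only [h3] at h4
  exact (tendsto_nhds_unique h4 tendsto_const_nhds)

/-- The constant matrix `[-L I]`, a left inverse of `inner`. -/
def Regulator.leftInverse (ρ : Regulator S) : Matrix (Fin du) (Fin dx ⊕ Fin du) ℂ :=
  Matrix.fromCols (-cpx ρ.L) (1 : Matrix (Fin du) (Fin du) ℂ)

/-- The deviation from the regulator, as a constant matrix multiple of the closed loop. -/
theorem Regulator.deviation_eq_mul (ρ : Regulator S)
    (T : TransferMatrix (Fin dx ⊕ Fin du) (Fin dw)) (θ : UnitAddCircle) :
    ρ.deviation T θ = ρ.leftInverse * T θ := by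
  conv_rhs => rw [← Matrix.fromRows_toRows (T θ)]
  rw [leftInverse, Matrix.fromCols_mul_fromRows, deviation, Matrix.neg_mul, Matrix.one_mul]
  abel

theorem Regulator.isUnit_det_gram (ρ : Regulator S) : IsUnit (cpx ρ.gram).det := by
  have h1 : (cpx ρ.gram).det = ((ρ.gram.det : ℝ) : ℂ) :=
    (RingHom.map_det Complex.ofRealHom ρ.gram).symm
  rw [h1, isUnit_iff_ne_zero]
  have h2 : ρ.gram.det ≠ 0 := (isUnit_det_one_add ρ.posSemidef).ne_zero
  exact_mod_cast h2

theorem Regulator.memH_cross (ρ : Regulator S) : MemH ∞ ρ.cross := by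
  have h1 := MemH.ofReal (p := ∞) le_top (S.Bwᵀ * ρ.P * S.Bu)
  have h2 := ((MemH.ofReal (p := ∞) le_top (S.Bwᵀ * ρ.P * (S.A + S.Bu * ρ.L))).mul le_top
    ρ.memH_res).mul le_top (MemH.ofReal le_top S.Bu)
  have h3 := h1.add le_top h2
  have e : ρ.cross = fun θ => cpx (S.Bwᵀ * ρ.P * S.Bu) +
      cpx (S.Bwᵀ * ρ.P * (S.A + S.Bu * ρ.L)) * ρ.res θ * cpx S.Bu := by
    funext θ
    rw [cross, Acl, ← cpx_mul]
  rw [e]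
  exact h3

theorem fourier_conj_smul_wform {m n : Type} [Fintype m] [Fintype n] (k : ℕ) (θ : UnitAddCircle)
    (X Y : Matrix m n ℂ) (W : Matrix n n ℂ) :
    wform ((fourier (-(k : ℤ)) θ : ℂ) • X) Y W = fourier (k : ℤ) θ * wform X Y W := by
  rw [wform, Matrix.conjTranspose_smul, Matrix.smul_mul, Matrix.smul_mul, Matrix.trace_smul,
    smul_eq_mul, wform, fourier_neg, Complex.star_def, Complex.conj_conj]

/-- The minimizer of a weighted cost over the closed loops is bounded. With `E = inner* T`,
optimality makes `E W` strictly anticausal and `E W` orthogonal to the causal part of `E`. The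
remaining part of `E` is rational, so the Laurent coefficients of `Tr (E* E W)` decay geometrically,
and this function is bounded. As the weight is at least the identity, `E` is bounded. -/
theorem Regulator.memH_top_of_minimizer (ρ : Regulator S)
    {W : TransferMatrix (Fin dw) (Fin dw)} (hWm : EntryAESM W) (hWs : EntrySymm W)
    (hWi : ∀ i j, Integrable (fun θ => W θ i j) circ) (hW1 : ∀ᵐ θ ∂circ, (W θ - 1).PosSemidef)
    {T : TransferMatrix (Fin dx ⊕ Fin du) (Fin dw)} (hT : T ∈ loops S) (hTW : wtrace T W < ∞)
    (hmin : ∀ T' ∈ loops S, wtrace T W ≤ wtrace T' W) : MemH ∞ T := by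
  have hW : ∀ᵐ θ ∂circ, (W θ).PosSemidef := hW1.mono fun _ => posSemidef_of_sub_one
  have hTm : EntryAESM T := hT.1.entryAESM
  have hIm : EntryAESM ρ.inner := ρ.memH_inner.entryAESM
  obtain ⟨cI, hcI0, hcI⟩ := ρ.memH_inner.exists_fro_le
  set V := ρ.deviation T with hV
  have hVH : MemH 2 V := ρ.memH_deviation le_rfl hT.1
  have hVW : wtrace V W < ∞ := by
    have e : V = fun θ => ρ.leftInverse * T θ := funext (ρ.deviation_eq_mul T)
    rw [e]
    exact wtrace_mul_lt_top (A := fun _ => ρ.leftInverse) hW (fro_nonneg _)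
      (ae_of_all _ fun _ => le_rfl) hTW
  obtain ⟨E, hE⟩ : ∃ E : TransferMatrix (Fin du) (Fin dw), E = fun θ => (ρ.inner θ)ᴴ * T θ :=
    ⟨_, rfl⟩
  have hEm : EntryAESM E := by
    rw [hE]
    exact hIm.conjTranspose.mul hTm
  have hEV : ∀ᵐ θ ∂circ, E θ = cpx ρ.gram * V θ + (ρ.cross θ)ᴴ := by
    filter_upwards [ρ.eq_inner_mul_deviation_add_drift hT] with θ hθ
    rw [hE]
    dsimp only
    rw [hθ, Matrix.mul_add, ← Matrix.mul_assoc, ρ.inner_conjTranspose_mul_inner,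
      ρ.inner_conjTranspose_mul_drift]
  have hEW : wtrace E W < ∞ := by
    rw [hE]
    refine wtrace_mul_lt_top hW hcI0 ?_ hTW
    filter_upwards [hcI] with θ hθ
    have : fro (ρ.inner θ)ᴴ = fro (ρ.inner θ) := by
      simp only [fro, Matrix.conjTranspose_apply, norm_star]
      exact Finset.sum_comm
    rw [this]
    exact hθ
  -- optimality in the direction `inner * D`, for causal `D`
  have hopt : ∀ D : TransferMatrix (Fin du) (Fin dw), MemH 2 D → wtrace D W < ∞ →
      ∫ θ, wform (D θ) (E θ) (W θ) ∂circ = 0 := by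
    intro D hD hDW
    have h1 := integral_wform_eq_zero hTm (hIm.mul hD.entryAESM) hWm hW
      (hT.1.entrySymm one_le_two)
      ((ρ.memH_inner.mul le_rfl hD).entrySymm one_le_two) hWs hTW
      (wtrace_mul_lt_top hW hcI0 hcI hDW) (fun t => hmin _ (by
        have h2 := ρ.add_inner_mul_mem_loops hT
          (hD.smul le_rfl (HardyFn.ofReal (p := ∞) t))
        convert h2 using 2 with θ
        rw [Matrix.mul_smul]
        rfl))
    rw [← h1]
    refine integral_congr_ae (ae_of_all _ fun θ => ?_)
    simp only [wform, Matrix.conjTranspose_mul, hE, Matrix.mul_assoc]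
  have hoptk : ∀ (k : ℕ) (D : TransferMatrix (Fin du) (Fin dw)), MemH 2 D → wtrace D W < ∞ →
      zcoeff (fun θ => wform (D θ) (E θ) (W θ)) k = 0 := by
    intro k D hD hDW
    have h1 := hopt (fun θ => (fourier (-(k : ℤ)) θ : ℂ) • D θ)
      (hD.smul le_rfl (HardyFn.fourier_neg k)) (by
        refine lt_of_eq_of_lt ?_ hDW
        refine lintegral_congr fun θ => ?_
        have := wquad_smul_left (D θ) (fourier (-(k : ℤ)) θ : ℂ) (W θ)
        rw [norm_fourier_apply, one_pow, one_mul] at this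
        exact congrArg ENNReal.ofReal this)
    rw [zcoeff_eq, ← h1]
    exact integral_congr_ae (ae_of_all _ fun θ => (fourier_conj_smul_wform k θ _ _ _).symm)
  -- entries of `E W`
  have hG : ∀ i j, Integrable (fun θ => (E θ * W θ) i j) circ := by
    intro i j
    have h1 := integrable_wform (X := fun _ => Matrix.single i j 1) (Y := E) (EntryAESM.const _) hEm
      hWm hW (wtrace_lt_top_of_fro_le hW hWi (ae_of_all _ fun _ => le_rfl)) hEW
    refine h1.congr (ae_of_all _ fun θ => ?_)
    simp only [wform, Matrix.mul_assoc, Matrix.conjTranspose_single, star_one]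
    rw [Matrix.trace_single_mul]
    simp
  have hGF : ∀ F : TransferMatrix (Fin dw) (Fin du), MemH ∞ F →
      Integrable (fun θ => (F θ * (E θ * W θ)).trace) circ := by
    intro F hF
    refine integrable_finsetSum (f := fun i θ => ∑ j, F θ i j * (E θ * W θ) j i) Finset.univ
      fun i _ => integrable_finsetSum _ fun j _ => ?_
    obtain ⟨c, hc⟩ := (memLp_top_iff_bounded (hF.memLp i j).1).1 (hF.memLp i j)
    exact (hG j i).bdd_mul (hF.memLp i j).1 hc
  have hconst : ∀ (k : ℕ) (C : Matrix (Fin dw) (Fin du) ℝ),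
      zcoeff (fun θ => (cpx C * (E θ * W θ)).trace) k = 0 := by
    intro k C
    rw [← hoptk k (fun _ => cpx Cᵀ) (MemH.ofReal one_le_two _)
      (wtrace_lt_top_of_fro_le hW hWi (ae_of_all _ fun _ => le_rfl))]
    congr 1
    funext θ
    rw [wform, cpx_conjTranspose, Matrix.transpose_transpose, Matrix.mul_assoc]
  -- the part of the coefficients that comes from the resolvent
  set J : Matrix (Fin dw) (Fin dx) ℝ → ℤ → ℂ := fun Y k =>
    zcoeff (fun θ => (cpx Y * ρ.res θ * cpx S.Bu * (E θ * W θ)).trace) k with hJ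
  have hFY : ∀ Y : Matrix (Fin dw) (Fin dx) ℝ, MemH ∞ fun θ => cpx Y * ρ.res θ * cpx S.Bu :=
    fun Y => ((MemH.ofReal le_top Y).mul le_top ρ.memH_res).mul le_top (MemH.ofReal le_top _)
  set Ac := S.A + S.Bu * ρ.L with hAc
  have hJstep : ∀ (k : ℕ) Y, J Y (k + 1) = J (Y * Ac) k := by
    intro k Y
    have h1 : (fun θ => (fourier 1 θ : ℂ) * (cpx Y * ρ.res θ * cpx S.Bu * (E θ * W θ)).trace) =
        fun θ => (cpx (Y * S.Bu) * (E θ * W θ)).trace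
          + (cpx (Y * Ac) * ρ.res θ * cpx S.Bu * (E θ * W θ)).trace := by
      funext θ
      rw [← smul_eq_mul, ← Matrix.trace_smul, ← Matrix.trace_add, ← Matrix.add_mul,
        ← Matrix.smul_mul, ← Matrix.smul_mul, ← Matrix.mul_smul, ρ.smul_res,
        cpx_mul, cpx_mul, Acl, ← hAc]
      simp only [Matrix.mul_add, Matrix.add_mul, Matrix.mul_one, Matrix.mul_assoc]
    rw [hJ]
    dsimp only
    rw [← zcoeff_fourier_mul, h1, zcoeff_add (hGF _ (MemH.ofReal le_top _)) (hGF _ (hFY _)),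
      hconst, zero_add]
  have hJpow : ∀ (k : ℕ) Y, J Y k = J (Y * Ac ^ k) 0 := by
    intro k
    induction k with
    | zero => intro Y; simp
    | succ k ih =>
      intro Y
      rw [Nat.cast_succ, hJstep, ih, Matrix.mul_assoc, ← pow_succ']
  obtain ⟨C, r, hC0, hr0, hr1, hCr⟩ := exists_pow_entry_le_of_riccati ρ.posSemidef ρ.riccati
  have hJbound : ∀ Y, ∃ K : ℝ, ∀ k : ℕ, ‖J Y k‖ ≤ K * r ^ k := by
    intro Y
    set g : Fin dx → Fin dw → ℂ := fun j i =>
      zcoeff (fun θ => (ρ.res θ * cpx S.Bu * (E θ * W θ)) j i) 0 with hg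
    have hgi : ∀ j i, Integrable (fun θ => (ρ.res θ * cpx S.Bu * (E θ * W θ)) j i) circ := by
      intro j i
      refine integrable_finsetSum (f := fun l θ => (ρ.res θ * cpx S.Bu) j l * (E θ * W θ) l i)
        Finset.univ fun l _ => ?_
      have hF : MemH ∞ fun θ => ρ.res θ * cpx S.Bu := ρ.memH_res.mul le_top (MemH.ofReal le_top _)
      obtain ⟨c, hc⟩ := (memLp_top_iff_bounded (hF.memLp j l).1).1 (hF.memLp j l)
      exact (hG l i).bdd_mul (hF.memLp j l).1 hc
    have hJ0 : ∀ Z : Matrix (Fin dw) (Fin dx) ℝ, J Z 0 = ∑ i, ∑ j, (Z i j : ℂ) * g j i := by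
      intro Z
      rw [hJ]
      dsimp only
      have e : (fun θ => (cpx Z * ρ.res θ * cpx S.Bu * (E θ * W θ)).trace) = fun θ =>
          ∑ i, ∑ j, (Z i j : ℂ) * (ρ.res θ * cpx S.Bu * (E θ * W θ)) j i := by
        funext θ
        rw [Matrix.mul_assoc (cpx Z), Matrix.mul_assoc (cpx Z)]
        rfl
      rw [e, zcoeff_sum _ fun i _ => integrable_finsetSum _ fun j _ => (hgi j i).const_mul _]
      refine Finset.sum_congr rfl fun i _ => ?_
      rw [zcoeff_sum _ fun j _ => (hgi j i).const_mul _]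
      simp only [zcoeff_const_mul, hg]
    refine ⟨∑ i, ∑ j, (∑ l, |Y i l| * C) * ‖g j i‖, fun k => ?_⟩
    rw [hJpow, hJ0, Finset.sum_mul]
    refine (norm_sum_le _ _).trans (Finset.sum_le_sum fun i _ => ?_)
    rw [Finset.sum_mul]
    refine (norm_sum_le _ _).trans (Finset.sum_le_sum fun j _ => ?_)
    rw [norm_mul, Complex.norm_real, mul_right_comm]
    refine mul_le_mul_of_nonneg_right ?_ (norm_nonneg _)
    rw [Matrix.mul_apply, Finset.sum_mul]
    refine (norm_sum_le _ _).trans (Finset.sum_le_sum fun l _ => ?_)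
    rw [norm_mul, mul_assoc]
    exact mul_le_mul_of_nonneg_left (hCr k l j) (norm_nonneg _)
  -- the coefficients of `Tr (E* E W)`
  set h : UnitAddCircle → ℂ := fun θ => wform (E θ) (E θ) (W θ) with hh
  have hhi : Integrable h circ := integrable_wform hEm hEm hWm hW hEW hEW
  have hcpos : ∀ k : ℕ, zcoeff h k = J (S.Bwᵀ * ρ.P * Ac) k := by
    intro k
    have hRV : MemH 2 fun θ => cpx ρ.gram * V θ :=
      (MemH.ofReal le_top _).mul le_rfl hVH
    have hRVW : wtrace (fun θ => cpx ρ.gram * V θ) W < ∞ :=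
      wtrace_mul_lt_top (A := fun _ => cpx ρ.gram) hW (fro_nonneg _)
        (ae_of_all _ fun _ => le_rfl) hVW
    have e : h =ᵐ[circ] fun θ => (wform (cpx ρ.gram * V θ) (E θ) (W θ)
        + (cpx (S.Bwᵀ * ρ.P * S.Bu) * (E θ * W θ)).trace)
        + (cpx (S.Bwᵀ * ρ.P * Ac) * ρ.res θ * cpx S.Bu * (E θ * W θ)).trace := by
      filter_upwards [hEV] with θ hθ
      have h2 : h θ = wform (cpx ρ.gram * V θ) (E θ) (W θ)
          + (ρ.cross θ * (E θ * W θ)).trace := by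
        rw [hh]
        dsimp only
        have h3 : (E θ)ᴴ = (cpx ρ.gram * V θ)ᴴ + ρ.cross θ := by
          rw [hθ, Matrix.conjTranspose_add, Matrix.conjTranspose_conjTranspose]
        rw [wform, h3, Matrix.add_mul, Matrix.add_mul, Matrix.trace_add, wform,
          Matrix.mul_assoc (ρ.cross θ)]
      rw [h2, cross, Matrix.add_mul, Matrix.trace_add, ← add_assoc, Acl,
        cpx_mul (S.Bwᵀ * ρ.P) Ac]
    have i1 := integrable_wform hRV.entryAESM hEm hWm hW hRVW hEW
    have i2 := hGF _ (MemH.ofReal le_top (S.Bwᵀ * ρ.P * S.Bu))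
    have i3 : Integrable (fun θ => wform (cpx ρ.gram * V θ) (E θ) (W θ)
        + (cpx (S.Bwᵀ * ρ.P * S.Bu) * (E θ * W θ)).trace) circ := i1.add i2
    rw [zcoeff_congr_ae e, zcoeff_add i3 (hGF _ (hFY _)), zcoeff_add i1 i2, hoptk k _ hRV hRVW,
      hconst, zero_add, zero_add]
  have hreal : ∀ᵐ θ ∂circ, conj (h θ) = h θ := by
    filter_upwards [hW] with θ hθ
    obtain ⟨B, hB⟩ := exists_eq_mul_conjTranspose hθ
    rw [hh]
    dsimp only
    rw [hB, wform_mul_conjTranspose, ← Complex.star_def, ← Matrix.trace_conjTranspose]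
    simp
  have hcneg : ∀ k : ℤ, ‖zcoeff h (-k)‖ = ‖zcoeff h k‖ := by
    intro k
    have h1 := zcoeff_conj h k
    rw [zcoeff_congr_ae hreal] at h1
    rw [h1, RCLike.norm_conj]
  obtain ⟨K, hK⟩ := hJbound (S.Bwᵀ * ρ.P * Ac)
  have hsum : Summable fun k : ℤ => ‖zcoeff h k‖ := by
    have h1 : Summable fun k : ℕ => ‖zcoeff h k‖ := by
      refine Summable.of_nonneg_of_le (fun _ => norm_nonneg _) (fun k => ?_)
        ((summable_geometric_of_lt_one hr0 hr1).mul_left K)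
      rw [hcpos]
      exact hK k
    exact Summable.of_nat_of_neg h1 (h1.congr fun k => (hcneg k).symm)
  obtain ⟨C', hC'⟩ := bounded_of_summable_zcoeff hhi hsum
  obtain ⟨cS, hcS0, hcS⟩ := ρ.memH_cross.exists_fro_le
  obtain ⟨cD, hcD0, hcD⟩ := ρ.memH_drift.exists_fro_le
  refine hT.1.top_of_fro_le (C := 2 * (cI * (fro (cpx ρ.gram)⁻¹ * (2 * C' + 2 * cS))) + 2 * cD) ?_
  filter_upwards [hC', hcS, hcD, hcI, hW1, hEV, ρ.eq_inner_mul_deviation_add_drift hT]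
    with θ h1 h2 h3 h4 h5 h6 h7
  have hfE : fro (E θ) ≤ C' := by
    refine (fro_le_wquad h5 _).trans ?_
    rw [← wform_self_re]
    exact (Complex.re_le_norm _).trans h1
  have hVE : V θ = (cpx ρ.gram)⁻¹ * (E θ + -(ρ.cross θ)ᴴ) := by
    rw [h6, add_neg_cancel_right, Matrix.nonsing_inv_mul_cancel_left _ _ ρ.isUnit_det_gram]
  have hfc : fro (-(ρ.cross θ)ᴴ) = fro (ρ.cross θ) := by
    simp only [fro, Matrix.neg_apply, norm_neg, Matrix.conjTranspose_apply, norm_star]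
    exact Finset.sum_comm
  have hfV : fro (V θ) ≤ fro (cpx ρ.gram)⁻¹ * (2 * C' + 2 * cS) := by
    rw [hVE]
    refine (fro_mul_le _ _).trans (mul_le_mul_of_nonneg_left ?_ (fro_nonneg _))
    refine (fro_add_le _ _).trans ?_
    rw [hfc]
    linarith
  rw [h7]
  refine (fro_add_le _ _).trans (add_le_add (mul_le_mul_of_nonneg_left ?_ zero_le_two)
    (mul_le_mul_of_nonneg_left h3 zero_le_two))
  exact (fro_mul_le _ _).trans (mul_le_mul h4 hfV (fro_nonneg _) hcI0)

/-- For every multiplier, the weighted cost has a bounded minimizer over the closed loops, with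
quadratic growth. -/
theorem Regulator.exists_minimizer (ρ : Regulator S) {L : TransferMatrix (Fin dw) (Fin dw)}
    (hL : L ∈ multipliers dw) :
    ∃ T ∈ loops S, MemH ∞ T ∧ wtrace T (fun θ => 1 + L θ) < ∞ ∧
      ∀ T' ∈ loops S, wtrace T (fun θ => 1 + L θ)
        + ENNReal.ofReal (1 / 2) * h2sq (fun θ => T' θ - T θ) ≤ wtrace T' (fun θ => 1 + L θ) := by
  obtain ⟨c, -, hc⟩ := ρ.memH_drift.exists_fro_le
  obtain ⟨T, hT, hfin, hgrow⟩ := exists_wtrace_minimizer (C := loops S) (weight_entryAESM hL)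
    (weight_sub_one_posSemidef hL) (fun T hT => hT.1.memLp)
    (fun T hT T' hT' => loops_midpoint hT hT') (fun T T' hT hT' h => loops_closed hT hT' h)
    ⟨ρ.drift, ρ.drift_mem_loops, wtrace_lt_top_of_fro_le (weight_posSemidef hL)
      (weight_integrable hL) hc⟩
  refine ⟨T, hT, ?_, hfin, hgrow⟩
  exact ρ.memH_top_of_minimizer (weight_entryAESM hL) (weight_entrySymm hL) (weight_integrable hL)
    (weight_sub_one_posSemidef hL) hT hfin fun T' hT' => le_self_add.trans (hgrow T' hT')

end loops

/-! ### The cone of dual variables -/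

section multipliers
variable {m : Type} [Fintype m] {n : ℕ} {L L' : TransferMatrix (Fin n) (Fin n)}

theorem zero_mem_multipliers : (fun _ => 0 : TransferMatrix (Fin n) (Fin n)) ∈ multipliers n := by
  refine ⟨(memL_iff le_rfl).2 fun i j => ⟨MemLp.zero', ?_⟩, ae_of_all _ fun _ => .zero⟩
  simpa using ConjSymm.ofReal 0

theorem add_smul_mem_multipliers (hL : L ∈ multipliers n) (hL' : L' ∈ multipliers n) {a b : ℝ}
    (ha : 0 ≤ a) (hb : 0 ≤ b) : (fun θ => a • L θ + b • L' θ) ∈ multipliers n := by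
  have h1 := (memL_iff le_rfl).1 hL.1
  have h2 := (memL_iff le_rfl).1 hL'.1
  refine ⟨(memL_iff le_rfl).2 fun i j =>
    ⟨((h1 i j).1.const_smul a).add ((h2 i j).1.const_smul b), ?_⟩, ?_⟩
  · have := ((ConjSymm.ofReal a).mul (h1 i j).2).add ((ConjSymm.ofReal b).mul (h2 i j).2)
    simpa using this
  · filter_upwards [hL.2, hL'.2] with θ h h'
    exact (h.smul ha).add (h'.smul hb)

theorem smul_mem_multipliers (hL : L ∈ multipliers n) {a : ℝ} (ha : 0 ≤ a) :
    (fun θ => a • L θ) ∈ multipliers n := by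
  simpa using add_smul_mem_multipliers hL hL ha le_rfl

theorem integrable_trace (hL : L ∈ multipliers n) :
    Integrable (fun θ => (L θ).trace.re) circ := by
  have : Integrable (fun θ => (L θ).trace) circ :=
    integrable_finsetSum _ fun i _ => memLp_one_iff_integrable.1 (hL.1.memLp i i)
  exact this.re

theorem ntrace_nonneg (hL : L ∈ multipliers n) : 0 ≤ ntrace L :=
  integral_nonneg_of_ae (hL.2.mono fun _ h => trace_re_nonneg h)

theorem ntrace_add_smul (hL : L ∈ multipliers n) (hL' : L' ∈ multipliers n) (a b : ℝ) :
    ntrace (fun θ => a • L θ + b • L' θ) = a * ntrace L + b * ntrace L' := by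
  have h1 := (integrable_trace hL).const_mul a
  have h2 := (integrable_trace hL').const_mul b
  rw [ntrace, ntrace, ntrace, ← integral_const_mul, ← integral_const_mul, ← integral_add h1 h2]
  refine integral_congr_ae (ae_of_all _ fun θ => ?_)
  simp [Matrix.trace_add, Matrix.trace_smul]

theorem ntrace_smul (a : ℝ) : ntrace (fun θ => a • L θ) = a * ntrace L := by
  rw [ntrace, ntrace, ← integral_const_mul]
  refine integral_congr_ae (ae_of_all _ fun θ => ?_)
  simp [Matrix.trace_smul]

theorem wtrace_add_smul {T : TransferMatrix m (Fin n)} {W W' : TransferMatrix (Fin n) (Fin n)}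
    (hT : EntryAESM T) (hWm : EntryAESM W)
    (hW : ∀ᵐ θ ∂circ, (W θ).PosSemidef) (hW' : ∀ᵐ θ ∂circ, (W' θ).PosSemidef) {a b : ℝ}
    (ha : 0 ≤ a) (hb : 0 ≤ b) : wtrace T (fun θ => a • W θ + b • W' θ) =
      ENNReal.ofReal a * wtrace T W + ENNReal.ofReal b * wtrace T W' := by
  simp only [wtrace_eq]
  rw [← lintegral_const_mul' _ _ ENNReal.ofReal_ne_top,
    ← lintegral_const_mul' _ _ ENNReal.ofReal_ne_top,
    ← lintegral_add_left' ((hT.wquad hWm).aemeasurable.ennreal_ofReal.const_mul _)]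
  refine lintegral_congr_ae ?_
  filter_upwards [hW, hW'] with θ h h'
  rw [wquad_add, wquad_smul, wquad_smul, ← ENNReal.ofReal_mul ha, ← ENNReal.ofReal_mul hb,
    ENNReal.ofReal_add (mul_nonneg ha (wquad_nonneg h _)) (mul_nonneg hb (wquad_nonneg h' _))]

theorem wtrace_one_add {T : TransferMatrix m (Fin n)} (hT : EntryAESM T)
    (hL : L ∈ multipliers n) : wtrace T (fun θ => 1 + L θ) = h2sq T + wtrace T L := by
  have h := wtrace_add_smul hT (EntryAESM.const 1)
    (ae_of_all _ fun _ => Matrix.PosSemidef.one) hL.2 zero_le_one zero_le_one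
  have h2 : wtrace T (fun _ => 1) = h2sq T := by simp [wtrace, h2sq]
  simpa only [one_smul, ENNReal.ofReal_one, one_mul, h2] using h

open scoped Matrix.Norms.L2Operator in
theorem wtrace_le_of_opNorm_le {T : TransferMatrix m (Fin n)} (hL : L ∈ multipliers n) {c : ℝ}
    (hT : ∀ᵐ θ ∂circ, ‖T θ‖ ≤ c) : wtrace T L ≤ ENNReal.ofReal (c ^ 2 * ntrace L) := by
  have h1 : 0 ≤ᵐ[circ] fun θ => c ^ 2 * (L θ).trace.re :=
    hL.2.mono fun θ h => mul_nonneg (sq_nonneg c) (trace_re_nonneg h)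
  rw [wtrace_eq, ntrace, ← integral_const_mul,
    ofReal_integral_eq_lintegral_ofReal ((integrable_trace hL).const_mul _) h1]
  refine lintegral_mono_ae ?_
  filter_upwards [hL.2, hT] with θ h h'
  refine ENNReal.ofReal_le_ofReal ((wquad_le_opNorm h _).trans ?_)
  exact mul_le_mul_of_nonneg_right (pow_le_pow_left₀ (norm_nonneg _) h' 2) (trace_re_nonneg h)

end multipliers

/-! ### The bound on the `H_∞` norm -/

section bound
open scoped Matrix.Norms.L2Operator
variable {m : Type} [Fintype m] {n : ℕ}

theorem hinf_le_iff {T : TransferMatrix m (Fin n)} {c : ℝ} (hc : 0 ≤ c) :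
    hinf T ≤ ENNReal.ofReal c ↔ ∀ᵐ θ ∂circ, ‖T θ‖ ≤ c := by
  constructor
  · intro h
    filter_upwards [ENNReal.ae_le_essSup (μ := circ) fun θ => ENNReal.ofReal ‖T θ‖] with θ hθ
    exact (ENNReal.ofReal_le_ofReal_iff hc).1 (hθ.trans h)
  · intro h
    exact essSup_le_of_ae_le _ (h.mono fun θ hθ => ENNReal.ofReal_le_ofReal hθ)

theorem hinf_congr_ae {T T' : TransferMatrix m (Fin n)} (h : T =ᵐ[circ] T') : hinf T = hinf T' :=
  essSup_congr_ae (h.mono fun θ hθ => by simp only [hθ])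

theorem fro_le_of_opNorm_le {T : Matrix m (Fin n) ℂ} {c : ℝ} (h : ‖T‖ ≤ c) :
    fro T ≤ c ^ 2 * fro (1 : Matrix (Fin n) (Fin n) ℂ) := by
  have h1 := fro_mul_le_opNorm T (1 : Matrix (Fin n) (Fin n) ℂ)
  rw [Matrix.mul_one] at h1
  exact h1.trans (mul_le_mul_of_nonneg_right (pow_le_pow_left₀ (norm_nonneg _) h 2) (fro_nonneg _))

theorem MemH.top_of_opNorm_le {T : TransferMatrix m (Fin n)} (hT : MemH 2 T) {c : ℝ}
    (h : ∀ᵐ θ ∂circ, ‖T θ‖ ≤ c) : MemH ∞ T :=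
  hT.top_of_fro_le (h.mono fun _ hθ => fro_le_of_opNorm_le hθ)

theorem MemH.exists_opNorm_le {T : TransferMatrix m (Fin n)} (hT : MemH ∞ T) :
    ∃ c, 0 ≤ c ∧ ∀ᵐ θ ∂circ, ‖T θ‖ ≤ c := by
  obtain ⟨C, hC0, hC⟩ := hT.exists_fro_le
  refine ⟨Real.sqrt C, Real.sqrt_nonneg _, hC.mono fun θ hθ => ?_⟩
  exact Real.le_sqrt_of_sq_le ((opNorm_sq_le_fro _).trans hθ)

/-- The reflection `W(z) ↦ conj W(z̄)` makes a weight into the weight of a Laurent operator with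
real blocks. -/
theorem symmetrization_mem_multipliers {W : TransferMatrix (Fin n) (Fin n)}
    (hWi : ∀ i j, Integrable (fun θ => W θ i j) circ) (hW : ∀ᵐ θ ∂circ, (W θ).PosSemidef) :
    (fun θ => W θ + (W (-θ))ᴴᵀ) ∈ multipliers n := by
  have hq : MeasurePreserving (fun θ : UnitAddCircle => -θ) circ circ :=
    Measure.measurePreserving_neg circ
  refine ⟨(memL_iff le_rfl).2 fun i j => ⟨?_, ?_⟩, ?_⟩
  · have h1 : MemLp (fun θ => conj (W (-θ) i j)) 1 circ :=
      ((memLp_one_iff_integrable.2 (hWi i j)).comp_measurePreserving hq).star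
    exact (memLp_one_iff_integrable.2 (hWi i j)).add h1
  · refine ae_of_all _ fun θ => ?_
    simp [add_comm]
  · have h2 : ∀ᵐ θ ∂circ, (W (-θ)).PosSemidef :=
      hq.quasiMeasurePreserving.ae (p := fun θ => (W θ).PosSemidef) hW
    filter_upwards [hW, h2] with θ h h'
    exact h.add h'.conjTranspose.transpose

theorem wquad_conjTranspose_transpose (M M' : Matrix m (Fin n) ℂ) (W : Matrix (Fin n) (Fin n) ℂ)
    (h : ∀ i j, M' i j = conj (M i j)) : wquad M (Wᴴᵀ) = wquad M' W := by
  have : M = M'ᴴᵀ := by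
    ext i j; simp [h]
  subst this
  have e : (M'ᴴᵀ)ᴴ * M'ᴴᵀ * Wᴴᵀ = (M'ᴴ * M' * W)ᴴᵀ := by
    ext i j
    simp only [Matrix.mul_apply, Matrix.transpose_apply, Matrix.conjTranspose_apply, star_sum,
      star_mul', star_star]
  rw [wquad, wquad, e, Matrix.trace_transpose, Matrix.trace_conjTranspose]
  simp

theorem wtrace_symmetrization {T : TransferMatrix m (Fin n)} {W : TransferMatrix (Fin n) (Fin n)}
    (hT : EntryAESM T) (hTs : EntrySymm T) (hWm : EntryAESM W)
    (hW : ∀ᵐ θ ∂circ, (W θ).PosSemidef) :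
    wtrace T (fun θ => W θ + (W (-θ))ᴴᵀ) = 2 * wtrace T W := by
  have hq : MeasurePreserving (fun θ : UnitAddCircle => -θ) circ circ :=
    Measure.measurePreserving_neg circ
  have h2 : ∀ᵐ θ ∂circ, (W (-θ)).PosSemidef :=
    hq.quasiMeasurePreserving.ae (p := fun θ => (W θ).PosSemidef) hW
  have hs : ∀ᵐ θ ∂circ, ∀ i j, T (-θ) i j = conj (T θ i j) :=
    ae_all_iff.2 fun i => ae_all_iff.2 fun j => hTs i j
  have h3 : ∫⁻ θ, ENNReal.ofReal (wquad (T (-θ)) (W (-θ))) ∂circ = wtrace T W :=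
    hq.lintegral_comp_emb (MeasurableEquiv.neg UnitAddCircle).measurableEmbedding
      (fun θ => ENNReal.ofReal (wquad (T θ) (W θ)))
  rw [two_mul]
  nth_rewrite 2 [← h3]
  rw [wtrace_eq, wtrace_eq, ← lintegral_add_left' (hT.wquad hWm).aemeasurable.ennreal_ofReal]
  refine lintegral_congr_ae ?_
  filter_upwards [hW, h2, hs] with θ h h' h''
  rw [wquad_add, wquad_conjTranspose_transpose (T θ) (T (-θ)) _ h'',
    ENNReal.ofReal_add (wquad_nonneg h _) (wquad_nonneg h' _)]

theorem ntrace_symmetrization {W : TransferMatrix (Fin n) (Fin n)}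
    (hWi : ∀ i j, Integrable (fun θ => W θ i j) circ) :
    ntrace (fun θ => W θ + (W (-θ))ᴴᵀ) = 2 * ∫ θ, (W θ).trace.re ∂circ := by
  obtain ⟨f, hf⟩ : ∃ f : UnitAddCircle → ℝ, ∀ θ, f θ = (W θ).trace.re := ⟨_, fun _ => rfl⟩
  have hi : Integrable f circ := by
    have : Integrable (fun θ => (W θ).trace) circ :=
      integrable_finsetSum _ fun i _ => hWi i i
    exact this.re.congr (ae_of_all _ fun θ => (hf θ).symm)
  have h : ntrace (fun θ => W θ + (W (-θ))ᴴᵀ) = ∫ θ, f θ + f (-θ) ∂circ := by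
    refine integral_congr_ae (ae_of_all _ fun θ => ?_)
    simp [Matrix.trace_add, Matrix.trace_transpose, Matrix.trace_conjTranspose, hf]
  rw [h, integral_add hi hi.comp_neg, integral_neg_eq_self, two_mul]
  simp only [hf]

/-- A transfer matrix whose weighted costs are bounded by `γ² tr Λ` for all dual variables has
`H_∞` norm at most `γ`: this is tested on the weights `x x*` on a set of frequencies. -/
theorem opNorm_le_of_wtrace_le {T : TransferMatrix m (Fin n)} (hT : EntryAESM T)
    (hTs : EntrySymm T) {γ : ℝ} (hγ : 0 ≤ γ)
    (h : ∀ L ∈ multipliers n, wtrace T L ≤ ENNReal.ofReal (γ ^ 2 * ntrace L)) :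
    ∀ᵐ θ ∂circ, ‖T θ‖ ≤ γ := by
  have key : ∀ x : Fin n → ℂ, ∀ᵐ θ ∂circ,
      ∑ i, ‖(T θ *ᵥ x) i‖ ^ 2 ≤ γ ^ 2 * ∑ j, ‖x j‖ ^ 2 := by
    intro x
    set X : Matrix (Fin n) (Fin n) ℂ := Matrix.vecMulVec x (star x) with hX
    have hXp : X.PosSemidef := Matrix.posSemidef_vecMulVec_self_star x
    have hXt : X.trace.re = ∑ j, ‖x j‖ ^ 2 := by
      rw [hX, Matrix.trace_vecMulVec, dotProduct, Complex.re_sum]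
      refine Finset.sum_congr rfl fun j _ => ?_
      rw [Pi.star_apply, Complex.star_def, Complex.mul_conj']
      norm_cast
    have hXq : ∀ M : Matrix m (Fin n) ℂ, wquad M X = ∑ i, ‖(M *ᵥ x) i‖ ^ 2 := by
      intro M
      have e : X = (Matrix.of fun j (_ : Unit) => x j) * (Matrix.of fun j (_ : Unit) => x j)ᴴ := by
        ext i j
        simp [hX, Matrix.vecMulVec_apply, Matrix.mul_apply]
      rw [e, wquad_mul_conjTranspose, fro]
      simp [Matrix.mul_apply, Matrix.mulVec, dotProduct]
    set g : UnitAddCircle → ℝ := fun θ => wquad (T θ) X with hg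
    have hgm : AEStronglyMeasurable g circ := hT.wquad (EntryAESM.const X)
    set B : Set UnitAddCircle := {θ | γ ^ 2 * X.trace.re < hgm.mk g θ} with hB
    have hBm : MeasurableSet B :=
      measurableSet_lt measurable_const hgm.stronglyMeasurable_mk.measurable
    set W : TransferMatrix (Fin n) (Fin n) := fun θ => B.indicator (fun _ => X) θ with hW
    have hWe : ∀ i j, (fun θ => W θ i j) = B.indicator fun _ => X i j := by
      intro i j; ext θ
      by_cases hθ : θ ∈ B <;> simp [hW, hθ]
    have hWi : ∀ i j, Integrable (fun θ => W θ i j) circ := fun i j => by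
      rw [hWe]; exact (integrable_const _).indicator hBm
    have hWp : ∀ θ, (W θ).PosSemidef := fun θ => by
      by_cases hθ : θ ∈ B
      · simpa [hW, hθ] using hXp
      · simpa [hW, hθ] using Matrix.PosSemidef.zero
    have h1 := h _ (symmetrization_mem_multipliers hWi (ae_of_all _ hWp))
    rw [wtrace_symmetrization hT hTs (fun i j => (hWi i j).1) (ae_of_all _ hWp),
      ntrace_symmetrization hWi] at h1
    have h2 : wtrace T W = ∫⁻ θ in B, ENNReal.ofReal (g θ) ∂circ := by
      rw [wtrace_eq, ← lintegral_indicator hBm]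
      refine lintegral_congr fun θ => ?_
      by_cases hθ : θ ∈ B
      · simp [hW, hθ, hg]
      · simp [hW, hθ, wquad]
    have h3 : ∫ θ, (W θ).trace.re ∂circ = circ.real B * X.trace.re := by
      have : (fun θ => (W θ).trace.re) = B.indicator fun _ => X.trace.re := by
        ext θ
        by_cases hθ : θ ∈ B <;> simp [hW, hθ]
      rw [this, integral_indicator hBm, setIntegral_const, smul_eq_mul]
    have hX0 : 0 ≤ X.trace.re := trace_re_nonneg hXp
    have h4 : ∫⁻ θ in B, ENNReal.ofReal (g θ) ∂circ ≤
        ∫⁻ _ in B, ENNReal.ofReal (γ ^ 2 * X.trace.re) ∂circ := by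
      rw [h2, h3] at h1
      rw [setLIntegral_const]
      have e : ENNReal.ofReal (γ ^ 2 * (2 * (circ.real B * X.trace.re))) =
          2 * (ENNReal.ofReal (γ ^ 2 * X.trace.re) * circ B) := by
        rw [show γ ^ 2 * (2 * (circ.real B * X.trace.re)) =
          2 * ((γ ^ 2 * X.trace.re) * circ.real B) by ring, ENNReal.ofReal_mul zero_le_two,
          ENNReal.ofReal_mul (by positivity), ofReal_measureReal]
        simp
      rw [e] at h1
      exact (ENNReal.mul_le_mul_iff_right two_ne_zero (by simp)).1 h1
    have h5 : circ B = 0 := by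
      by_contra hne
      have e : ∫⁻ θ in B, ENNReal.ofReal (g θ) ∂circ = ∫⁻ θ in B, ENNReal.ofReal (hgm.mk g θ) ∂circ :=
        lintegral_congr_ae (ae_restrict_of_ae (hgm.ae_eq_mk.mono fun θ hθ => by simp only [hθ]))
      rw [e] at h4
      refine absurd h4 (not_le.2 ?_)
      refine setLIntegral_strict_mono hBm hne
        hgm.stronglyMeasurable_mk.measurable.ennreal_ofReal ?_ ?_
      · rw [setLIntegral_const]
        exact ENNReal.mul_ne_top ENNReal.ofReal_ne_top (measure_ne_top _ _)
      · refine ae_of_all _ fun θ hθB => ?_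
        exact (ENNReal.ofReal_lt_ofReal_iff_of_nonneg (by positivity)).2 hθB
    have h6 : ∀ᵐ θ ∂circ, θ ∉ B := measure_eq_zero_iff_ae_notMem.1 h5
    filter_upwards [h6, hgm.ae_eq_mk] with θ h7 h8
    rw [← hXq, ← hXt, show wquad (T θ) X = g θ from rfl, h8]
    exact not_lt.1 h7
  have hall : ∀ᵐ θ ∂circ, ∀ k : ℕ, ∑ i, ‖(T θ *ᵥ TopologicalSpace.denseSeq (Fin n → ℂ) k) i‖ ^ 2
      ≤ γ ^ 2 * ∑ j, ‖TopologicalSpace.denseSeq (Fin n → ℂ) k j‖ ^ 2 :=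
    ae_all_iff.2 fun k => key _
  filter_upwards [hall] with θ hθ
  refine opNorm_le_of_forall hγ fun x => ?_
  have hc : IsClosed {x : Fin n → ℂ | ∑ i, ‖(T θ *ᵥ x) i‖ ^ 2 ≤ γ ^ 2 * ∑ j, ‖x j‖ ^ 2} := by
    refine isClosed_le ?_ (by fun_prop)
    simp only [Matrix.mulVec, dotProduct]
    fun_prop
  exact (TopologicalSpace.denseRange_denseSeq (Fin n → ℂ)).induction_on
    (p := fun x => ∑ i, ‖(T θ *ᵥ x) i‖ ^ 2 ≤ γ ^ 2 * ∑ j, ‖x j‖ ^ 2) x hc hθ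

end bound

/-! ### The dual value and the absence of a duality gap -/

section dual
variable {dx du dw : ℕ} {S : System dx du dw} {γ : ℝ} {L L' : TransferMatrix (Fin dw) (Fin dw)}
  {T T' : TransferMatrix (Fin dx ⊕ Fin du) (Fin dw)}

/-- The dual function, as a real number: the infimum of the Lagrangian over all closed loops in
`H_2`. -/
def dualValue (S : System dx du dw) (γ : ℝ) (L : TransferMatrix (Fin dw) (Fin dw)) : ℝ :=
  (⨅ T ∈ loops S, wtrace T fun θ => 1 + L θ).toReal - γ ^ 2 * ntrace L

/-- `T` minimizes the Lagrangian of `L` over all closed loops in `H_2`; the gap to the minimum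
controls the distance to `T`. -/
structure IsDualMinimizer (S : System dx du dw) (γ : ℝ) (L : TransferMatrix (Fin dw) (Fin dw))
    (T : TransferMatrix (Fin dx ⊕ Fin du) (Fin dw)) : Prop where
  mem : T ∈ loops S
  bounded : MemH ∞ T
  eq : wtrace T (fun θ => 1 + L θ) = ENNReal.ofReal (dualValue S γ L + γ ^ 2 * ntrace L)
  growth : ∀ T' ∈ loops S, ENNReal.ofReal (dualValue S γ L + γ ^ 2 * ntrace L) +
    ENNReal.ofReal (1 / 2) * h2sq (fun θ => T' θ - T θ) ≤ wtrace T' fun θ => 1 + L θ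

theorem dualValue_add_nonneg : 0 ≤ dualValue S γ L + γ ^ 2 * ntrace L := by
  rw [dualValue, sub_add_cancel]
  exact ENNReal.toReal_nonneg

theorem Regulator.exists_isDualMinimizer (ρ : Regulator S) (hL : L ∈ multipliers dw) (γ : ℝ) :
    ∃ T, IsDualMinimizer S γ L T := by
  obtain ⟨T, hT, hTb, hfin, hgrow⟩ := ρ.exists_minimizer hL
  have h : (⨅ T ∈ loops S, wtrace T fun θ => 1 + L θ) = wtrace T fun θ => 1 + L θ :=
    le_antisymm (iInf₂_le T hT) (le_iInf₂ fun T' hT' => le_self_add.trans (hgrow T' hT'))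
  have e : wtrace T (fun θ => 1 + L θ) = ENNReal.ofReal (dualValue S γ L + γ ^ 2 * ntrace L) := by
    rw [dualValue, sub_add_cancel, h, ENNReal.ofReal_toReal hfin.ne]
  exact ⟨T, hT, hTb, e, fun T' hT' => e ▸ hgrow T' hT'⟩

theorem IsDualMinimizer.le (h : IsDualMinimizer S γ L T) (hT' : T' ∈ loops S) :
    ENNReal.ofReal (dualValue S γ L + γ ^ 2 * ntrace L) ≤ wtrace T' fun θ => 1 + L θ :=
  le_self_add.trans (h.growth T' hT')

theorem h2sq_lt_top_of_mem_loops (hT : T ∈ loops S) : h2sq T < ∞ := by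
  rw [h2sq_eq_sum hT.1.entryAESM]
  exact ENNReal.sum_lt_top.2 fun i _ => ENNReal.sum_lt_top.2 fun j _ =>
    ENNReal.pow_lt_top (hT.1.memLp i j).2

open scoped Matrix.Norms.L2Operator in
/-- Weak duality, in quantitative form: a closed loop with norm less than `γ` shows that
multipliers of large trace have a small dual value. -/
theorem Regulator.dualValue_le (ρ : Regulator S) (hL : L ∈ multipliers dw) (hT : T ∈ loops S)
    {c : ℝ} (hc : ∀ᵐ θ ∂circ, ‖T θ‖ ≤ c) :
    dualValue S γ L ≤ (h2sq T).toReal + (c ^ 2 - γ ^ 2) * ntrace L := by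
  obtain ⟨T', hT'⟩ := ρ.exists_isDualMinimizer hL γ
  have h1 := hT'.le hT
  rw [wtrace_one_add hT.1.entryAESM hL] at h1
  have h2 : ENNReal.ofReal (dualValue S γ L + γ ^ 2 * ntrace L) ≤
      ENNReal.ofReal ((h2sq T).toReal + c ^ 2 * ntrace L) := by
    rw [ENNReal.ofReal_add ENNReal.toReal_nonneg (mul_nonneg (sq_nonneg _) (ntrace_nonneg hL)),
      ENNReal.ofReal_toReal (h2sq_lt_top_of_mem_loops hT).ne]
    exact h1.trans (by gcongr; exact wtrace_le_of_opNorm_le hL hc)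
  have h3 := (ENNReal.ofReal_le_ofReal_iff (add_nonneg ENNReal.toReal_nonneg
    (mul_nonneg (sq_nonneg _) (ntrace_nonneg hL)))).1 h2
  linarith

/-- The minimizer `z` for a convex combination of two dual variables, compared with the minimizer `T`
for the first of them. This is the concavity of the dual function, with the gain `(1 - t) q / 2` from
the quadratic growth of the Lagrangian at `T`. -/
theorem Regulator.exists_mixed_loop (ρ : Regulator S) (hL : L ∈ multipliers dw)
    (hL' : L' ∈ multipliers dw) (hT : IsDualMinimizer S γ L T) {t : ℝ} (ht0 : 0 < t)
    (ht1 : t < 1) : ∃ z ∈ loops S, ∃ q b : ℝ, 0 ≤ q ∧ 0 ≤ b ∧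
      h2sq (fun θ => z θ - T θ) = ENNReal.ofReal q ∧
      wtrace z (fun θ => 1 + L' θ) = ENNReal.ofReal b ∧
      (1 - t) * (dualValue S γ L + q / 2) + t * (b - γ ^ 2 * ntrace L') ≤
        dualValue S γ (fun θ => (1 - t) • L θ + t • L' θ) := by
  have ht' : 0 < 1 - t := by linarith
  have hM := add_smul_mem_multipliers hL hL' ht'.le ht0.le
  obtain ⟨z, hz⟩ := ρ.exists_isDualMinimizer hM γ
  have hzm := hz.mem.1.entryAESM
  have e : (fun θ => 1 + ((1 - t) • L θ + t • L' θ)) =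
      fun θ => (1 - t) • (1 + L θ) + t • (1 + L' θ) := by
    funext θ
    module
  have h1 := hz.eq
  rw [e, wtrace_add_smul hzm (weight_entryAESM hL) (weight_posSemidef hL) (weight_posSemidef hL')
    ht'.le ht0.le] at h1
  have hfin : ∀ {x y : ℝ≥0∞} {s r : ℝ}, 0 < s → ENNReal.ofReal s * x + y = ENNReal.ofReal r →
      x ≠ ∞ := by
    rintro x y s r hs h rfl
    rw [ENNReal.mul_top (by simpa using hs), top_add] at h
    exact ENNReal.ofReal_ne_top h.symm
  have hq : h2sq (fun θ => z θ - T θ) ≠ ∞ := by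
    intro h
    have h2 := hT.growth z hz.mem
    rw [h, ENNReal.mul_top (by simp), add_top, top_le_iff] at h2
    exact hfin ht' h1 h2
  obtain ⟨a, ha0, ha⟩ : ∃ a : ℝ, 0 ≤ a ∧ wtrace z (fun θ => 1 + L θ) = ENNReal.ofReal a :=
    ⟨_, ENNReal.toReal_nonneg, (ENNReal.ofReal_toReal (hfin ht' h1)).symm⟩
  obtain ⟨b, hb0, hb⟩ : ∃ b : ℝ, 0 ≤ b ∧ wtrace z (fun θ => 1 + L' θ) = ENNReal.ofReal b :=
    ⟨_, ENNReal.toReal_nonneg,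
      (ENNReal.ofReal_toReal (hfin ht0 ((add_comm _ _).trans h1))).symm⟩
  obtain ⟨q, hq0, hq⟩ : ∃ q : ℝ, 0 ≤ q ∧ h2sq (fun θ => z θ - T θ) = ENNReal.ofReal q :=
    ⟨_, ENNReal.toReal_nonneg, (ENNReal.ofReal_toReal hq).symm⟩
  refine ⟨z, hz.mem, q, b, hq0, hb0, hq, hb, ?_⟩
  have h2 := hT.growth z hz.mem
  rw [ha, hq, ← ENNReal.ofReal_mul (by norm_num), ← ENNReal.ofReal_add dualValue_add_nonneg
    (by positivity), ENNReal.ofReal_le_ofReal_iff ha0] at h2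
  rw [ha, hb, ← ENNReal.ofReal_mul ht'.le, ← ENNReal.ofReal_mul ht0.le,
    ← ENNReal.ofReal_add (by positivity) (by positivity),
    ENNReal.ofReal_eq_ofReal_iff (by positivity) dualValue_add_nonneg, ntrace_add_smul hL hL'] at h1
  nlinarith [mul_le_mul_of_nonneg_left h2 ht'.le]

/-- The dual function is midpoint concave. -/
theorem Regulator.half_add_half_le_dualValue (ρ : Regulator S) (hL : L ∈ multipliers dw)
    (hL' : L' ∈ multipliers dw) : (dualValue S γ L + dualValue S γ L') / 2 ≤
      dualValue S γ (fun θ => (1 / 2 : ℝ) • (L θ + L' θ)) := by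
  obtain ⟨T, hT⟩ := ρ.exists_isDualMinimizer hL γ
  obtain ⟨T', hT'⟩ := ρ.exists_isDualMinimizer hL' γ
  obtain ⟨z, hz, q, b, hq0, hb0, hq, hb, h⟩ := ρ.exists_mixed_loop hL hL' hT
    (t := 1 / 2) (by norm_num) (by norm_num)
  have h1 := hT'.le hz
  rw [hb, ENNReal.ofReal_le_ofReal_iff hb0] at h1
  have e : (fun θ => (1 - 1 / 2 : ℝ) • L θ + (1 / 2 : ℝ) • L' θ) =
      fun θ => (1 / 2 : ℝ) • (L θ + L' θ) := by
    funext θ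
    module
  rw [e] at h
  linarith

/-- The minimizers of nearly optimal dual variables are close to each other. -/
theorem Regulator.h2sq_sub_le (ρ : Regulator S) (hL : L ∈ multipliers dw)
    (hL' : L' ∈ multipliers dw) (hT : IsDualMinimizer S γ L T) (hT' : IsDualMinimizer S γ L' T')
    {d ε : ℝ} (hd : ∀ L ∈ multipliers dw, dualValue S γ L ≤ d) (h1 : d - ε ≤ dualValue S γ L)
    (h2 : d - ε ≤ dualValue S γ L') :
    h2sq (fun θ => T θ - T' θ) ≤ ENNReal.ofReal (8 * ε) := by
  obtain ⟨z, hz, q, b, hq0, hb0, hq, hb, h⟩ := ρ.exists_mixed_loop hL hL' hT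
    (t := 1 / 2) (by norm_num) (by norm_num)
  have hd' := hd _ (add_smul_mem_multipliers hL hL' (a := 1 - 1 / 2) (b := 1 / 2) (by norm_num)
    (by norm_num))
  have h3 := hT'.growth z hz
  rw [hb] at h3
  have hq' : h2sq (fun θ => z θ - T' θ) ≠ ∞ := by
    intro h
    rw [h, ENNReal.mul_top (by simp), add_top, top_le_iff] at h3
    exact ENNReal.ofReal_ne_top h3
  obtain ⟨q', hq'0, hq'⟩ : ∃ q : ℝ, 0 ≤ q ∧ h2sq (fun θ => z θ - T' θ) = ENNReal.ofReal q :=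
    ⟨_, ENNReal.toReal_nonneg, (ENNReal.ofReal_toReal hq').symm⟩
  rw [hq', ← ENNReal.ofReal_mul (by norm_num), ← ENNReal.ofReal_add dualValue_add_nonneg
    (by positivity), ENNReal.ofReal_le_ofReal_iff hb0] at h3
  have e : (fun θ => T θ - T' θ) = fun θ => (T θ - z θ) + (z θ - T' θ) := by
    funext θ
    abel
  rw [e]
  refine (h2sq_add_le (hT.mem.1.entryAESM.sub hz.1.entryAESM)).trans ?_
  rw [h2sq_sub_comm, hq, hq', ← ENNReal.ofReal_ofNat, ← ENNReal.ofReal_mul (by norm_num),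
    ← ENNReal.ofReal_mul (by norm_num), ← ENNReal.ofReal_add (by positivity) (by positivity)]
  exact ENNReal.ofReal_le_ofReal (by linarith)

/-- The minimizers along a maximizing sequence of dual variables converge to a closed loop whose
Lagrangian is bounded by the dual optimal value, for every dual variable. -/
theorem Regulator.exists_saddle (ρ : Regulator S) {d : ℝ}
    (hd : IsLUB (dualValue S γ '' multipliers dw) d) :
    ∃ T ∈ loops S, ∀ L ∈ multipliers dw,
      wtrace T (fun θ => 1 + L θ) ≤ ENNReal.ofReal (d + γ ^ 2 * ntrace L) := by
  have hle : ∀ L ∈ multipliers dw, dualValue S γ L ≤ d := fun L hL => hd.1 ⟨L, hL, rfl⟩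
  have hex : ∀ k : ℕ, ∃ L ∈ multipliers dw, d - 1 / ((k : ℝ) + 1) ^ 2 ≤ dualValue S γ L := by
    intro k
    obtain ⟨_, ⟨L, hL, rfl⟩, h, -⟩ := hd.exists_between
      (show d - 1 / ((k : ℝ) + 1) ^ 2 < d by
        have : 0 < 1 / ((k : ℝ) + 1) ^ 2 := by positivity
        linarith)
    exact ⟨L, hL, h.le⟩
  choose Λ hΛ hΛd using hex
  choose τ hτ using fun k => ρ.exists_isDualMinimizer (hΛ k) γ
  have hlim : Tendsto (fun k : ℕ => 1 / ((k : ℝ) + 1)) atTop (𝓝 0) :=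
    tendsto_one_div_add_atTop_nhds_zero_nat
  obtain ⟨T, hT2, hTlim⟩ := exists_h2sq_limit (T := τ) (fun k => (hτ k).mem.1.memLp) (by
    intro ε hε
    obtain ⟨N, hN⟩ :=
      (hlim.eventually_lt_const (show 0 < ε / 8 by positivity)).exists_forall_of_atTop
    refine ⟨N, fun k hk k' hk' => ?_⟩
    have hb : ∀ k ≥ N, d - ε / 8 ≤ dualValue S γ (Λ k) := by
      intro k hk
      have h1 := hN k hk
      have h2 : 1 / ((k : ℝ) + 1) ^ 2 ≤ 1 / ((k : ℝ) + 1) := by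
        apply one_div_le_one_div_of_le (by positivity)
        have : (0 : ℝ) ≤ k := k.cast_nonneg
        nlinarith
      linarith [hΛd k]
    refine (ρ.h2sq_sub_le (hΛ k) (hΛ k') (hτ k) (hτ k') hle (hb k hk) (hb k' hk')).trans ?_
    exact ENNReal.ofReal_le_ofReal (by linarith))
  have hTm : EntryAESM T := fun i j => (hT2 i j).1
  have hTl : T ∈ loops S := loops_closed (fun k => (hτ k).mem) hT2 hTlim
  refine ⟨T, hTl, fun L hL => ?_⟩
  -- mix `L` into `Λ k` with weight `1 / (k + 2)`: it tends to zero, but more slowly than the gap of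
  -- `Λ k` to the optimal value
  have ht : ∀ k : ℕ, 0 < 1 / ((k : ℝ) + 2) ∧ 1 / ((k : ℝ) + 2) ≤ 1 / 2 := fun k =>
    ⟨by positivity, one_div_le_one_div_of_le (by norm_num)
      (by linarith [(k.cast_nonneg : (0 : ℝ) ≤ k)])⟩
  choose z hz q b hq0 hb0 hq hb h using fun k => ρ.exists_mixed_loop (hΛ k) hL (hτ k) (ht k).1
    (by linarith [(ht k).2])
  have hd' : ∀ k : ℕ, (1 - 1 / ((k : ℝ) + 2)) * (d - 1 / ((k : ℝ) + 1) ^ 2 + q k / 2)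
      + 1 / ((k : ℝ) + 2) * (b k - γ ^ 2 * ntrace L) ≤ d := fun k => by
    refine le_trans ?_ ((h k).trans (hle _ (add_smul_mem_multipliers (hΛ k) hL
      (by linarith [(ht k).2]) (ht k).1.le)))
    gcongr
    · linarith [(ht k).2]
    · exact hΛd k
  have hε : ∀ k : ℕ, (0 : ℝ) < 1 / ((k : ℝ) + 1) ^ 2 ∧
      1 / ((k : ℝ) + 1) ^ 2 ≤ 2 * (1 / ((k : ℝ) + 1)) * (1 / ((k : ℝ) + 2)) := by
    intro k
    refine ⟨by positivity, ?_⟩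
    have : (0 : ℝ) ≤ k := k.cast_nonneg
    rw [mul_one_div, mul_one_div, div_div, div_le_div_iff₀ (by positivity) (by positivity)]
    nlinarith
  have hlim2 : Tendsto (fun k : ℕ => 1 / ((k : ℝ) + 2)) atTop (𝓝 0) := by
    have := (tendsto_add_atTop_iff_nat (f := fun k : ℕ => 1 / ((k : ℝ) + 1)) 1).2 hlim
    refine this.congr fun k => ?_
    push_cast
    ring
  set g : ℝ := γ ^ 2 * ntrace L with hg
  have hbk : ∀ k : ℕ, b k ≤ d + g + 2 * (1 / ((k : ℝ) + 1)) := by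
    intro k
    have h1 := hd' k
    have h2 := hε k
    have h3 := ht k
    have h4 := hq0 k
    have h5 : 1 / ((k : ℝ) + 2) * b k ≤
        1 / ((k : ℝ) + 2) * (d + g + 2 * (1 / ((k : ℝ) + 1))) := by
      nlinarith [mul_nonneg (show 0 ≤ 1 - 1 / ((k : ℝ) + 2) by linarith) h4,
        mul_nonneg h3.1.le h2.1.le]
    exact le_of_mul_le_mul_left h5 h3.1
  have hqk : ∀ k : ℕ, q k ≤ 4 * (1 / ((k : ℝ) + 2) * (d + g) + 1 / ((k : ℝ) + 1) ^ 2) := by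
    intro k
    have h1 := hd' k
    have h2 := hε k
    have h3 := ht k
    nlinarith [mul_nonneg (show 0 ≤ 1 / 2 - 1 / ((k : ℝ) + 2) by linarith) (hq0 k),
      mul_nonneg h3.1.le h2.1.le, mul_nonneg h3.1.le (hb0 k)]
  have hqlim : Tendsto q atTop (𝓝 0) := by
    refine squeeze_zero hq0 hqk ?_
    have h1 : Tendsto (fun k : ℕ => 1 / ((k : ℝ) + 1) ^ 2) atTop (𝓝 0) := by
      simpa using hlim.pow 2
    simpa using ((hlim2.mul_const (d + g)).add h1).const_mul 4
  have hzlim : Tendsto (fun k => h2sq fun θ => z k θ - T θ) atTop (𝓝 0) := by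
    have h1 : Tendsto (fun k => 2 * ENNReal.ofReal (q k) + 2 * h2sq fun θ => τ k θ - T θ) atTop
        (𝓝 (2 * ENNReal.ofReal 0 + 2 * 0)) :=
      (ENNReal.Tendsto.const_mul (ENNReal.tendsto_ofReal hqlim) (by simp)).add
        (ENNReal.Tendsto.const_mul hTlim (by simp))
    simp only [ENNReal.ofReal_zero, mul_zero, add_zero] at h1
    refine tendsto_of_tendsto_of_tendsto_of_le_of_le tendsto_const_nhds h1 (fun _ => zero_le) ?_
    intro k
    dsimp only
    rw [← hq k]
    have e : (fun θ => z k θ - T θ) = fun θ => (z k θ - τ k θ) + (τ k θ - T θ) := by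
      funext θ
      abel
    rw [e]
    exact h2sq_add_le ((hz k).1.entryAESM.sub (hτ k).mem.1.entryAESM)
  refine wtrace_le_of_tendsto (fun k => (hz k).1.entryAESM) hTm (weight_entryAESM hL) hzlim
    (c := fun k : ℕ => ENNReal.ofReal (d + g + 2 * (1 / ((k : ℝ) + 1)))) ?_ ?_
  · refine ENNReal.tendsto_ofReal ?_
    simpa using (hlim.const_mul 2).const_add (d + g)
  · intro k
    rw [hb k]
    exact ENNReal.ofReal_le_ofReal (hbk k)

open scoped Matrix.Norms.L2Operator in
/-- There is no duality gap: some closed loop with `H_∞` norm at most `γ` has squared `H_2` norm at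
most the supremum of the dual function. -/
theorem Regulator.exists_primal_le (ρ : Regulator S) (hγ : 0 ≤ γ) {d : ℝ}
    (hd : IsLUB (dualValue S γ '' multipliers dw) d) :
    ∃ T ∈ loops S, (∀ᵐ θ ∂circ, ‖T θ‖ ≤ γ) ∧ h2sq T ≤ ENNReal.ofReal d := by
  obtain ⟨T, hT, h⟩ := ρ.exists_saddle hd
  have hTm := hT.1.entryAESM
  refine ⟨T, hT, ?_, ?_⟩
  · refine opNorm_le_of_wtrace_le hTm (hT.1.entrySymm one_le_two) hγ fun L hL => ?_
    have hs : ∀ s : ℝ, 0 < s → ENNReal.ofReal s * wtrace T L ≤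
        ENNReal.ofReal (d + s * (γ ^ 2 * ntrace L)) := by
      intro s hs
      have hsL := smul_mem_multipliers hL hs.le
      have h1 := h _ hsL
      rw [wtrace_one_add hTm hsL, ntrace_smul] at h1
      have h2 : wtrace T (fun θ => s • L θ) = ENNReal.ofReal s * wtrace T L := by
        have := wtrace_add_smul hTm hL.1.entryAESM hL.2 hL.2 hs.le (le_refl (0 : ℝ))
        simpa using this
      rw [h2, mul_left_comm] at h1
      exact le_add_self.trans h1
    have hfin : wtrace T L ≠ ∞ := by
      intro htop
      have := hs 1 one_pos
      rw [htop, ENNReal.mul_top (by simp), top_le_iff] at this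
      exact ENNReal.ofReal_ne_top this
    obtain ⟨w, hw0, hw⟩ : ∃ w : ℝ, 0 ≤ w ∧ wtrace T L = ENNReal.ofReal w :=
      ⟨_, ENNReal.toReal_nonneg, (ENNReal.ofReal_toReal hfin).symm⟩
    have hg0 : 0 ≤ γ ^ 2 * ntrace L := mul_nonneg (sq_nonneg _) (ntrace_nonneg hL)
    rw [hw]
    refine ENNReal.ofReal_le_ofReal ?_
    by_contra hlt
    push Not at hlt
    -- this multiple of `Λ` violates the bound
    have hs2 := hs ((|d| + 1) / (w - γ ^ 2 * ntrace L))
      (div_pos (by positivity) (sub_pos.2 hlt))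
    set s := (|d| + 1) / (w - γ ^ 2 * ntrace L) with hsdef
    have hs0 : 0 < s := div_pos (by positivity) (sub_pos.2 hlt)
    have e : s * (w - γ ^ 2 * ntrace L) = |d| + 1 := div_mul_cancel₀ _ (sub_pos.2 hlt).ne'
    have hd1 : d ≤ |d| := le_abs_self d
    rw [hw, ← ENNReal.ofReal_mul hs0.le] at hs2
    have hsw : 0 < s * w := mul_pos hs0 (hg0.trans_lt hlt)
    have h3 : s * w ≤ d + s * (γ ^ 2 * ntrace L) := 
      (ENNReal.ofReal_le_ofReal_iff'.1 hs2).resolve_right (not_le.2 hsw)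
    linarith
  · have h1 := h _ zero_mem_multipliers
    rw [wtrace_one_add hTm zero_mem_multipliers] at h1
    refine le_self_add.trans (h1.trans (le_of_eq ?_))
    simp [ntrace]

end dual

/-! ### Szegő's extremal functions -/

section szego

theorem fro_unit (M : Matrix Unit Unit ℂ) : fro M = ‖M () ()‖ ^ 2 := by simp [fro]

/-- The minimizer `p` of `∫ |p|² w` among the causal functions with mean one has `|p|² w` constant.
It is close to `1` when the mean of `w` is close to `1`, and small where `w` is large. -/
theorem exists_szego {w : UnitAddCircle → ℝ} (hwm : AEStronglyMeasurable w circ)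
    (hws : ∀ᵐ θ ∂circ, w (-θ) = w θ) (hw1 : ∀ᵐ θ ∂circ, 1 ≤ w θ) {c : ℝ}
    (hwc : ∀ᵐ θ ∂circ, w θ ≤ c) :
    ∃ p : UnitAddCircle → ℂ, HardyFn ∞ p ∧
      (∀ᵐ θ ∂circ, ‖p θ‖ ^ 2 * w θ ≤ ∫ θ, w θ ∂circ) ∧
      h2sq (fun θ => Matrix.of fun _ _ => p θ - 1 : TransferMatrix Unit Unit) ≤
        ENNReal.ofReal (2 * (∫ θ, w θ ∂circ - 1)) := by
  set W : TransferMatrix Unit Unit := fun θ => w θ • 1 with hW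
  have hWent : ∀ θ i j, W θ i j = (w θ : ℂ) := fun θ i j => by simp [hW]
  have hWm : EntryAESM W := fun i j => by
    simp only [hWent]
    exact Complex.continuous_ofReal.comp_aestronglyMeasurable hwm
  have hwi : Integrable w circ := by
    refine Integrable.of_bound hwm c ?_
    filter_upwards [hw1, hwc] with θ h1 h2
    rwa [Real.norm_of_nonneg (by linarith)]
  have hWi : ∀ i j, Integrable (fun θ => W θ i j) circ := fun i j => by
    simp only [hWent]
    exact hwi.ofReal
  have hWp : ∀ᵐ θ ∂circ, (W θ - 1).PosSemidef := by
    filter_upwards [hw1] with θ h1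
    have : W θ - 1 = (w θ - 1) • 1 := by simp only [hW, sub_smul, one_smul]
    rw [this]
    exact Matrix.PosSemidef.one.smul (by linarith)
  have hWp' : ∀ᵐ θ ∂circ, (W θ).PosSemidef := hWp.mono fun _ h => posSemidef_of_sub_one h
  have hWs : EntrySymm W := fun i j => by
    unfold ConjSymm
    filter_upwards [hws] with θ h
    simp [hWent, h]
  have hWq : ∀ (M : Matrix Unit Unit ℂ) θ, wquad M (W θ) = w θ * ‖M () ()‖ ^ 2 := fun M θ => by
    rw [hW, wquad_smul, wquad_one, fro_unit]
  clear_value W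
  have hone : MemH 2 (fun _ => 1 : TransferMatrix Unit Unit) := by
    have := MemH.ofReal (p := 2) one_le_two (1 : Matrix Unit Unit ℝ)
    simpa using this
  have hC2 : ∀ T ∈ {T : TransferMatrix Unit Unit | MemH 2 T ∧ zcoeff (fun θ => T θ () ()) 0 = 1},
      Integrable (fun θ => T θ () ()) circ := fun T hT =>
    (hT.1.memLp () ()).integrable one_le_two
  obtain ⟨T, hT, hTfin, hgrow⟩ := exists_wtrace_minimizer
    (C := {T : TransferMatrix Unit Unit | MemH 2 T ∧ zcoeff (fun θ => T θ () ()) 0 = 1})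
    hWm hWp (fun T hT => hT.1.memLp) (by
      intro T hT T' hT'
      have h1 : MemH 2 fun θ => T θ + T' θ := hT.1.add one_le_two hT'.1
      have h2 := MemH.smul le_rfl (HardyFn.ofReal (1 / 2)) h1
      have e : (fun θ => (((1 / 2 : ℝ) : ℝ) : ℂ) • (T θ + T' θ)) =
          fun θ => (1 / 2 : ℝ) • (T θ + T' θ) := by
        funext θ
        ext i j
        simp
        ring
      rw [e] at h2
      refine ⟨h2, ?_⟩
      have e2 : (fun θ => ((1 / 2 : ℝ) • (T θ + T' θ)) () ()) =
          fun θ => (1 / 2 : ℂ) * (T θ () () + T' θ () ()) := by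
        funext θ
        simp
        ring
      rw [e2, zcoeff_const_mul, zcoeff_add (hC2 T hT) (hC2 T' hT'), hT.2, hT'.2]
      norm_num) (by
      intro T T' hT hT' h
      refine ⟨MemH.of_tendsto (fun k => (hT k).1) hT' h, ?_⟩
      have h1 := tendsto_zcoeff (fun k => (hT k).1.memLp () ()) (hT' () ())
        (eLpNorm_entry_tendsto (fun k => (hT k).1.entryAESM) (fun i j => (hT' i j).1) h () ()) 0
      have h2 : (fun k => zcoeff (fun θ => T k θ () ()) 0) = fun _ => 1 := funext fun k => (hT k).2
      rw [h2] at h1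
      exact tendsto_nhds_unique tendsto_const_nhds h1 |>.symm)
    ⟨fun _ => 1, ⟨hone, by simp [zcoeff_const]⟩, wtrace_lt_top_of_fro_le hWp' hWi
      (ae_of_all _ fun _ => le_rfl)⟩
  obtain ⟨hTH, hT0⟩ := hT
  have hTm := hTH.entryAESM
  obtain ⟨p, hp⟩ : ∃ p : UnitAddCircle → ℂ, p = fun θ => T θ () () := ⟨_, rfl⟩
  have hpH : HardyFn 2 p := hp ▸ (memH_iff one_le_two).1 hTH () ()
  have hp0 : zcoeff p 0 = 1 := hp ▸ hT0
  have hTp : ∀ θ i j, T θ i j = p θ := fun θ i j => by rw [hp]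
  have hTq : ∀ θ, wquad (T θ) (W θ) = w θ * ‖p θ‖ ^ 2 := fun θ => by rw [hWq, hTp]
  have hqi : Integrable (fun θ => w θ * ‖p θ‖ ^ 2) circ := by
    have := integrable_wquad hTm hWm hWp' hTfin
    simpa only [hTq] using this
  have hTW : wtrace T W = ENNReal.ofReal (∫ θ, w θ * ‖p θ‖ ^ 2 ∂circ) := by
    have := integrable_wquad hTm hWm hWp' hTfin
    rw [wtrace_eq_ofReal hWp' this]
    simp only [hTq]
  set κ : ℝ := ∫ θ, w θ * ‖p θ‖ ^ 2 ∂circ with hκ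
  -- the minimizer is orthogonal to its own delays
  have horth : ∀ k : ℕ, 0 < k → ∫ θ, fourier (k : ℤ) θ * ((w θ * ‖p θ‖ ^ 2 : ℝ) : ℂ) ∂circ = 0 := by
    intro k hk
    have hD : MemH 2 fun θ => (fourier (-(k : ℤ)) θ : ℂ) • T θ :=
      MemH.smul le_rfl (HardyFn.fourier_neg k) hTH
    have hDW : wtrace (fun θ => (fourier (-(k : ℤ)) θ : ℂ) • T θ) W < ∞ := by
      have e : wtrace (fun θ => (fourier (-(k : ℤ)) θ : ℂ) • T θ) W = wtrace T W := by
        simp only [wtrace_eq, wquad_smul_left, norm_fourier_apply, one_pow, one_mul]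
      rwa [e]
    have h1 := integral_wform_eq_zero hTm hD.entryAESM hWm hWp' (hTH.entrySymm one_le_two)
      (hD.entrySymm one_le_two) hWs hTfin hDW (by
        intro t
        refine le_self_add.trans (hgrow _ ⟨?_, ?_⟩)
        · have h2 := MemH.smul le_rfl (HardyFn.ofReal t) hD
          have h3 := hTH.add one_le_two h2
          convert h3 using 2
          ext i j
          simp
        · have e : (fun θ => (T θ + t • (fourier (-(k : ℤ)) θ : ℂ) • T θ) () ()) =
              fun θ => p θ + (t : ℂ) * (fourier (-(k : ℤ)) θ * p θ) := by
            funext θ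
            simp [hTp]
          have hpi : Integrable p circ := hpH.memLp.integrable one_le_two
          rw [e, zcoeff_add hpi ((integrable_fourier_mul hpi _).const_mul _), zcoeff_const_mul,
            zcoeff_fourier_mul, hp0, hpH.causal _ (by omega)]
          simp)
    rw [← h1]
    refine integral_congr_ae (ae_of_all _ fun θ => ?_)
    simp only [fourier_conj_smul_wform]
    congr 1
    rw [wform, Matrix.trace]
    simp only [Finset.univ_unique, Finset.sum_singleton, Matrix.diag, Matrix.mul_apply,
      Matrix.conjTranspose_apply, hTp, hWent, Complex.star_def]
    rw [Complex.conj_mul']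
    push_cast
    ring
  have hconst : (fun θ => ((w θ * ‖p θ‖ ^ 2 : ℝ) : ℂ)) =ᵐ[circ] fun _ => (κ : ℂ) := by
    refine ae_eq_of_zcoeff hqi.ofReal (integrable_const _) fun k => ?_
    rw [zcoeff_const]
    rcases lt_trichotomy k 0 with hk | rfl | hk
    · rw [if_neg hk.ne]
      have h1 := zcoeff_conj (fun θ => ((w θ * ‖p θ‖ ^ 2 : ℝ) : ℂ)) k
      simp only [Complex.conj_ofReal] at h1
      have h2 := horth k.natAbs (by omega)
      rw [h1, zcoeff_eq, show -k = (k.natAbs : ℤ) by omega, h2, map_zero]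
    · rw [if_pos rfl, zcoeff_eq]
      simp only [fourier_zero, one_mul]
      exact integral_ofReal (𝕜 := ℂ)
    · rw [if_neg hk.ne', zcoeff_eq]
      have h2 := horth k.natAbs (by omega)
      rwa [show (k.natAbs : ℤ) = k by omega] at h2
  have hgrow1 := hgrow (fun _ => 1) ⟨hone, by simp [zcoeff_const]⟩
  have h1W : wtrace (fun _ => (1 : Matrix Unit Unit ℂ)) W = ENNReal.ofReal (∫ θ, w θ ∂circ) := by
    have e : ∀ θ, wquad (1 : Matrix Unit Unit ℂ) (W θ) = w θ := fun θ => by simp [hWq]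
    rw [wtrace_eq_ofReal hWp' (by simpa only [e] using hwi)]
    simp only [e]
  rw [h1W, hTW] at hgrow1
  have hw0 : 1 ≤ ∫ θ, w θ ∂circ := by
    have : ∫ _ : UnitAddCircle, (1 : ℝ) ∂circ ≤ ∫ θ, w θ ∂circ :=
      integral_mono_ae (integrable_const _) hwi hw1
    simpa using this
  have hκw : κ ≤ ∫ θ, w θ ∂circ :=
    (ENNReal.ofReal_le_ofReal_iff (by linarith)).1 (le_self_add.trans hgrow1)
  have hκ1 : 1 ≤ κ := by
    have hpi : Integrable p circ := hpH.memLp.integrable one_le_two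
    have hri : Integrable (fun θ => (p θ).re) circ := hpi.re
    have h1 : ∫ θ, (p θ).re ∂circ = 1 := by
      have h2 : ∫ θ, p θ ∂circ = 1 := by simpa [zcoeff_eq] using hp0
      have h3 := integral_re (𝕜 := ℂ) hpi
      rw [h2] at h3
      simpa using h3
    have h2 : ∫ θ, 2 * (p θ).re - 1 ∂circ = 1 := by
      rw [integral_sub (hri.const_mul 2) (integrable_const _), integral_const_mul, h1]
      simp only [integral_const, probReal_univ, one_smul]
      norm_num
    rw [← h2, hκ]
    refine integral_mono_ae ((hri.const_mul 2).sub (integrable_const _)) hqi ?_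
    filter_upwards [hw1] with θ h
    have h3 : ‖p θ‖ ^ 2 = (p θ).re ^ 2 + (p θ).im ^ 2 := by
      rw [← Complex.normSq_eq_norm_sq, Complex.normSq_apply]
      ring
    have h4 := sq_nonneg ((p θ).re - 1)
    have h5 := sq_nonneg (p θ).im
    nlinarith [sq_nonneg ‖p θ‖]
  have hpb : ∀ᵐ θ ∂circ, ‖p θ‖ ^ 2 * w θ = κ := by
    filter_upwards [hconst] with θ h
    rw [mul_comm]
    exact_mod_cast h
  refine ⟨p, ⟨?_, hpH.symm, hpH.causal⟩, hpb.mono fun θ h => h.le.trans hκw, ?_⟩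
  · refine (memLp_top_iff_bounded hpH.memLp.1).2 ⟨Real.sqrt κ, ?_⟩
    filter_upwards [hpb, hw1] with θ h h1
    refine Real.le_sqrt_of_sq_le ?_
    nlinarith [sq_nonneg ‖p θ‖]
  · have e : h2sq (fun θ => Matrix.of fun _ _ => p θ - 1 : TransferMatrix Unit Unit) =
        h2sq fun θ => 1 - T θ := by
      simp only [h2sq_eq_lintegral_fro, fro_unit, Matrix.sub_apply, Matrix.of_apply,
        Matrix.one_apply_eq, hTp]
      simp only [norm_sub_rev]
    rw [e]
    have hfin : h2sq (fun θ => 1 - T θ) ≠ ∞ := by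
      intro h
      rw [h, ENNReal.mul_top (by simp), add_top, top_le_iff] at hgrow1
      exact ENNReal.ofReal_ne_top hgrow1
    rw [← ENNReal.ofReal_toReal hfin] at hgrow1 ⊢
    rw [← ENNReal.ofReal_mul (by norm_num), ← ENNReal.ofReal_add (by linarith) (by positivity),
      ENNReal.ofReal_le_ofReal_iff (by linarith)] at hgrow1
    exact ENNReal.ofReal_le_ofReal (by linarith)

end szego

/-! ### A compactness principle for dual variables -/

section komlos
variable {m : Type} [Fintype m] {n : ℕ}

/-- The convexity of `1 / (1 + x)`, with a remainder. -/
theorem one_div_midpoint_le {a b : ℝ} (ha : 0 ≤ a) (hb : 0 ≤ b) :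
    1 / (1 + (a + b) / 2) + 1 / 4 * (1 / (1 + a) - 1 / (1 + b)) ^ 2 ≤
      1 / 2 * (1 / (1 + a)) + 1 / 2 * (1 / (1 + b)) := by
  have h1 : 0 < 1 + a := by linarith
  have h2 : 0 < 1 + b := by linarith
  have h3 : 0 < 1 + (a + b) / 2 := by linarith
  have e : 1 / 2 * (1 / (1 + a)) + 1 / 2 * (1 / (1 + b)) - (1 / (1 + (a + b) / 2) +
      1 / 4 * (1 / (1 + a) - 1 / (1 + b)) ^ 2) =
      (a - b) ^ 2 * (2 * (1 + a) * (1 + b) - (2 + a + b)) /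
        (4 * (1 + a) ^ 2 * (1 + b) ^ 2 * (2 + a + b)) := by
    have h4 : (2 + a + b) ≠ 0 := by linarith
    have h5 : 1 + (a + b) / 2 = (2 + a + b) / 2 := by ring
    rw [h5]
    field_simp
    ring
  have : 0 ≤ (a - b) ^ 2 * (2 * (1 + a) * (1 + b) - (2 + a + b)) /
        (4 * (1 + a) ^ 2 * (1 + b) ^ 2 * (2 + a + b)) := by
    apply div_nonneg
    · apply mul_nonneg (sq_nonneg _)
      nlinarith [mul_nonneg ha hb]
    · positivity
  linarith

/-- In a decreasing sequence of nonempty midpoint-convex sets of dual variables with bounded traces,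
there are elements along which finitely many quadratic forms converge almost everywhere. They
nearly minimize the strictly convex functional `∑ ∫ 1 / (1 + q)`. -/
theorem exists_tendsto_wquad {C : ℕ → Set (TransferMatrix (Fin n) (Fin n))}
    (hC : ∀ k, C k ⊆ multipliers n) (hanti : Antitone C) (hne : ∀ k, (C k).Nonempty)
    (hmid : ∀ k, ∀ L ∈ C k, ∀ L' ∈ C k, (fun θ => (1 / 2 : ℝ) • (L θ + L' θ)) ∈ C k) {M : ℝ}
    (hM : ∀ k, ∀ L ∈ C k, ntrace L ≤ M) {ι : Type} [Fintype ι]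
    (R : ι → Matrix m (Fin n) ℂ) :
    ∃ Λ : ℕ → TransferMatrix (Fin n) (Fin n), (∀ k, Λ k ∈ C k) ∧
      ∀ᵐ θ ∂circ, ∀ i, ∃ r : ℝ, Tendsto (fun k => wquad (R i) (Λ k θ)) atTop (𝓝 r) := by
  obtain ⟨u, hu⟩ : ∃ u : ι → TransferMatrix (Fin n) (Fin n) → UnitAddCircle → ℝ,
    ∀ i L θ, u i L θ = 1 / (1 + wquad (R i) (L θ)) := ⟨_, fun _ _ _ => rfl⟩
  have hu0 : ∀ L ∈ multipliers n, ∀ᵐ θ ∂circ, ∀ i, 0 < u i L θ ∧ u i L θ ≤ 1 := by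
    intro L hL
    filter_upwards [hL.2] with θ h i
    have h1 := wquad_nonneg h (R i)
    rw [hu]
    exact ⟨by positivity, (div_le_one (by linarith)).2 (by linarith)⟩
  have hum : ∀ L ∈ multipliers n, ∀ i, AEStronglyMeasurable (u i L) circ := by
    intro L hL i
    have h1 : AEStronglyMeasurable (fun θ => wquad (R i) (L θ)) circ :=
      (EntryAESM.const (R i)).wquad hL.1.entryAESM
    have h2 : u i L = fun θ => 1 / (1 + wquad (R i) (L θ)) := funext fun θ => hu i L θ
    rw [h2]
    exact ((h1.aemeasurable.const_add 1).const_div 1).aestronglyMeasurable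
  have hui : ∀ L ∈ multipliers n, ∀ i, Integrable (u i L) circ := by
    intro L hL i
    refine Integrable.of_bound (hum L hL i) 1 ?_
    filter_upwards [hu0 L hL] with θ h
    rw [Real.norm_of_nonneg (h i).1.le]
    exact (h i).2
  obtain ⟨ψ, hψ⟩ : ∃ ψ : TransferMatrix (Fin n) (Fin n) → ℝ,
    ∀ L, ψ L = ∑ i, ∫ θ, u i L θ ∂circ := ⟨_, fun _ => rfl⟩
  have hψ0 : ∀ L ∈ multipliers n, 0 ≤ ψ L := by
    intro L hL
    rw [hψ]
    exact Finset.sum_nonneg fun i _ => integral_nonneg_of_ae ((hu0 L hL).mono fun θ h => (h i).1.le)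
  have hψ1 : ∀ L ∈ multipliers n, ψ L ≤ Fintype.card ι := by
    intro L hL
    rw [hψ]
    calc ∑ i, ∫ θ, u i L θ ∂circ ≤ ∑ _i : ι, (1 : ℝ) := by
          refine Finset.sum_le_sum fun i _ => ?_
          have := integral_mono_ae (hui L hL i) (integrable_const 1)
            ((hu0 L hL).mono fun θ h => (h i).2)
          simpa using this
      _ = Fintype.card ι := by simp
  have hgap : ∀ L ∈ multipliers n, ∀ L' ∈ multipliers n,
      ψ (fun θ => (1 / 2 : ℝ) • (L θ + L' θ)) +
        1 / 4 * ∑ i, ∫ θ, (u i L θ - u i L' θ) ^ 2 ∂circ ≤ 1 / 2 * ψ L + 1 / 2 * ψ L' := by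
    intro L hL L' hL'
    have hN : (fun θ => (1 / 2 : ℝ) • (L θ + L' θ)) ∈ multipliers n := by
      have := add_smul_mem_multipliers hL hL' (a := 1 / 2) (b := 1 / 2) (by norm_num) (by norm_num)
      simpa only [smul_add] using this
    simp only [hψ, Finset.mul_sum]
    rw [← Finset.sum_add_distrib, ← Finset.sum_add_distrib]
    refine Finset.sum_le_sum fun i _ => ?_
    have hsq : Integrable (fun θ => (u i L θ - u i L' θ) ^ 2) circ := by
      refine Integrable.of_bound (((hum L hL i).sub (hum L' hL' i)).pow 2) 1 ?_
      filter_upwards [hu0 L hL, hu0 L' hL'] with θ h h'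
      have h1 := h i
      have h2 := h' i
      rw [Real.norm_of_nonneg (sq_nonneg _)]
      nlinarith
    rw [← integral_const_mul, ← integral_const_mul, ← integral_const_mul,
      ← integral_add (hui _ hN i) (hsq.const_mul _),
      ← integral_add ((hui L hL i).const_mul _) ((hui L' hL' i).const_mul _)]
    refine integral_mono_ae ((hui _ hN i).add (hsq.const_mul _))
      (((hui L hL i).const_mul _).add ((hui L' hL' i).const_mul _)) ?_
    filter_upwards [hL.2, hL'.2] with θ h h'
    have h1 := one_div_midpoint_le (wquad_nonneg h (R i)) (wquad_nonneg h' (R i))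
    simp only [hu, wquad_smul, wquad_add]
    rwa [show 1 / 2 * (wquad (R i) (L θ) + wquad (R i) (L' θ)) =
      (wquad (R i) (L θ) + wquad (R i) (L' θ)) / 2 by ring]
  obtain ⟨a, ha⟩ : ∃ a : ℕ → ℝ, ∀ k, a k = sInf (ψ '' C k) := ⟨_, fun _ => rfl⟩
  have hbdd : ∀ k, BddBelow (ψ '' C k) := fun k =>
    ⟨0, by rintro _ ⟨L, hL, rfl⟩; exact hψ0 L (hC k hL)⟩
  have hale : ∀ k, ∀ L ∈ C k, a k ≤ ψ L := fun k L hL => ha k ▸ csInf_le (hbdd k) ⟨L, hL, rfl⟩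
  have hamono : Monotone a := by
    intro k k' hkk'
    rw [ha k']
    refine le_csInf ((hne k').image ψ) ?_
    rintro _ ⟨L, hL, rfl⟩
    exact hale k L (hanti hkk' hL)
  have habd : BddAbove (Set.range a) := by
    refine ⟨Fintype.card ι, ?_⟩
    rintro _ ⟨k, rfl⟩
    obtain ⟨L, hL⟩ := hne k
    exact (hale k L hL).trans (hψ1 L (hC k hL))
  have halim := tendsto_atTop_ciSup hamono habd
  set A := ⨆ k, a k with hA
  have haA : ∀ k, a k ≤ A := fun k => le_ciSup habd k
  have hex : ∀ k : ℕ, ∃ L ∈ C k, ψ L < a k + 1 / ((k : ℝ) + 1) := by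
    intro k
    obtain ⟨_, ⟨L, hL, rfl⟩, h⟩ := exists_lt_of_csInf_lt ((hne k).image ψ)
      (show sInf (ψ '' C k) < a k + 1 / ((k : ℝ) + 1) by
        rw [← ha k]
        have : 0 < 1 / ((k : ℝ) + 1) := by positivity
        linarith)
    exact ⟨L, hL, h⟩
  choose Λ hΛ hΛψ using hex
  -- the functions `1 / (1 + q)` form a Cauchy sequence in `L₂`
  obtain ⟨T, hT⟩ : ∃ T : ℕ → TransferMatrix ι Unit, ∀ k θ i j, T k θ i j = (u i (Λ k) θ : ℂ) :=
    ⟨fun k θ => Matrix.of fun i _ => (u i (Λ k) θ : ℂ), fun _ _ _ _ => rfl⟩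
  have hTm : ∀ k i j, MemLp (fun θ => T k θ i j) 2 circ := by
    intro k i j
    simp only [hT]
    refine MemLp.of_bound (Complex.continuous_ofReal.comp_aestronglyMeasurable
      (hum _ (hC k (hΛ k)) i)) 1 ?_
    filter_upwards [hu0 _ (hC k (hΛ k))] with θ h
    rw [Complex.norm_real, Real.norm_of_nonneg (h i).1.le]
    exact (h i).2
  have hdist : ∀ k k', h2sq (fun θ => T k θ - T k' θ) =
      ENNReal.ofReal (∑ i, ∫ θ, (u i (Λ k) θ - u i (Λ k') θ) ^ 2 ∂circ) := by
    intro k k'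
    have hsq : ∀ i, Integrable (fun θ => (u i (Λ k) θ - u i (Λ k') θ) ^ 2) circ := by
      intro i
      refine Integrable.of_bound
        (((hum _ (hC k (hΛ k)) i).sub (hum _ (hC k' (hΛ k')) i)).pow 2) 1 ?_
      filter_upwards [hu0 _ (hC k (hΛ k)), hu0 _ (hC k' (hΛ k'))] with θ h h'
      have h1 := h i
      have h2 := h' i
      rw [Real.norm_of_nonneg (sq_nonneg _)]
      nlinarith
    rw [← integral_finsetSum _ fun i _ => hsq i, ofReal_integral_eq_lintegral_ofReal
      (integrable_finsetSum _ fun i _ => hsq i)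
      (ae_of_all _ fun θ => Finset.sum_nonneg fun i _ => sq_nonneg _), h2sq_eq_lintegral_fro]
    refine lintegral_congr fun θ => ?_
    congr 1
    rw [fro]
    refine Finset.sum_congr rfl fun i _ => ?_
    simp only [Finset.univ_unique, Finset.sum_singleton, Matrix.sub_apply, hT]
    rw [← Complex.ofReal_sub, Complex.norm_real, Real.norm_eq_abs, sq_abs]
  obtain ⟨T', hT'2, hT'lim⟩ := exists_h2sq_limit hTm (by
    intro ε hε
    have hlim : Tendsto (fun k : ℕ => 2 * (A - a k) + 4 * (1 / ((k : ℝ) + 1))) atTop (𝓝 0) := by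
      have h1 := ((tendsto_const_nhds (x := A)).sub halim).const_mul 2
      have h2 := (tendsto_one_div_add_atTop_nhds_zero_nat (𝕜 := ℝ)).const_mul 4
      simpa using h1.add h2
    obtain ⟨N, hN⟩ := (hlim.eventually_lt_const hε).exists_forall_of_atTop
    have hsymm : ∀ k k', k ≤ k' → N ≤ k → h2sq (fun θ => T k θ - T k' θ) ≤ ENNReal.ofReal ε := by
      intro k k' hkk' hk
      rw [hdist]
      refine ENNReal.ofReal_le_ofReal ?_
      have h1 := hgap _ (hC k (hΛ k)) _ (hC k' (hΛ k'))
      have h2 := hale k _ (hmid k _ (hΛ k) _ (hanti hkk' (hΛ k')))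
      have h3 := hΛψ k
      have h4 := hΛψ k'
      have h5 := haA k'
      have h6 := hN k hk
      have h7 : 1 / ((k' : ℝ) + 1) ≤ 1 / ((k : ℝ) + 1) :=
        one_div_le_one_div_of_le (by positivity) (by
          have : (k : ℝ) ≤ k' := by exact_mod_cast hkk'
          linarith)
      linarith
    refine ⟨N, fun k hk k' hk' => ?_⟩
    rcases le_total k k' with h | h
    · exact hsymm k k' h hk
    · rw [h2sq_sub_comm]
      exact hsymm k' k h hk')
  obtain ⟨φ, hφ, hlim⟩ := exists_subseq_tendsto_ae (fun k i j => (hTm k i j).1)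
    (fun i j => (hT'2 i j).1) hT'lim
  refine ⟨fun k => Λ (φ k), fun k => hanti (hφ.id_le k) (hΛ (φ k)), ?_⟩
  -- the limit of `1 / (1 + q)` is positive by Fatou's lemma
  have hfatou : ∀ i, ∀ᵐ θ ∂circ,
      liminf (fun k => ENNReal.ofReal (wquad (R i) (Λ (φ k) θ))) atTop < ∞ := by
    intro i
    have hm : ∀ k, AEMeasurable (fun θ => ENNReal.ofReal (wquad (R i) (Λ (φ k) θ))) circ := fun k =>
      ((EntryAESM.const (R i)).wquad (hC _ (hΛ (φ k))).1.entryAESM).aemeasurable.ennreal_ofReal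
    refine ae_lt_top' ?_ (ne_of_lt ?_)
    · simp only [liminf_eq_iSup_iInf_of_nat']
      exact AEMeasurable.iSup fun k => AEMeasurable.iInf fun l => hm (l + k)
    refine (lintegral_liminf_le' hm).trans_lt ?_
    have hb : ∀ k, ∫⁻ θ, ENNReal.ofReal (wquad (R i) (Λ (φ k) θ)) ∂circ ≤
        ENNReal.ofReal (fro (R i) * M) := by
      intro k
      have hL := hC _ (hΛ (φ k))
      have h1 : 0 ≤ᵐ[circ] fun θ => fro (R i) * (Λ (φ k) θ).trace.re :=
        hL.2.mono fun θ h => mul_nonneg (fro_nonneg _) (trace_re_nonneg h)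
      calc ∫⁻ θ, ENNReal.ofReal (wquad (R i) (Λ (φ k) θ)) ∂circ
          ≤ ∫⁻ θ, ENNReal.ofReal (fro (R i) * (Λ (φ k) θ).trace.re) ∂circ :=
            lintegral_mono_ae (hL.2.mono fun θ h => ENNReal.ofReal_le_ofReal (wquad_le_fro_mul h _))
        _ = ENNReal.ofReal (∫ θ, fro (R i) * (Λ (φ k) θ).trace.re ∂circ) :=
            (ofReal_integral_eq_lintegral_ofReal ((integrable_trace hL).const_mul _) h1).symm
        _ ≤ ENNReal.ofReal (fro (R i) * M) := by
            rw [integral_const_mul]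
            exact ENNReal.ofReal_le_ofReal
              (mul_le_mul_of_nonneg_left (hM _ _ (hΛ (φ k))) (fro_nonneg _))
    refine lt_of_le_of_lt ?_ (ENNReal.ofReal_lt_top (r := fro (R i) * M))
    refine liminf_le_of_frequently_le' (Frequently.of_forall hb)
  have hpos : ∀ᵐ θ ∂circ, ∀ k i, 0 < u i (Λ (φ k)) θ ∧ u i (Λ (φ k)) θ ≤ 1 :=
    ae_all_iff.2 fun k => hu0 _ (hC _ (hΛ (φ k)))
  filter_upwards [hlim, ae_all_iff.2 hfatou, hpos] with θ h1 h2 h3 i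
  have h4 : Tendsto (fun k => u i (Λ (φ k)) θ) atTop (𝓝 (T' θ i ()).re) := by
    have := (Complex.continuous_re.tendsto _).comp (h1 i ())
    simpa [Function.comp_def, hT] using this
  have hinv : ∀ k, wquad (R i) (Λ (φ k) θ) = (u i (Λ (φ k)) θ)⁻¹ - 1 := fun k => by
    rw [hu, one_div, inv_inv]
    ring
  simp only [hinv]
  refine ⟨_, (h4.inv₀ ?_).sub_const 1⟩
  intro h0
  rw [h0] at h4
  have h5 : Tendsto (fun k => (u i (Λ (φ k)) θ)⁻¹) atTop atTop :=
    (tendsto_nhdsWithin_iff.2 ⟨h4, Eventually.of_forall fun k => (h3 k i).1⟩).inv_tendsto_nhdsGT_zero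
  have h6 : Tendsto (fun k => ENNReal.ofReal (wquad (R i) (Λ (φ k) θ))) atTop (𝓝 ∞) := by
    simp only [hinv]
    exact ENNReal.tendsto_ofReal_atTop.comp (tendsto_atTop_add_const_right _ (-1) h5)
  exact (h2 i).ne h6.liminf_eq

end komlos

section limits
variable {m : Type} [Fintype m] {n : ℕ}

theorem posSemidef_of_tendsto {W : ℕ → Matrix (Fin n) (Fin n) ℂ} {W' : Matrix (Fin n) (Fin n) ℂ}
    (hW : ∀ k, (W k).PosSemidef) (h : ∀ i j, Tendsto (fun k => W k i j) atTop (𝓝 (W' i j))) :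
    W'.PosSemidef := by
  refine Matrix.PosSemidef.of_dotProduct_mulVec_nonneg ?_ fun x => ?_
  · refine Matrix.IsHermitian.ext fun i j => ?_
    refine tendsto_nhds_unique ((continuous_star.tendsto _).comp (h j i)) ?_
    refine (h i j).congr fun k => ?_
    exact ((hW k).1.apply i j).symm
  · have h1 : Tendsto (fun k => star x ⬝ᵥ W k *ᵥ x) atTop (𝓝 (star x ⬝ᵥ W' *ᵥ x)) := by
      simp only [dotProduct, Matrix.mulVec]
      exact tendsto_finsetSum _ fun i _ => tendsto_const_nhds.mul
        (tendsto_finsetSum _ fun j _ => (h i j).mul tendsto_const_nhds)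
    exact ge_of_tendsto' h1 fun k => (hW k).dotProduct_mulVec_nonneg x

/-- The row vector `eᵢ + c eⱼ`; the quadratic forms of these vectors determine a Hermitian matrix by
polarization. -/
def polarVector (i j : Fin n) (c : ℂ) : Matrix Unit (Fin n) ℂ :=
  Matrix.of fun _ k => (if k = i then 1 else 0) + if k = j then c else 0

theorem wquad_polarVector {W : Matrix (Fin n) (Fin n) ℂ} (hW : W.IsHermitian) (i j : Fin n)
    (c : ℂ) : wquad (polarVector i j c) W =
      (W i i).re + ‖c‖ ^ 2 * (W j j).re + 2 * (conj c * W i j).re := by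
  have h1 : wquad (polarVector i j c) W =
      (polarVector i j c * W * (polarVector i j c)ᴴ).trace.re := by
    rw [wquad, Matrix.mul_assoc, Matrix.trace_mul_comm]
  have h2 : (polarVector i j c * W * (polarVector i j c)ᴴ).trace =
      W i i + c * W j i + (W i j + c * W j j) * conj c := by
    simp [polarVector, Matrix.trace, Matrix.mul_apply, add_mul, mul_add, Finset.sum_add_distrib,
      apply_ite conj]
  have h3 : W j i = conj (W i j) := (hW.apply j i).symm
  have h4 : ‖c‖ ^ 2 = c.re ^ 2 + c.im ^ 2 := by
    rw [← Complex.normSq_eq_norm_sq, Complex.normSq_apply]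
    ring
  have h5 : (W j j).im = 0 := Complex.conj_eq_iff_im.1 (hW.apply j j)
  rw [h1, h2, h3, h4]
  simp only [Complex.add_re, Complex.mul_re, Complex.conj_re, Complex.conj_im, Complex.add_im,
    Complex.mul_im, h5]
  ring

/-- In a decreasing sequence of nonempty midpoint-convex sets of dual variables with bounded traces,
there are elements that converge almost everywhere to a dual variable. -/
theorem exists_tendsto_multipliers {C : ℕ → Set (TransferMatrix (Fin n) (Fin n))}
    (hC : ∀ k, C k ⊆ multipliers n) (hanti : Antitone C) (hne : ∀ k, (C k).Nonempty)
    (hmid : ∀ k, ∀ L ∈ C k, ∀ L' ∈ C k, (fun θ => (1 / 2 : ℝ) • (L θ + L' θ)) ∈ C k) {M : ℝ}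
    (hM : ∀ k, ∀ L ∈ C k, ntrace L ≤ M) :
    ∃ Λ : ℕ → TransferMatrix (Fin n) (Fin n), (∀ k, Λ k ∈ C k) ∧ ∃ L ∈ multipliers n,
      ∀ᵐ θ ∂circ, ∀ i j, Tendsto (fun k => Λ k θ i j) atTop (𝓝 (L θ i j)) := by
  obtain ⟨Λ, hΛ, hlim⟩ := exists_tendsto_wquad hC hanti hne hmid hM
    (ι := Fin n × Fin n × Fin 3) fun x => polarVector x.1 x.2.1 (![0, 1, Complex.I] x.2.2)
  have hΛm := fun k => hC k (hΛ k)
  obtain ⟨L, hLdef⟩ : ∃ L : TransferMatrix (Fin n) (Fin n),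
    ∀ θ i j, L θ i j = limUnder atTop fun k => Λ k θ i j :=
    ⟨fun θ => Matrix.of fun i j => limUnder atTop fun k => Λ k θ i j, fun _ _ _ => rfl⟩
  have hpsd : ∀ᵐ θ ∂circ, ∀ k, (Λ k θ).PosSemidef := ae_all_iff.2 fun k => (hΛm k).2
  have hL : ∀ᵐ θ ∂circ, ∀ i j, Tendsto (fun k => Λ k θ i j) atTop (𝓝 (L θ i j)) := by
    filter_upwards [hlim, hpsd] with θ h hp i j
    rw [hLdef]
    refine tendsto_nhds_limUnder ?_
    have hq : ∀ i j c, ∀ k, wquad (polarVector i j c) (Λ k θ) =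
        (Λ k θ i i).re + ‖c‖ ^ 2 * (Λ k θ j j).re + 2 * (conj c * Λ k θ i j).re :=
      fun i j c k => wquad_polarVector (hp k).1 i j c
    have hd : ∀ i, ∃ r : ℝ, Tendsto (fun k => (Λ k θ i i).re) atTop (𝓝 r) := by
      intro i
      obtain ⟨r, hr⟩ := h (i, i, 0)
      refine ⟨r, hr.congr fun k => ?_⟩
      rw [hq]
      simp
    obtain ⟨a, ha⟩ := hd i
    obtain ⟨b, hb⟩ := hd j
    obtain ⟨r, hr⟩ := h (i, j, 1)
    obtain ⟨s, hs⟩ := h (i, j, 2)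
    have hre : Tendsto (fun k => (Λ k θ i j).re) atTop (𝓝 ((r - a - b) / 2)) := by
      refine (((hr.sub ha).sub hb).div_const 2).congr fun k => ?_
      rw [hq]
      simp
      ring
    have him : Tendsto (fun k => (Λ k θ i j).im) atTop (𝓝 ((s - a - b) / 2)) := by
      refine (((hs.sub ha).sub hb).div_const 2).congr fun k => ?_
      rw [hq]
      simp
      ring
    refine ⟨(((r - a - b) / 2 : ℝ) : ℂ) + (((s - a - b) / 2 : ℝ) : ℂ) * Complex.I, ?_⟩
    refine (((Complex.continuous_ofReal.tendsto _).comp hre).add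
      (((Complex.continuous_ofReal.tendsto _).comp him).mul_const Complex.I)).congr fun k => ?_
    exact Complex.re_add_im _
  have hLm : EntryAESM L := fun i j =>
    aestronglyMeasurable_of_tendsto_ae atTop (fun k => (hΛm k).1.entryAESM i j)
      (hL.mono fun θ h => h i j)
  -- the limit is integrable because its entries are bounded by its trace
  refine ⟨Λ, hΛ, L, ⟨(memL_iff le_rfl).2 fun i j => ⟨?_, ?_⟩, ?_⟩, hL⟩
  · refine memLp_one_iff_integrable.2 ⟨hLm i j, ?_⟩
    have hm : ∀ k, AEMeasurable (fun θ => ‖Λ k θ i j‖ₑ) circ := fun k =>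
      ((hΛm k).1.entryAESM i j).enorm
    calc ∫⁻ θ, ‖L θ i j‖ₑ ∂circ = ∫⁻ θ, liminf (fun k => ‖Λ k θ i j‖ₑ) atTop ∂circ :=
          lintegral_congr_ae (hL.mono fun θ h => (h i j).enorm.liminf_eq.symm)
      _ ≤ liminf (fun k => ∫⁻ θ, ‖Λ k θ i j‖ₑ ∂circ) atTop := lintegral_liminf_le' hm
      _ ≤ ENNReal.ofReal M := by
          refine liminf_le_of_frequently_le' (Frequently.of_forall fun k => ?_)
          calc ∫⁻ θ, ‖Λ k θ i j‖ₑ ∂circ ≤ ∫⁻ θ, ENNReal.ofReal (Λ k θ).trace.re ∂circ :=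
                lintegral_mono_ae ((hΛm k).2.mono fun θ h => by
                  rw [← ofReal_norm]
                  exact ENNReal.ofReal_le_ofReal (norm_apply_le_trace h i j))
            _ = ENNReal.ofReal (ntrace (Λ k)) :=
                (ofReal_integral_eq_lintegral_ofReal (integrable_trace (hΛm k))
                  ((hΛm k).2.mono fun θ h => trace_re_nonneg h)).symm
            _ ≤ ENNReal.ofReal M := ENNReal.ofReal_le_ofReal (hM k _ (hΛ k))
      _ < ∞ := ENNReal.ofReal_lt_top
  · exact EntrySymm.of_tendsto (fun k => (hΛm k).1.entrySymm le_rfl) hL i j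
  · filter_upwards [hL, hpsd] with θ h hp
    exact posSemidef_of_tendsto hp h

theorem abs_wquad_le (M : Matrix m (Fin n) ℂ) (E : Matrix (Fin n) (Fin n) ℂ) :
    |wquad M E| ≤ fro M * ∑ i, ∑ j, ‖E i j‖ := by
  have h1 : ‖(Mᴴ * M * E).trace‖ ≤ fro M * ∑ i, ∑ j, ‖E i j‖ := by
    rw [Finset.sum_comm, Finset.mul_sum, Matrix.trace]
    refine (norm_sum_le _ _).trans (Finset.sum_le_sum fun i _ => ?_)
    rw [Finset.mul_sum, Matrix.diag, Matrix.mul_apply]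
    refine (norm_sum_le _ _).trans (Finset.sum_le_sum fun j _ => ?_)
    rw [norm_mul]
    refine mul_le_mul_of_nonneg_right ?_ (norm_nonneg _)
    rw [← trace_conjTranspose_mul_self_re]
    exact norm_apply_le_trace (Matrix.posSemidef_conjTranspose_mul_self M) i j
  exact (Complex.abs_re_le_norm _).trans h1

theorem abs_trace_re_le (E : Matrix (Fin n) (Fin n) ℂ) : |E.trace.re| ≤ ∑ i, ∑ j, ‖E i j‖ := by
  refine (Complex.abs_re_le_norm _).trans ((norm_sum_le _ _).trans
    (Finset.sum_le_sum fun i _ => ?_))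
  exact Finset.single_le_sum (f := fun j => ‖E i j‖) (fun _ _ => norm_nonneg _) (Finset.mem_univ i)

end limits

/-! ### Attainment in the dual problem -/

section attainment
variable {dx du dw : ℕ} {S : System dx du dw} {γ : ℝ} {L : TransferMatrix (Fin dw) (Fin dw)}
  {T T₀ : TransferMatrix (Fin dx ⊕ Fin du) (Fin dw)}

/-- The density of the Lagrangian with respect to frequency. -/
def density (γ : ℝ) (T : TransferMatrix (Fin dx ⊕ Fin du) (Fin dw))
    (L : TransferMatrix (Fin dw) (Fin dw)) (θ : UnitAddCircle) : ℝ :=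
  fro (T θ) + (wquad (T θ) (L θ) - γ ^ 2 * (L θ).trace.re)

theorem density_integral (hT : MemH ∞ T) (hL : L ∈ multipliers dw) :
    Integrable (density γ T L) circ ∧ wtrace T (fun θ => 1 + L θ) =
      ENNReal.ofReal ((∫ θ, density γ T L θ ∂circ) + γ ^ 2 * ntrace L) ∧
    0 ≤ (∫ θ, density γ T L θ ∂circ) + γ ^ 2 * ntrace L := by
  obtain ⟨c, -, hc⟩ := hT.exists_fro_le
  have hW := weight_posSemidef hL
  have hfin := wtrace_lt_top_of_fro_le hW (weight_integrable hL) hc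
  have hi := integrable_wquad hT.entryAESM (weight_entryAESM hL) hW hfin
  have e : density γ T L = fun θ => wquad (T θ) (1 + L θ) - γ ^ 2 * (L θ).trace.re := by
    funext θ
    rw [density, wquad_add, wquad_one]
    ring
  have hs : (∫ θ, density γ T L θ ∂circ) + γ ^ 2 * ntrace L =
      ∫ θ, wquad (T θ) (1 + L θ) ∂circ := by
    rw [e, integral_sub hi ((integrable_trace hL).const_mul _), integral_const_mul, ntrace]
    ring
  refine ⟨?_, ?_, ?_⟩
  · rw [e]
    exact hi.sub ((integrable_trace hL).const_mul _)
  · rw [hs, wtrace_eq_ofReal hW hi]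
  · rw [hs]
    exact integral_nonneg_of_ae (hW.mono fun θ h => wquad_nonneg h _)

theorem Regulator.dualValue_le_integral (ρ : Regulator S) (hT : T ∈ loops S) (hb : MemH ∞ T)
    (hL : L ∈ multipliers dw) : dualValue S γ L ≤ ∫ θ, density γ T L θ ∂circ := by
  obtain ⟨T', hT'⟩ := ρ.exists_isDualMinimizer hL γ
  obtain ⟨-, h1, h2⟩ := density_integral (γ := γ) hb hL
  have h3 := hT'.le hT
  rw [h1, ENNReal.ofReal_le_ofReal_iff h2] at h3
  linarith

theorem IsDualMinimizer.integral_eq (h : IsDualMinimizer S γ L T) (hL : L ∈ multipliers dw) :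
    ∫ θ, density γ T L θ ∂circ = dualValue S γ L := by
  obtain ⟨-, h1, h2⟩ := density_integral (γ := γ) h.bounded hL
  have h3 := h.eq
  rw [h1, ENNReal.ofReal_eq_ofReal_iff h2 dualValue_add_nonneg] at h3
  linarith

open scoped Matrix.Norms.L2Operator in
/-- The dual function is upper semicontinuous along sequences of dual variables that converge
almost everywhere. Mass may escape to the small sets where the convergence is slow. There, a Szegő
function moves the minimizer `T` of the limit towards the strictly feasible `T₀`, so that this mass
only lowers the Lagrangian. -/
theorem Regulator.le_dualValue_of_tendsto (ρ : Regulator S) (hT₀ : T₀ ∈ loops S) {γ₀ : ℝ}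
    (hγ₀ : 0 ≤ γ₀) (hγ : γ₀ < γ) (hT₀γ : ∀ᵐ θ ∂circ, ‖T₀ θ‖ ≤ γ₀)
    {Λ : ℕ → TransferMatrix (Fin dw) (Fin dw)} (hΛ : ∀ k, Λ k ∈ multipliers dw)
    (hL : L ∈ multipliers dw)
    (hlim : ∀ᵐ θ ∂circ, ∀ i j, Tendsto (fun k => Λ k θ i j) atTop (𝓝 (L θ i j)))
    {a : ℕ → ℝ} {d : ℝ} (ha : Tendsto a atTop (𝓝 d)) (haΛ : ∀ k, a k ≤ dualValue S γ (Λ k)) :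
    d ≤ dualValue S γ L := by
  obtain ⟨T, hT⟩ := ρ.exists_isDualMinimizer hL γ
  obtain ⟨τ, hτ0, hτ⟩ := hT.bounded.exists_opNorm_le
  have hT₀b : MemH ∞ T₀ := hT₀.1.top_of_opNorm_le hT₀γ
  -- the size of the weight that makes the Szegő function small enough on the exceptional sets
  obtain ⟨c, hc0, hc⟩ : ∃ c : ℝ, 0 ≤ c ∧ 2 * (τ + γ₀) ^ 2 ≤ (1 + c) * (γ - γ₀) ^ 2 := by
    have h1 : 0 < (γ - γ₀) ^ 2 := by
      have : 0 < γ - γ₀ := sub_pos.2 hγ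
      positivity
    refine ⟨2 * (τ + γ₀) ^ 2 / (γ - γ₀) ^ 2, by positivity, ?_⟩
    rw [add_mul, div_mul_cancel₀ _ h1.ne']
    linarith
  obtain ⟨F, hF⟩ : ∃ F : ℝ, F = (γ₀ + 2 * (τ + γ₀)) ^ 2 * fro (1 : Matrix (Fin dw) (Fin dw) ℂ) :=
    ⟨_, rfl⟩
  have hF0 : 0 ≤ F := hF ▸ mul_nonneg (sq_nonneg _) (fro_nonneg _)
  refine le_of_forall_pos_le_add fun ε hε => ?_
  obtain ⟨δ, hδ, hδε⟩ : ∃ δ : ℝ, 0 < δ ∧ (F + γ ^ 2) * δ ≤ ε := by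
    refine ⟨ε / (F + γ ^ 2 + 1), by positivity, ?_⟩
    rw [mul_div_assoc', div_le_iff₀ (by positivity)]
    nlinarith
  -- the exceptional sets are `{δ < f k}`
  obtain ⟨f, hf⟩ : ∃ f : ℕ → UnitAddCircle → ℝ, ∀ k θ, f k θ = ∑ i, ∑ j, ‖Λ k θ i j - L θ i j‖ :=
    ⟨_, fun _ _ => rfl⟩
  have hfm : ∀ k, AEStronglyMeasurable (f k) circ := by
    intro k
    have e : f k = fun θ => ∑ i, ∑ j, ‖Λ k θ i j - L θ i j‖ := funext (hf k)
    rw [e]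
    exact Finset.aestronglyMeasurable_fun_sum _ fun i _ =>
      Finset.aestronglyMeasurable_fun_sum _ fun j _ =>
        (((hΛ k).1.entryAESM i j).sub (hL.1.entryAESM i j)).norm
  have hfs : ∀ k, ∀ᵐ θ ∂circ, f k (-θ) = f k θ := by
    intro k
    have h1 : ∀ᵐ θ ∂circ, ∀ i j, Λ k (-θ) i j = conj (Λ k θ i j) :=
      ae_all_iff.2 fun i => ae_all_iff.2 fun j => (hΛ k).1.entrySymm le_rfl i j
    have h2 : ∀ᵐ θ ∂circ, ∀ i j, L (-θ) i j = conj (L θ i j) :=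
      ae_all_iff.2 fun i => ae_all_iff.2 fun j => hL.1.entrySymm le_rfl i j
    filter_upwards [h1, h2] with θ h1 h2
    simp only [hf, h1, h2, ← map_sub, RCLike.norm_conj]
  have hf0 : ∀ᵐ θ ∂circ, Tendsto (fun k => f k θ) atTop (𝓝 0) := by
    filter_upwards [hlim] with θ h
    simp only [hf]
    have : Tendsto (fun k => ∑ i, ∑ j, ‖Λ k θ i j - L θ i j‖) atTop
        (𝓝 (∑ _i : Fin dw, ∑ _j : Fin dw, 0)) :=
      tendsto_finsetSum _ fun i _ => tendsto_finsetSum _ fun j _ =>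
        tendsto_iff_norm_sub_tendsto_zero.1 (h i j)
    simpa using this
  obtain ⟨w, hw⟩ : ∃ w : ℕ → UnitAddCircle → ℝ, ∀ k θ, w k θ = if δ < f k θ then 1 + c else 1 :=
    ⟨_, fun _ _ => rfl⟩
  have hwm : ∀ k, AEStronglyMeasurable (w k) circ := by
    intro k
    have h1 : Measurable fun x : ℝ => if δ < x then 1 + c else 1 :=
      Measurable.ite measurableSet_Ioi measurable_const measurable_const
    have e : w k = (fun x : ℝ => if δ < x then 1 + c else 1) ∘ f k := funext (hw k)
    rw [e]
    exact (h1.comp_aemeasurable (hfm k).aemeasurable).aestronglyMeasurable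
  have hw1 : ∀ k θ, 1 ≤ w k θ ∧ w k θ ≤ 1 + c := by
    intro k θ
    rw [hw]
    split_ifs
    · exact ⟨by linarith, le_rfl⟩
    · exact ⟨le_rfl, by linarith⟩
  have hwlim : Tendsto (fun k => ∫ θ, w k θ ∂circ) atTop (𝓝 1) := by
    have h1 : Tendsto (fun k => ∫ θ, w k θ ∂circ) atTop (𝓝 (∫ _ : UnitAddCircle, (1 : ℝ) ∂circ)) := by
      refine tendsto_integral_of_dominated_convergence (fun _ => 1 + c) hwm (integrable_const _)
        (fun k => ae_of_all _ fun θ => ?_) ?_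
      · rw [Real.norm_of_nonneg (by linarith [hw1 k θ])]
        exact (hw1 k θ).2
      · filter_upwards [hf0] with θ h
        refine tendsto_const_nhds.congr' ?_
        filter_upwards [h.eventually_lt_const hδ] with k hk
        rw [hw, if_neg hk.le.not_gt]
    simpa using h1
  choose p hpH hpw hp1 using fun k => exists_szego (hwm k)
    ((hfs k).mono fun θ h => by simp only [hw, h]) (ae_of_all _ fun θ => (hw1 k θ).1)
    (ae_of_all _ fun θ => (hw1 k θ).2)
  have hplim : Tendsto (fun k => h2sq fun θ =>
      (Matrix.of fun _ _ => p k θ : Matrix Unit Unit ℂ) - Matrix.of fun _ _ => 1) atTop (𝓝 0) := by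
    have h1 : Tendsto (fun k => ENNReal.ofReal (2 * (∫ θ, w k θ ∂circ - 1))) atTop (𝓝 0) := by
      have := ENNReal.tendsto_ofReal ((hwlim.sub_const 1).const_mul 2)
      simpa using this
    exact tendsto_of_tendsto_of_tendsto_of_le_of_le tendsto_const_nhds h1 (fun _ => zero_le) hp1
  obtain ⟨φ, hφ, hpae⟩ := exists_subseq_tendsto_ae
    (fun k i j => (hpH k).memLp.1) (fun i j => aestronglyMeasurable_const) hplim
  obtain ⟨T', hT'⟩ : ∃ T' : ℕ → TransferMatrix (Fin dx ⊕ Fin du) (Fin dw),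
    ∀ k θ, T' k θ = T₀ θ + p k θ • (T θ - T₀ θ) := ⟨_, fun _ _ => rfl⟩
  have hT'l : ∀ k, T' k ∈ loops S ∧ MemH ∞ (T' k) := by
    intro k
    have e : T' k = fun θ => T₀ θ + p k θ • (T θ - T₀ θ) := funext (hT' k)
    rw [e]
    exact ⟨add_smul_sub_mem_loops hT₀ hT.mem (hpH k), hT₀b.add le_top
      (MemH.smul le_top (hpH k) (hT.bounded.sub le_top hT₀b))⟩
  have hdiff : ∀ᵐ θ ∂circ, ‖T θ - T₀ θ‖ ≤ τ + γ₀ := by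
    filter_upwards [hτ, hT₀γ] with θ h1 h2
    exact (norm_sub_le _ _).trans (add_le_add h1 h2)
  have hev : ∀ᶠ k in atTop, ∫ θ, w k θ ∂circ ≤ 2 :=
    (hwlim.eventually_lt_const (show (1 : ℝ) < 2 by norm_num)).mono fun k h => h.le
  have hT'F : ∀ k, ∫ θ, w k θ ∂circ ≤ 2 → ∀ᵐ θ ∂circ, fro (T' k θ) ≤ F ∧
      (δ < f k θ → ‖T' k θ‖ ≤ γ) := by
    intro k hk
    filter_upwards [hpw k, hdiff, hT₀γ] with θ h1 h2 h3
    have h4 : ‖T' k θ‖ ≤ γ₀ + ‖p k θ‖ * (τ + γ₀) := by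
      rw [hT']
      refine (norm_add_le _ _).trans (add_le_add h3 ?_)
      rw [norm_smul]
      exact mul_le_mul_of_nonneg_left h2 (norm_nonneg _)
    have h5 := hw1 k θ
    have h6 : 0 ≤ ‖p k θ‖ := norm_nonneg _
    constructor
    · have h7 : ‖p k θ‖ ≤ 2 := by
        have : ‖p k θ‖ ^ 2 * 1 ≤ ‖p k θ‖ ^ 2 * w k θ :=
          mul_le_mul_of_nonneg_left h5.1 (sq_nonneg _)
        nlinarith
      rw [hF]
      refine fro_le_of_opNorm_le (h4.trans ?_)
      gcongr
    · intro hlt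
      rw [hw, if_pos hlt] at h1
      have h8 : (‖p k θ‖ * (τ + γ₀)) ^ 2 ≤ (γ - γ₀) ^ 2 := by
        have h9 : (1 + c) * (‖p k θ‖ * (τ + γ₀)) ^ 2 ≤ (1 + c) * (γ - γ₀) ^ 2 := by
          calc (1 + c) * (‖p k θ‖ * (τ + γ₀)) ^ 2
              = (‖p k θ‖ ^ 2 * (1 + c)) * (τ + γ₀) ^ 2 := by ring
            _ ≤ 2 * (τ + γ₀) ^ 2 := mul_le_mul_of_nonneg_right (h1.trans hk) (sq_nonneg _)
            _ ≤ _ := hc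
        exact le_of_mul_le_mul_left h9 (by linarith)
      have h10 := abs_le_of_sq_le_sq' h8 (sub_nonneg.2 hγ.le)
      linarith [h10.2]
  -- an upper bound for the density of the Lagrangian at `T' k` and `Λ k`, with a dominated limit: on the
  -- exceptional set the term with `Λ k` is at most zero
  obtain ⟨G, hG⟩ : ∃ G : ℕ → UnitAddCircle → ℝ, ∀ k θ, G k θ = fro (T' k θ) +
      (if δ < f k θ then 0 else wquad (T' k θ) (L θ) - γ ^ 2 * (L θ).trace.re) + ε :=
    ⟨_, fun _ _ => rfl⟩
  have hGm : ∀ k, AEStronglyMeasurable (G k) circ := by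
    intro k
    have e : G k = fun θ => fro (T' k θ) + (if δ < f k θ then 0 else 1) *
        (wquad (T' k θ) (L θ) - γ ^ 2 * (L θ).trace.re) + ε := by
      funext θ
      rw [hG]
      split_ifs <;> simp
    have h1 : Measurable fun x : ℝ => if δ < x then (0 : ℝ) else 1 :=
      Measurable.ite measurableSet_Ioi measurable_const measurable_const
    have h2 : AEStronglyMeasurable (fun θ => if δ < f k θ then (0 : ℝ) else 1) circ :=
      (h1.comp_aemeasurable (hfm k).aemeasurable).aestronglyMeasurable
    rw [e]
    have hTm := (hT'l k).2.entryAESM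
    exact (hTm.fro.add (h2.mul ((hTm.wquad hL.1.entryAESM).sub
      ((integrable_trace hL).1.const_mul _)))).add aestronglyMeasurable_const
  have hGb : ∀ k, ∫ θ, w k θ ∂circ ≤ 2 → ∀ᵐ θ ∂circ,
      ‖G k θ‖ ≤ F + (F + γ ^ 2) * (L θ).trace.re + ε := by
    intro k hk
    filter_upwards [hT'F k hk, hL.2] with θ h1 h2
    have h3 := fro_nonneg (T' k θ)
    have h4 := wquad_nonneg h2 (T' k θ)
    have h5 := trace_re_nonneg h2
    have h6 : wquad (T' k θ) (L θ) ≤ F * (L θ).trace.re :=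
      (wquad_le_fro_mul h2 _).trans (mul_le_mul_of_nonneg_right h1.1 h5)
    have h7 : 0 ≤ F * (L θ).trace.re := mul_nonneg hF0 h5
    have h8 : 0 ≤ γ ^ 2 * (L θ).trace.re := mul_nonneg (sq_nonneg _) h5
    rw [hG, Real.norm_eq_abs, abs_le]
    split_ifs
    · constructor <;> nlinarith [h1.1]
    · constructor <;> nlinarith [h1.1]
  have hGi : ∀ k, ∫ θ, w k θ ∂circ ≤ 2 → Integrable (G k) circ := fun k hk =>
    Integrable.mono' (((integrable_const F).add ((integrable_trace hL).const_mul _)).add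
      (integrable_const ε)) (hGm k) (hGb k hk)
  have hDG : ∀ k, ∫ θ, w k θ ∂circ ≤ 2 → dualValue S γ (Λ k) ≤ ∫ θ, G k θ ∂circ := by
    intro k hk
    refine (ρ.dualValue_le_integral (hT'l k).1 (hT'l k).2 (hΛ k)).trans ?_
    refine integral_mono_ae (density_integral (hT'l k).2 (hΛ k)).1 (hGi k hk) ?_
    filter_upwards [hT'F k hk, (hΛ k).2] with θ h1 h2
    rw [density, hG]
    have h5 := trace_re_nonneg h2
    split_ifs with h
    · have h3 := (wquad_le_opNorm h2 (T' k θ)).trans (mul_le_mul_of_nonneg_right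
        (pow_le_pow_left₀ (norm_nonneg _) (h1.2 h) 2) h5)
      linarith
    · have e : Λ k θ = L θ + (Λ k θ - L θ) := by abel
      have h6 : ∑ i, ∑ j, ‖(Λ k θ - L θ) i j‖ ≤ δ := by
        have := not_lt.1 h
        rwa [hf] at this
      have h7 := (abs_le.1 (abs_wquad_le (T' k θ) (Λ k θ - L θ))).2
      have h8 := (abs_le.1 (abs_trace_re_le (Λ k θ - L θ))).1
      have h9 : fro (T' k θ) * ∑ i, ∑ j, ‖(Λ k θ - L θ) i j‖ ≤ F * δ :=
        mul_le_mul h1.1 h6 (Finset.sum_nonneg fun i _ => Finset.sum_nonneg fun j _ =>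
          norm_nonneg _) hF0
      rw [e, wquad_add, Matrix.trace_add, Complex.add_re]
      nlinarith [mul_le_mul_of_nonneg_left (h6) (sq_nonneg γ),
        mul_le_mul_of_nonneg_left h8 (sq_nonneg γ)]
  have hGlim : Tendsto (fun k => ∫ θ, G (φ k) θ ∂circ) atTop
      (𝓝 (∫ θ, density γ T L θ + ε ∂circ)) := by
    have hev' : ∀ᶠ k in atTop, ∫ θ, w (φ k) θ ∂circ ≤ 2 := hφ.tendsto_atTop.eventually hev
    refine tendsto_integral_filter_of_dominated_convergence
      (fun θ => F + (F + γ ^ 2) * (L θ).trace.re + ε)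
      (Eventually.of_forall fun k => hGm (φ k)) (hev'.mono fun k hk => hGb (φ k) hk)
      (((integrable_const F).add ((integrable_trace hL).const_mul _)).add (integrable_const ε)) ?_
    have hp1 : ∀ᵐ θ ∂circ, Tendsto (fun k => p (φ k) θ) atTop (𝓝 1) :=
      hpae.mono fun θ h => h () ()
    filter_upwards [hp1, hf0] with θ h1 h2
    have h3 : ∀ i j, Tendsto (fun k => T' (φ k) θ i j) atTop (𝓝 (T θ i j)) := by
      intro i j
      have h4 := (h1.mul_const (T θ i j - T₀ θ i j)).const_add (T₀ θ i j)
      rw [one_mul, add_sub_cancel] at h4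
      refine h4.congr fun k => ?_
      rw [hT']
      rfl
    have h5 : Tendsto (fun k => fro (T' (φ k) θ)) atTop (𝓝 (fro (T θ))) := by
      unfold fro
      exact tendsto_finsetSum _ fun i _ => tendsto_finsetSum _ fun j _ => ((h3 i j).norm.pow 2)
    have h6 : Tendsto (fun k => wquad (T' (φ k) θ) (L θ)) atTop (𝓝 (wquad (T θ) (L θ))) :=
      tendsto_wquad h3 fun i j => tendsto_const_nhds
    have h7 := (h5.add (h6.sub_const (γ ^ 2 * (L θ).trace.re))).add_const ε
    refine h7.congr' ?_
    filter_upwards [(h2.comp hφ.tendsto_atTop).eventually_lt_const hδ] with k hk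
    have hk' : f (φ k) θ < δ := hk
    rw [hG, if_neg hk'.le.not_gt]
  have hfinal : d ≤ ∫ θ, density γ T L θ + ε ∂circ := by
    refine le_of_tendsto_of_tendsto (ha.comp hφ.tendsto_atTop) hGlim ?_
    filter_upwards [hφ.tendsto_atTop.eventually hev] with k hk
    exact (haΛ _).trans (hDG _ hk)
  rw [integral_add (density_integral hT.bounded hL).1 (integrable_const _),
    hT.integral_eq hL] at hfinal
  simpa using hfinal

open scoped Matrix.Norms.L2Operator in
/-- The maximum of the dual function is attained. -/
theorem Regulator.exists_isMaxOn_dualValue (ρ : Regulator S) (hT₀ : T₀ ∈ loops S) {γ₀ : ℝ}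
    (hγ₀ : 0 ≤ γ₀) (hγ : γ₀ < γ) (hT₀γ : ∀ᵐ θ ∂circ, ‖T₀ θ‖ ≤ γ₀) :
    ∃ L ∈ multipliers dw, ∀ L' ∈ multipliers dw, dualValue S γ L' ≤ dualValue S γ L := by
  have hpos : 0 < γ ^ 2 - γ₀ ^ 2 := by nlinarith
  have hle : ∀ L ∈ multipliers dw, dualValue S γ L ≤ (h2sq T₀).toReal := by
    intro L hL
    have h1 := ρ.dualValue_le (γ := γ) hL hT₀ hT₀γ
    nlinarith [ntrace_nonneg hL]
  have hne : (dualValue S γ '' multipliers dw).Nonempty := ⟨_, _, zero_mem_multipliers, rfl⟩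
  have hbdd : BddAbove (dualValue S γ '' multipliers dw) :=
    ⟨(h2sq T₀).toReal, by rintro _ ⟨L, hL, rfl⟩; exact hle L hL⟩
  set d := sSup (dualValue S γ '' multipliers dw) with hd
  have hled : ∀ L ∈ multipliers dw, dualValue S γ L ≤ d := fun L hL => le_csSup hbdd ⟨L, hL, rfl⟩
  -- the superlevel sets of the dual function; strict feasibility bounds the traces on them
  obtain ⟨C, hCdef⟩ : ∃ C : ℕ → Set (TransferMatrix (Fin dw) (Fin dw)), ∀ k L, L ∈ C k ↔
    L ∈ multipliers dw ∧ d - 1 / ((k : ℝ) + 1) ≤ dualValue S γ L :=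
    ⟨fun k => {L | L ∈ multipliers dw ∧ d - 1 / ((k : ℝ) + 1) ≤ dualValue S γ L},
      fun _ _ => Iff.rfl⟩
  have hε : ∀ k : ℕ, 0 < 1 / ((k : ℝ) + 1) ∧ 1 / ((k : ℝ) + 1) ≤ 1 := fun k =>
    ⟨by positivity, by
      rw [div_le_one (by positivity)]
      linarith [(k.cast_nonneg : (0 : ℝ) ≤ k)]⟩
  obtain ⟨Λ, hΛ, L, hL, hlim⟩ := exists_tendsto_multipliers (C := C)
    (fun k L h => ((hCdef k L).1 h).1)
    (fun k k' hkk' L h => by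
      obtain ⟨h1, h2⟩ := (hCdef k' L).1 h
      refine (hCdef k L).2 ⟨h1, le_trans ?_ h2⟩
      have : 1 / ((k' : ℝ) + 1) ≤ 1 / ((k : ℝ) + 1) :=
        one_div_le_one_div_of_le (by positivity) (by
          have : (k : ℝ) ≤ k' := by exact_mod_cast hkk'
          linarith)
      linarith)
    (fun k => by
      obtain ⟨_, ⟨L, hL, rfl⟩, h⟩ := exists_lt_of_lt_csSup hne
        (show d - 1 / ((k : ℝ) + 1) < sSup (dualValue S γ '' multipliers dw) by
          linarith [(hε k).1])
      exact ⟨L, (hCdef k L).2 ⟨hL, h.le⟩⟩)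
    (fun k L h L' h' => by
      obtain ⟨h1, h2⟩ := (hCdef k L).1 h
      obtain ⟨h3, h4⟩ := (hCdef k L').1 h'
      refine (hCdef k _).2 ⟨?_, ?_⟩
      · have := add_smul_mem_multipliers h1 h3 (a := 1 / 2) (b := 1 / 2) (by norm_num)
          (by norm_num)
        simpa only [smul_add] using this
      · have := ρ.half_add_half_le_dualValue (γ := γ) h1 h3
        linarith)
    (M := ((h2sq T₀).toReal - d + 1) / (γ ^ 2 - γ₀ ^ 2))
    (fun k L h => by
      obtain ⟨h1, h2⟩ := (hCdef k L).1 h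
      have h3 := ρ.dualValue_le (γ := γ) h1 hT₀ hT₀γ
      rw [le_div_iff₀ hpos]
      linarith [(hε k).2])
  have ha : Tendsto (fun k : ℕ => d - 1 / ((k : ℝ) + 1)) atTop (𝓝 d) := by
    simpa using (tendsto_one_div_add_atTop_nhds_zero_nat (𝕜 := ℝ)).const_sub d
  have h := ρ.le_dualValue_of_tendsto hT₀ hγ₀ hγ hT₀γ (fun k => ((hCdef k _).1 (hΛ k)).1) hL hlim ha
    fun k => ((hCdef k _).1 (hΛ k)).2
  exact ⟨L, hL, fun L' hL' => (hled L' hL').trans h⟩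

end attainment

/-! ### From closed loops back to controllers -/

section controllers
variable {dx du dw : ℕ} {S : System dx du dw} {γ : ℝ} {L : TransferMatrix (Fin dw) (Fin dw)}
  {K : TransferMatrix (Fin du) (Fin dw)} {T T' : TransferMatrix (Fin dx ⊕ Fin du) (Fin dw)}

theorem clHinf_eq (h : IsClosedLoop S K T) : clHinf S K = hinf T :=
  atClosedLoop_eq h fun _ h => hinf_congr_ae h

theorem clH2sq_eq (h : IsClosedLoop S K T) : clH2sq S K = h2sq T :=
  atClosedLoop_eq h fun _ h => h2sq_congr_ae h

theorem lagrangian_eq (h : IsClosedLoop S K T) : lagrangian S γ K L =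
    ((wtrace T fun θ => 1 + L θ : ℝ≥0∞) : EReal) - ((γ ^ 2 * ntrace L : ℝ) : EReal) := by
  rw [lagrangian, atClosedLoop_eq h fun _ h => wtrace_congr_ae h _]

open scoped Matrix.Norms.L2Operator in
theorem mem_feasible_iff (hγ : 0 ≤ γ) : K ∈ feasible S γ ↔ K ∈ controllers du dw ∧
    ∃ T, IsClosedLoop S K T ∧ ∀ᵐ θ ∂circ, ‖T θ‖ ≤ γ := by
  constructor
  · rintro ⟨hK, h⟩
    obtain ⟨T, hT⟩ := exists_isClosedLoop_of_lt_top (F := hinf) (h.trans_lt ENNReal.ofReal_lt_top)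
    rw [clHinf_eq hT] at h
    exact ⟨hK, T, hT, (hinf_le_iff hγ).1 h⟩
  · rintro ⟨hK, T, hT, h⟩
    refine ⟨hK, ?_⟩
    rw [clHinf_eq hT]
    exact (hinf_le_iff hγ).2 h

open scoped Matrix.Norms.L2Operator in
/-- A strictly feasible closed loop. -/
theorem exists_strictly_feasible (h : gammaInf S < ENNReal.ofReal γ) :
    ∃ T ∈ loops S, ∃ γ₀, 0 ≤ γ₀ ∧ γ₀ < γ ∧ ∀ᵐ θ ∂circ, ‖T θ‖ ≤ γ₀ := by
  obtain ⟨K, h⟩ := iInf_lt_iff.1 h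
  obtain ⟨hK, h⟩ := iInf_lt_iff.1 h
  obtain ⟨T, hT⟩ := exists_isClosedLoop_of_lt_top (F := hinf) (h.trans ENNReal.ofReal_lt_top)
  rw [clHinf_eq hT] at h
  have hfin : hinf T ≠ ∞ := (h.trans ENNReal.ofReal_lt_top).ne
  refine ⟨T, ((isClosedLoop_iff hK).1 hT).1, (hinf T).toReal, ENNReal.toReal_nonneg, ?_,
    (hinf_le_iff ENNReal.toReal_nonneg).1 (ENNReal.ofReal_toReal hfin).ge⟩
  exact (ENNReal.lt_ofReal_iff_toReal_lt hfin).1 h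

theorem coe_le_coe_sub_coe_iff {x : ℝ≥0∞} {v c : ℝ} (h : 0 ≤ v + c) :
    (v : EReal) ≤ (x : EReal) - (c : EReal) ↔ ENNReal.ofReal (v + c) ≤ x := by
  rw [EReal.le_sub_iff_add_le (.inl (EReal.coe_ne_bot _)) (.inl (EReal.coe_ne_top _)),
    ← EReal.coe_add, ← EReal.coe_ennreal_le_coe_ennreal_iff, EReal.coe_ennreal_ofReal,
    max_eq_left h]

theorem coe_sub_coe_le_coe_iff {x : ℝ≥0∞} {v c : ℝ} (h : 0 ≤ v + c) :
    (x : EReal) - (c : EReal) ≤ (v : EReal) ↔ x ≤ ENNReal.ofReal (v + c) := by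
  rw [EReal.sub_le_iff_le_add (.inl (EReal.coe_ne_bot _)) (.inl (EReal.coe_ne_top _)),
    ← EReal.coe_add, ← EReal.coe_ennreal_le_coe_ennreal_iff, EReal.coe_ennreal_ofReal,
    max_eq_left h]

/-- A controller is optimal for the Lagrangian when its closed loop attains the dual value. -/
theorem lagrangian_le_iff : lagrangian S γ K L ≤ (dualValue S γ L : EReal) ↔
    ∃ T, IsClosedLoop S K T ∧
      wtrace T (fun θ => 1 + L θ) ≤ ENNReal.ofReal (dualValue S γ L + γ ^ 2 * ntrace L) := by
  constructor
  · intro h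
    have h1 := (coe_sub_coe_le_coe_iff dualValue_add_nonneg).1 h
    obtain ⟨T, hT⟩ := exists_isClosedLoop_of_lt_top (h1.trans_lt ENNReal.ofReal_lt_top)
    refine ⟨T, hT, ?_⟩
    rwa [lagrangian_eq hT, coe_sub_coe_le_coe_iff dualValue_add_nonneg] at h
  · rintro ⟨T, hT, h⟩
    rwa [lagrangian_eq hT, coe_sub_coe_le_coe_iff dualValue_add_nonneg]

theorem Regulator.dualValue_le_lagrangian (ρ : Regulator S) (hL : L ∈ multipliers dw)
    (hK : K ∈ controllers du dw) : (dualValue S γ L : EReal) ≤ lagrangian S γ K L := by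
  rw [lagrangian, coe_le_coe_sub_coe_iff dualValue_add_nonneg]
  refine le_iInf₂ fun T hT => ?_
  obtain ⟨T', hT'⟩ := ρ.exists_isDualMinimizer hL γ
  exact hT'.le ((isClosedLoop_iff hK).1 hT).1

theorem Regulator.exists_lagrangian_eq (ρ : Regulator S) (hL : L ∈ multipliers dw) (γ : ℝ) :
    ∃ K ∈ controllers du dw, lagrangian S γ K L = (dualValue S γ L : EReal) := by
  obtain ⟨T, hT⟩ := ρ.exists_isDualMinimizer hL γ
  obtain ⟨hK, hcl⟩ := isClosedLoop_of_memH hT.mem hT.bounded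
  exact ⟨_, hK, le_antisymm (lagrangian_le_iff.2 ⟨T, hcl, hT.eq.le⟩)
    (ρ.dualValue_le_lagrangian hL hK)⟩

theorem Regulator.dualFunction_eq (ρ : Regulator S) (hL : L ∈ multipliers dw) (γ : ℝ) :
    dualFunction S γ L = (dualValue S γ L : EReal) := by
  obtain ⟨K, hK, h⟩ := ρ.exists_lagrangian_eq hL γ
  exact le_antisymm (h ▸ iInf₂_le K hK)
    (le_iInf₂ fun K' hK' => ρ.dualValue_le_lagrangian hL hK')

/-- The minimizer of the Lagrangian is unique up to null sets. -/
theorem IsDualMinimizer.ae_eq (h : IsDualMinimizer S γ L T) (hT' : T' ∈ loops S)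
    (hle : wtrace T' (fun θ => 1 + L θ) ≤ ENNReal.ofReal (dualValue S γ L + γ ^ 2 * ntrace L)) :
    T' =ᵐ[circ] T := by
  have h1 := (h.growth T' hT').trans hle
  have h2 : ENNReal.ofReal (1 / 2) * h2sq (fun θ => T' θ - T θ) ≤ 0 := by
    refine (ENNReal.add_le_add_iff_left (ENNReal.ofReal_ne_top
      (r := dualValue S γ L + γ ^ 2 * ntrace L))).1 ?_
    rwa [add_zero]
  have h3 : h2sq (fun θ => T' θ - T θ) = 0 := by
    rcases mul_eq_zero.1 (le_zero_iff.1 h2) with h | h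
    · norm_num at h
    · exact h
  have hm := hT'.1.entryAESM.sub h.mem.1.entryAESM
  rw [h2sq_eq_lintegral_fro, lintegral_eq_zero_iff' hm.fro.aemeasurable.ennreal_ofReal] at h3
  filter_upwards [h3] with θ h4
  have h5 : fro (T' θ - T θ) ≤ 0 := ENNReal.ofReal_eq_zero.1 h4
  ext i j
  have h6 := (norm_sq_le_fro (T' θ - T θ) i j).trans h5
  have h7 : ‖(T' θ - T θ) i j‖ = 0 := by nlinarith [norm_nonneg ((T' θ - T θ) i j)]
  exact sub_eq_zero.1 (norm_eq_zero.1 h7)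

open scoped Matrix.Norms.L2Operator in
theorem wtrace_le_of_feasible (hL : L ∈ multipliers dw) (hT : T ∈ loops S)
    (hTγ : ∀ᵐ θ ∂circ, ‖T θ‖ ≤ γ) {d : ℝ} (hd : 0 ≤ d) (h : h2sq T ≤ ENNReal.ofReal d) :
    wtrace T (fun θ => 1 + L θ) ≤ ENNReal.ofReal (d + γ ^ 2 * ntrace L) := by
  rw [wtrace_one_add hT.1.entryAESM hL,
    ENNReal.ofReal_add hd (mul_nonneg (sq_nonneg _) (ntrace_nonneg hL))]
  exact add_le_add h (wtrace_le_of_opNorm_le hL hTγ)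

end controllers

end MixedControl

end

open MixedControl in
theorem theorem1 {dx du dw : ℕ} (S : System dx du dw)
    (hu : Stabilizable S.A S.Bu) (hw : Stabilizable S.A S.Bw) (γ : ℝ)
    (hγ_inf : gammaInf S < ENNReal.ofReal γ) (hγ_two : ENNReal.ofReal γ < gammaTwo S) :
    -- the inner minimum is attained, for every dual variable
    (∀ L ∈ multipliers dw, ∃ K ∈ controllers du dw, lagrangian S γ K L = dualFunction S γ L) ∧
    -- the minimum of the primal problem and the maximum of the dual problem exist and coincide
    (∃ v : ℝ,
      IsLeast ((fun K => (clH2sq S K : EReal)) '' feasible S γ) (v : EReal) ∧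
      IsGreatest (dualFunction S γ '' multipliers dw) (v : EReal)) ∧
    -- the solutions of the primal problem are the controllers that solve the max-min problem
    (∀ L ∈ multipliers dw, IsMaxOn (dualFunction S γ) (multipliers dw) L →
      ∀ K, (K ∈ feasible S γ ∧ IsMinOn (clH2sq S) (feasible S γ) K) ↔
        (K ∈ controllers du dw ∧
          IsMinOn (fun K' => lagrangian S γ K' L) (controllers du dw) K)) := by
  obtain ⟨ρ⟩ := exists_regulator S hu
  obtain ⟨T₀, hT₀, γ₀, hγ₀, hγ₀γ, hT₀γ⟩ := exists_strictly_feasible hγ_inf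
  have hγ : 0 ≤ γ := hγ₀.trans hγ₀γ.le
  obtain ⟨L₀, hL₀, hmax⟩ := ρ.exists_isMaxOn_dualValue hT₀ hγ₀ hγ₀γ hT₀γ
  set d : ℝ := dualValue S γ L₀ with hd
  have hd0 : 0 ≤ d := by
    have h1 : 0 ≤ dualValue S γ (fun _ => (0 : Matrix (Fin dw) (Fin dw) ℂ)) + γ ^ 2 *
      ntrace (fun _ => (0 : Matrix (Fin dw) (Fin dw) ℂ)) := dualValue_add_nonneg
    have h2 : ntrace (fun _ => (0 : Matrix (Fin dw) (Fin dw) ℂ)) = 0 := by simp [ntrace]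
    rw [h2, mul_zero, add_zero] at h1
    exact h1.trans (hmax _ zero_mem_multipliers)
  obtain ⟨T, hT, hTγ, hTd⟩ := ρ.exists_primal_le (d := d) hγ
    ⟨by rintro _ ⟨L, hL, rfl⟩; exact hmax L hL, fun b hb => hb ⟨L₀, hL₀, rfl⟩⟩
  obtain ⟨hK, hcl⟩ := isClosedLoop_of_memH hT (hT.1.top_of_opNorm_le hTγ)
  have hKf := (mem_feasible_iff hγ).2 ⟨hK, T, hcl, hTγ⟩
  have hweak : ∀ K ∈ feasible S γ, ENNReal.ofReal d ≤ clH2sq S K := by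
    intro K hK
    obtain ⟨hKc, T', hT', hT'γ⟩ := (mem_feasible_iff hγ).1 hK
    have hT'l := ((isClosedLoop_iff hKc).1 hT').1
    have h1 := ρ.dualValue_le (γ := γ) hL₀ hT'l hT'γ
    rw [sub_self, zero_mul, add_zero] at h1
    rw [clH2sq_eq hT', ← ENNReal.ofReal_toReal (h2sq_lt_top_of_mem_loops hT'l).ne]
    exact ENNReal.ofReal_le_ofReal h1
  have hval := le_antisymm ((clH2sq_eq hcl).trans_le hTd) (hweak _ hKf)
  have hcoe : ((ENNReal.ofReal d : ℝ≥0∞) : EReal) = (d : EReal) := by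
    rw [EReal.coe_ennreal_ofReal, max_eq_left hd0]
  refine ⟨fun L hL => ?_, ⟨d, ⟨⟨_, hKf, ?_⟩, ?_⟩, ⟨L₀, hL₀, ρ.dualFunction_eq hL₀ γ⟩, ?_⟩,
    fun L hL hLmax K => ?_⟩
  · rw [ρ.dualFunction_eq hL]
    exact ρ.exists_lagrangian_eq hL γ
  · dsimp only
    rw [hval, hcoe]
  · rintro _ ⟨K, hK, rfl⟩
    dsimp only
    rw [← hcoe]
    exact EReal.coe_ennreal_le_coe_ennreal_iff.2 (hweak K hK)
  · rintro _ ⟨L, hL, rfl⟩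
    rw [ρ.dualFunction_eq hL]
    exact EReal.coe_le_coe_iff.2 (hmax L hL)
  · have hLd : dualValue S γ L = d := by
      refine le_antisymm (hmax L hL) ?_
      have h1 : dualFunction S γ L₀ ≤ dualFunction S γ L := hLmax hL₀
      rw [ρ.dualFunction_eq hL, ρ.dualFunction_eq hL₀] at h1
      exact EReal.coe_le_coe_iff.1 h1
    constructor
    · rintro ⟨hKf', hmin⟩
      obtain ⟨hKc, T', hT', hT'γ⟩ := (mem_feasible_iff hγ).1 hKf'
      have h1 : h2sq T' ≤ ENNReal.ofReal d := by
        rw [← clH2sq_eq hT', ← hval]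
        exact hmin hKf
      have h2 : lagrangian S γ K L ≤ (dualValue S γ L : EReal) := by
        refine lagrangian_le_iff.2 ⟨T', hT', ?_⟩
        rw [hLd]
        exact wtrace_le_of_feasible hL ((isClosedLoop_iff hKc).1 hT').1 hT'γ hd0 h1
      exact ⟨hKc, fun K' hK' => h2.trans (ρ.dualValue_le_lagrangian hL hK')⟩
    · rintro ⟨hKc, hmin⟩
      obtain ⟨K', hK', h1⟩ := ρ.exists_lagrangian_eq hL γ
      have h2 : lagrangian S γ K L ≤ (dualValue S γ L : EReal) := (hmin hK').trans_eq h1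
      obtain ⟨T', hT', hT'L⟩ := lagrangian_le_iff.1 h2
      -- both `T'` and the optimal closed loop `T` of the primal problem minimize the Lagrangian
      obtain ⟨Tm, hTm⟩ := ρ.exists_isDualMinimizer hL γ
      have h3 : T' =ᵐ[circ] T := by
        refine (hTm.ae_eq ((isClosedLoop_iff hKc).1 hT').1 hT'L).trans (hTm.ae_eq hT ?_).symm
        rw [hLd]
        exact wtrace_le_of_feasible hL hT hTγ hd0 hTd
      refine ⟨(mem_feasible_iff hγ).2 ⟨hKc, T', hT', ?_⟩, fun K'' hK'' => ?_⟩
      · filter_upwards [h3, hTγ] with θ h4 h5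
        rwa [h4]
      · have h4 : clH2sq S K = ENNReal.ofReal d := by
          rw [clH2sq_eq hT', h2sq_congr_ae h3, ← clH2sq_eq hcl, hval]
        have h5 := hweak K'' hK''
        rw [← h4] at h5
        exact h5
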